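/- **Notation.** Functions on $\mathbb R^n$ are complex-valued; $B(r)$ is the ball of radius $r$ centred at $0$; $[t]$ is the integer part of $t$; $\mathcal F f(\xi)=(2\pi)^{-n/2}\int f(x)e^{-ix\cdot\xi}\,dx$; $\sigma_j=\sigma(2^{-j}\cdot)$ and $\sigma_j(D)f=\mathcal F^{-1}[\sigma_j\cdot\mathcal F f]$ for $j\in\mathbb Z$. $\mathcal S_\infty$ is the space of Schwartz functions all of whose moments $\int x^\alpha\rho(x)\,dx$ vanish, with the topology induced by $\mathcal S$; $\mathcal S_\infty'$ is its topological dual with the topology of pointwise convergence. $\mathcal P\subset\mathcal S'$ is the space of polynomials, $\mathcal P_d$ the space of polynomials of degree at most $d$. There is a canonical map $\mathcal S'/\mathcal P\to\mathcal S_\infty'$, $[T]\mapsto T|_{\mathcal S_\infty}$. Let $\Delta^1_yF=F(\cdot+y)-F$ and $\Delta^{m+1}_yF=\Delta^m_y(\Delta^1_yF)$. For $s>0$, $\dot{\mathcal C}^s$ is the set of continuous functions $F$ on $\mathbb R^n$ with $$\|F\|_{\dot{\mathcal C}^s}=\sup_{y\ne0}\frac{\|\Delta_y^{[s+1]}F\|_{L^\infty}}{|y|^s}<\infty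 .$$ Fix $\theta\in\mathcal S$ with $\chi_{B(4)\setminus B(2)}\le\theta\le\chi_{B(8)\setminus B(1)}$. The space $\dot B^s_{\infty\infty}$ consists of the classes $[f]\in\mathcal S'/\mathcal P$ for which $\sup_{j\in\mathbb Z}2^{js}\|\theta_j(D)f\|_{L^\infty}<\infty$; this does not depend on the representative $f$. **Theorem.** Let $s>0$. Let $\psi\in\mathcal S$ satisfy $\chi_{B(1)}\le\psi\le\chi_{B(2)}$ and set $\varphi=\psi(2^{-1}\cdot)-\psi$. 1. For $F\in\dot{\mathcal C}^s$ and $\rho\in\mathcal S_\infty$ the function $F\rho$ is integrable, and $F\mapsto\big(\rho\mapsto\int_{\mathbb R^n}F(x)\rho(x)\,dx\big)$ induces a well-defined, linear, injective and continuous map from the quotient $\dot{\mathcal C}^s/\mathcal P_{[s]}$ (with the quotient norm) into $\mathcal S_\infty'$. 2. For every $F\in\dot{\mathcal C}^s$, the functional $f:\rho\in\mathcal S_\infty\mapsto\int_{\mathbb R^n}F(x)\rho(x)\,dx$ belongs to $\dot B^s_{\infty\infty}$, i.e. it is the image under $\mathcal S'/\mathcal P\to\mathcal S_\infty'$ of an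 element of $\dot B^s_{\infty\infty}$. 3. Let $f\in\mathcal S'$ with $[f]\in\dot B^s_{\infty\infty}$. Then each $\varphi_j(D)f$ is a $C^\infty$ function, and there is a continuous function $F\in\dot{\mathcal C}^s$, defining a tempered distribution, such that $f-F\in\mathcal P$. More precisely, $F$ can be taken as $F=G+H$ with $G\in C^\infty$ and $H$ continuous such that $$\partial^\alpha G=\sum_{j=-\infty}^0\partial^\alpha[\varphi_j(D)f]\quad\text{for all multi-indices }|\alpha|\ge[s+1],\qquad H=\sum_{j=1}^\infty\varphi_j(D)f,$$ all the series converging uniformly on $\mathbb R^n$. -/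

import Mathlib

open MeasureTheory Filter Topology
open scoped SchwartzMap FourierTransform ContDiff ENNReal Real

namespace HomBesov

noncomputable section

/-- The Euclidean space `ℝⁿ`. -/
abbrev E (n : ℕ) : Type := EuclideanSpace ℝ (Fin n)

/-! ### Monomials, the space `𝓢_∞`, its dual, and `𝓢'/𝒫` -/

/-- The monomial `x ↦ x^α`. -/
def mono {n : ℕ} (α : Fin n → ℕ) (x : E n) : ℂ := ∏ i, ((x i : ℝ) : ℂ) ^ α i

theorem mono_hasTemperateGrowth {n : ℕ} (α : Fin n → ℕ) :
    Function.HasTemperateGrowth (mono α : E n → ℂ) := by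
  have key : ∀ s : Finset (Fin n), Function.HasTemperateGrowth
      (fun x : E n => ∏ i ∈ s, ((x i : ℝ) : ℂ) ^ α i) := by
    intro s
    induction s using Finset.induction_on with
    | empty => simp only [Finset.prod_empty]; exact Function.HasTemperateGrowth.const (E := E n) (1 : ℂ)
    | insert a s ha ih =>
      simp only [Finset.prod_insert ha]
      refine Function.HasTemperateGrowth.mul (Function.HasTemperateGrowth.pow ?_ _) ih
      have h1 : Function.HasTemperateGrowth (fun x : E n => x a) :=
        (EuclideanSpace.proj a : E n →L[ℝ] ℝ).hasTemperateGrowth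
      exact Function.HasTemperateGrowth.comp Function.Complex.hasTemperateGrowth_ofReal h1
  exact key Finset.univ

/-- The tempered distribution `φ ↦ ∫ x^α φ(x) dx`. -/
def monoDist {n : ℕ} (α : Fin n → ℕ) : 𝓢'(E n, ℂ) :=
  Function.HasTemperateGrowth.toTemperedDistribution volume (mono_hasTemperateGrowth α)

theorem monoDist_apply {n : ℕ} (α : Fin n → ℕ) (φ : 𝓢(E n, ℂ)) :
    monoDist α φ = ∫ x, φ x * mono α x := rfl

/-- The space `𝒫` of polynomials, as a subspace of `𝓢'`. -/
def polyDist (n : ℕ) : Submodule ℂ 𝓢'(E n, ℂ) :=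
  Submodule.span ℂ (Set.range (monoDist (n := n)))

/-- `𝓢_∞`: Schwartz functions all of whose moments vanish, with the subspace topology. -/
def schwartzInf (n : ℕ) : Submodule ℂ 𝓢(E n, ℂ) where
  carrier := {φ | ∀ α : Fin n → ℕ, ∫ x, φ x * mono α x = 0}
  zero_mem' := by intro α; simp
  add_mem' := by
    intro φ ψ hφ hψ α
    have h := map_add (monoDist α) φ ψ
    rw [monoDist_apply, monoDist_apply, monoDist_apply, hφ α, hψ α, add_zero] at h
    exact h
  smul_mem' := by
    intro c φ hφ α
    have h := map_smul (monoDist α) c φ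
    rw [monoDist_apply, monoDist_apply, hφ α, smul_zero] at h
    exact h

/-- `𝓢_∞'`: the continuous linear functionals on `𝓢_∞`, with the topology of pointwise
convergence. -/
abbrev SchwartzInfDual (n : ℕ) : Type := schwartzInf n →Lₚₜ[ℂ] ℂ

/-- Restriction `𝓢' → 𝓢_∞'`. -/
def restrict (n : ℕ) : 𝓢'(E n, ℂ) →L[ℂ] SchwartzInfDual n :=
  PointwiseConvergenceCLM.precomp ℂ (schwartzInf n).subtypeL

/-- The quotient `𝓢'/𝒫`. -/
abbrev DistModPoly (n : ℕ) : Type := 𝓢'(E n, ℂ) ⧸ polyDist n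

theorem polyDist_le_ker_restrict (n : ℕ) :
    polyDist n ≤ LinearMap.ker (restrict n).toLinearMap := by
  refine Submodule.span_le.2 ?_
  rintro _ ⟨α, rfl⟩
  ext φ
  exact φ.2 α

/-- The canonical map `𝓢'/𝒫 → 𝓢_∞'`, `[T] ↦ T|𝓢_∞`. -/
def restrictQuot (n : ℕ) : DistModPoly n →ₗ[ℂ] SchwartzInfDual n :=
  (polyDist n).liftQ (restrict n).toLinearMap (polyDist_le_ker_restrict n)

/-- `F` is (locally integrable and) the function representing the tempered distribution `T`:
`T φ = ∫ F φ`. -/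
def Represents {n : ℕ} (F : E n → ℂ) (T : 𝓢'(E n, ℂ)) : Prop :=
  ∀ φ : 𝓢(E n, ℂ), Integrable (fun x => F x * φ x) ∧ T φ = ∫ x, F x * φ x

/-! ### Fourier multipliers and the homogeneous Besov space -/

/-- The Fourier multiplier `σ(D)T = 𝓕⁻¹[σ · 𝓕 T]`, where `𝓕 f(ξ) = (2π)^{-n/2} ∫ f(x) e^{-i x·ξ} dx`.
Mathlib's Fourier transform has the phase `e^{-2π i x·ξ}`, whence the dilation by `2π`. -/
def multiplier {n : ℕ} (σ : E n → ℝ) (T : 𝓢'(E n, ℂ)) : 𝓢'(E n, ℂ) :=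
  TemperedDistribution.fourierMultiplierCLM ℂ (fun ξ : E n => ((σ ((2 * π) • ξ) : ℝ) : ℂ)) T

/-- The dyadic dilate `σ_j = σ(2^{-j} ·)`. -/
def dyadic {n : ℕ} (σ : E n → ℝ) (j : ℤ) (ξ : E n) : ℝ := σ ((2 : ℝ) ^ (-j) • ξ)

/-- `χ_{B(4) ∖ B(2)} ≤ θ ≤ χ_{B(8) ∖ B(1)}`. -/
def IsAnnulusCutoff {n : ℕ} (θ : 𝓢(E n, ℝ)) : Prop :=
  ∀ ξ : E n,
    (Metric.ball (0 : E n) 4 \ Metric.ball 0 2).indicator (fun _ => (1 : ℝ)) ξ ≤ θ ξ ∧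
    θ ξ ≤ (Metric.ball (0 : E n) 8 \ Metric.ball 0 1).indicator (fun _ => (1 : ℝ)) ξ

/-- `χ_{B(1)} ≤ ψ ≤ χ_{B(2)}`. -/
def IsBallCutoff {n : ℕ} (ψ : 𝓢(E n, ℝ)) : Prop :=
  ∀ ξ : E n,
    (Metric.ball (0 : E n) 1).indicator (fun _ => (1 : ℝ)) ξ ≤ ψ ξ ∧
    ψ ξ ≤ (Metric.ball (0 : E n) 2).indicator (fun _ => (1 : ℝ)) ξ

/-- The `L^∞` norm of a tempered distribution: it is `∞` unless the distribution is given by an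
`L^∞` function. -/
def linftyNorm {n : ℕ} (T : 𝓢'(E n, ℂ)) : ℝ≥0∞ :=
  ⨅ (g : Lp ℂ (⊤ : ℝ≥0∞) (volume : Measure (E n))) (_ : Lp.toTemperedDistribution g = T), ‖g‖ₑ

/-- `sup_j 2^{js} ‖𝓕⁻¹[θ_j · 𝓕 T]‖_∞`. -/
def besovNorm {n : ℕ} (θ : 𝓢(E n, ℝ)) (s : ℝ) (T : 𝓢'(E n, ℂ)) : ℝ≥0∞ :=
  ⨆ j : ℤ, ENNReal.ofReal ((2 : ℝ) ^ ((j : ℝ) * s)) * linftyNorm (multiplier (dyadic θ j) T)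

/-- The homogeneous Besov space `Ḃ^s_{∞∞} ⊆ 𝓢'/𝒫`. Its defining norm does not depend on the
representative of a class, see `mk_mem_besov_iff`. -/
def besov {n : ℕ} (θ : 𝓢(E n, ℝ)) (s : ℝ) : Set (DistModPoly n) :=
  {f | ∃ T : 𝓢'(E n, ℂ), (polyDist n).mkQ T = f ∧ besovNorm θ s T < ⊤}

/-! ### The Hölder–Zygmund space -/

/-- The set of difference quotients `|Δ_y^{[s+1]} F(x)| / |y|^s`. (For `y = 0` and `s > 0` the
quotient is `0 / 0 = 0`.) -/
def zygQuot {n : ℕ} (s : ℝ) (F : E n → ℂ) (p : E n × E n) : ℝ :=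
  ‖((fwdDiff p.2)^[⌊s + 1⌋₊] F) p.1‖ / ‖p.2‖ ^ s

theorem fwdDiff_iter_add' {n : ℕ} (y : E n) (m : ℕ) (F G : E n → ℂ) :
    (fwdDiff y)^[m] (F + G) = (fwdDiff y)^[m] F + (fwdDiff y)^[m] G := fwdDiff_iter_add y F G m

theorem fwdDiff_iter_smul' {n : ℕ} (y : E n) (m : ℕ) (c : ℂ) (F : E n → ℂ) :
    (fwdDiff y)^[m] (c • F) = c • (fwdDiff y)^[m] F := fwdDiff_iter_const_smul y c F m

theorem zygQuot_nonneg {n : ℕ} (s : ℝ) (F : E n → ℂ) (p : E n × E n) : 0 ≤ zygQuot s F p := by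
  unfold zygQuot; positivity

theorem zygQuot_add_le {n : ℕ} (s : ℝ) (F G : E n → ℂ) (p : E n × E n) :
    zygQuot s (F + G) p ≤ zygQuot s F p + zygQuot s G p := by
  unfold zygQuot
  rw [fwdDiff_iter_add', Pi.add_apply, ← add_div]
  gcongr
  exact norm_add_le _ _

theorem zygQuot_smul {n : ℕ} (s : ℝ) (c : ℂ) (F : E n → ℂ) (p : E n × E n) :
    zygQuot s (c • F) p = ‖c‖ * zygQuot s F p := by
  unfold zygQuot
  rw [fwdDiff_iter_smul', Pi.smul_apply, norm_smul, mul_div_assoc]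

theorem zygQuot_zero {n : ℕ} (s : ℝ) (p : E n × E n) : zygQuot s (0 : E n → ℂ) p = 0 := by
  simpa using zygQuot_smul s 0 (0 : E n → ℂ) p

/-- Continuous functions `F : ℝⁿ → ℂ` with
`sup_{x, y} |Δ_y^{[s+1]} F(x)| / |y|^s < ∞`. -/
def zygSubmodule (n : ℕ) (s : ℝ) : Submodule ℂ (E n → ℂ) where
  carrier := {F | Continuous F ∧ BddAbove (Set.range (zygQuot s F))}
  zero_mem' := by
    refine ⟨continuous_const, 0, ?_⟩
    rintro _ ⟨p, rfl⟩
    exact (zygQuot_zero s p).le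
  add_mem' := by
    rintro F G ⟨hF, A, hA⟩ ⟨hG, B, hB⟩
    refine ⟨hF.add hG, A + B, ?_⟩
    rintro _ ⟨p, rfl⟩
    exact (zygQuot_add_le s F G p).trans (add_le_add (hA ⟨p, rfl⟩) (hB ⟨p, rfl⟩))
  smul_mem' := by
    rintro c F ⟨hF, A, hA⟩
    refine ⟨hF.const_smul c, ‖c‖ * A, ?_⟩
    rintro _ ⟨p, rfl⟩
    rw [zygQuot_smul]
    exact mul_le_mul_of_nonneg_left (hA ⟨p, rfl⟩) (norm_nonneg c)

/-- The homogeneous Hölder–Zygmund space, before passing to the quotient. It is a type of its own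
because its topology comes from the seminorm and not from pointwise convergence. -/
def Zyg (n : ℕ) (s : ℝ) : Type := zygSubmodule n s

instance (n : ℕ) (s : ℝ) : AddCommGroup (Zyg n s) :=
  inferInstanceAs (AddCommGroup (zygSubmodule n s))

instance (n : ℕ) (s : ℝ) : Module ℂ (Zyg n s) :=
  inferInstanceAs (Module ℂ (zygSubmodule n s))

/-- The inclusion of the Hölder–Zygmund space into the functions `ℝⁿ → ℂ`. -/
def Zyg.toFun (n : ℕ) (s : ℝ) : Zyg n s →ₗ[ℂ] (E n → ℂ) := (zygSubmodule n s).subtype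

theorem Zyg.bdd {n : ℕ} {s : ℝ} (F : Zyg n s) :
    BddAbove (Set.range (zygQuot s (Zyg.toFun n s F))) := F.2.2

/-- The seminorm `sup_{x, y} |Δ_y^{[s+1]} F(x)| / |y|^s`. -/
def zygSeminorm (n : ℕ) (s : ℝ) : Seminorm ℂ (Zyg n s) :=
  Seminorm.of (fun F => ⨆ p : E n × E n, zygQuot s (Zyg.toFun n s F) p)
    (by
      intro F G
      refine ciSup_le fun p => ?_
      rw [map_add]
      exact (zygQuot_add_le s _ _ p).trans
        (add_le_add (le_ciSup (Zyg.bdd F) p) (le_ciSup (Zyg.bdd G) p)))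
    (by
      intro c F
      simp only [map_smul, zygQuot_smul]
      exact (Real.mul_iSup_of_nonneg (norm_nonneg c) _).symm)

instance (n : ℕ) (s : ℝ) : SeminormedAddCommGroup (Zyg n s) :=
  (zygSeminorm n s).toSeminormedAddCommGroup

/-- Evaluation of polynomials as functions on `ℝⁿ`. -/
def polyEval (n : ℕ) : MvPolynomial (Fin n) ℂ →ₗ[ℂ] (E n → ℂ) where
  toFun p x := MvPolynomial.eval (fun i => ((x i : ℝ) : ℂ)) p
  map_add' p q := by ext x; simp
  map_smul' c p := by ext x; simp [MvPolynomial.smul_eval]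

/-- `𝒫_d`: polynomials of degree at most `d`, as a subspace of the Hölder–Zygmund space. -/
def polyZyg (n : ℕ) (s : ℝ) (d : ℕ) : Submodule ℂ (Zyg n s) :=
  ((MvPolynomial.restrictTotalDegree (Fin n) ℂ d).map (polyEval n)).comap (Zyg.toFun n s)

/-- The homogeneous Hölder–Zygmund space `Ċ^s`, taken modulo `𝒫_{[s]}`, with the quotient norm. -/
abbrev ZygQuot (n : ℕ) (s : ℝ) : Type := Zyg n s ⧸ polyZyg n s ⌊s⌋₊

/-- The partial derivative `∂_{i_1} ⋯ ∂_{i_k} F`; these are the `∂^α F` with `|α| = k`. -/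
def partialDeriv {n k : ℕ} (i : Fin k → Fin n) (F : E n → ℂ) (x : E n) : ℂ :=
  iteratedFDeriv ℝ k F x (fun l => EuclideanSpace.single (i l) (1 : ℝ))

/-! ### The Besov norm does not depend on the representative -/

theorem eventually_lineDeriv {n : ℕ} (h : 𝓢(E n, ℂ)) (hh : ⇑h =ᶠ[𝓝 0] 0) (m : E n) :
    ⇑(LineDeriv.lineDerivOp m h : 𝓢(E n, ℂ)) =ᶠ[𝓝 0] 0 := by
  filter_upwards [hh.eventuallyEq_nhds] with x hx
  rw [SchwartzMap.lineDerivOp_apply_eq_fderiv, hx.fderiv_eq]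
  simp

theorem poly_mul_fourier {n : ℕ} (p : MvPolynomial (Fin n) ℂ) :
    ∀ h : 𝓢(E n, ℂ), ⇑h =ᶠ[𝓝 0] 0 → ∃ h' : 𝓢(E n, ℂ), ⇑h' =ᶠ[𝓝 0] 0 ∧
      ∀ x, polyEval n p x * (𝓕 h) x = (𝓕 h') x := by
  induction p using MvPolynomial.induction_on with
  | C a =>
    intro h hh
    refine ⟨a • h, ?_, fun x => ?_⟩
    · filter_upwards [hh] with x hx
      simp [hx]
    · rw [FourierTransform.fourier_smul]
      simp [polyEval]
  | add p q hp hq =>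
    intro h hh
    obtain ⟨h1, e1, f1⟩ := hp h hh
    obtain ⟨h2, e2, f2⟩ := hq h hh
    refine ⟨h1 + h2, ?_, fun x => ?_⟩
    · filter_upwards [e1, e2] with x hx1 hx2
      simp [hx1, hx2]
    · rw [FourierTransform.fourier_add, map_add, Pi.add_apply, add_mul, f1, f2]
      rfl
  | mul_X p i hp =>
    intro h hh
    have hc : (2 * π * Complex.I : ℂ) ≠ 0 := by
      simp [Real.pi_ne_zero]
    obtain ⟨h1, e1, f1⟩ := hp _ (eventually_lineDeriv h hh (EuclideanSpace.single i 1))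
    refine ⟨(2 * π * Complex.I : ℂ)⁻¹ • h1, ?_, fun x => ?_⟩
    · filter_upwards [e1] with x hx
      simp [hx]
    · rw [FourierTransform.fourier_smul, smul_apply, ← f1,
        SchwartzMap.fourier_lineDerivOp_eq]
      have : Function.HasTemperateGrowth
          (fun y : E n => inner ℝ y (EuclideanSpace.single i (1 : ℝ))) := by fun_prop
      rw [smul_apply, SchwartzMap.smulLeftCLM_apply_apply this]
      have e : inner ℝ x (EuclideanSpace.single i (1 : ℝ)) = x i := by
        simp [EuclideanSpace.inner_single_right]
      rw [e]
      simp only [polyEval, LinearMap.coe_mk, AddHom.coe_mk, map_mul, MvPolynomial.eval_X,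
        smul_eq_mul, Complex.real_smul]
      field_simp

theorem fourier_mem_schwartzInf {n : ℕ} (h : 𝓢(E n, ℂ)) (hh : ⇑h =ᶠ[𝓝 0] 0) :
    𝓕 h ∈ schwartzInf n := by
  intro α
  obtain ⟨h', e, f⟩ := poly_mul_fourier (∏ i, MvPolynomial.X i ^ α i) h hh
  have h1 : ∀ x, (𝓕 h) x * mono α x = (𝓕 h') x := by
    intro x
    rw [← f x, mul_comm]
    simp [polyEval, mono]
  simp only [h1]
  have h2 : (𝓕⁻ (𝓕 h')) (0 : E n) = 0 := by
    rw [FourierTransform.fourierInv_fourier_eq]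
    exact e.eq_of_nhds
  rw [SchwartzMap.fourierInv_coe, Real.fourierInv_eq] at h2
  simpa using h2

theorem multiplier_polyDist {n : ℕ} (θ : 𝓢(E n, ℝ)) (hθ : IsAnnulusCutoff θ) (j : ℤ)
    (P : 𝓢'(E n, ℂ)) (hP : P ∈ polyDist n) : multiplier (dyadic θ j) P = 0 := by
  ext u
  rw [multiplier, TemperedDistribution.fourierMultiplierCLM_apply_apply]
  set σ : E n → ℂ := fun ξ => ((dyadic θ j ((2 * π) • ξ) : ℝ) : ℂ) with hσ
  have hσ0 : σ =ᶠ[𝓝 0] 0 := by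
    have hc : Continuous (fun ξ : E n => (2 : ℝ) ^ (-j) • (2 * π) • ξ) := by fun_prop
    have : ∀ᶠ ξ in 𝓝 (0 : E n), (2 : ℝ) ^ (-j) • (2 * π) • ξ ∈ Metric.ball (0 : E n) 1 := by
      refine hc.continuousAt.eventually_mem ?_
      simpa using Metric.ball_mem_nhds (0 : E n) one_pos
    filter_upwards [this] with ξ hξ
    have h1 := (hθ ((2 : ℝ) ^ (-j) • (2 * π) • ξ)).1
    have h2 := (hθ ((2 : ℝ) ^ (-j) • (2 * π) • ξ)).2
    rw [Set.indicator_of_notMem (fun h => h.2 hξ)] at h2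
    have h3 := (Set.indicator_nonneg (fun _ _ => zero_le_one) _).trans h1
    simp only [hσ, dyadic, Pi.zero_apply, Complex.ofReal_eq_zero]
    exact le_antisymm h2 h3
  have hσt : Function.HasTemperateGrowth σ := by
    have h1 : Function.HasTemperateGrowth (fun ξ : E n => (2 : ℝ) ^ (-j) • (2 * π) • ξ) := by
      fun_prop
    exact Function.HasTemperateGrowth.comp Function.Complex.hasTemperateGrowth_ofReal
      (Function.HasTemperateGrowth.comp θ.hasTemperateGrowth h1)
  have hmem := fourier_mem_schwartzInf (SchwartzMap.smulLeftCLM ℂ σ (𝓕⁻ u)) (by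
    filter_upwards [hσ0] with ξ hξ
    rw [SchwartzMap.smulLeftCLM_apply_apply hσt, hξ]
    simp)
  have := polyDist_le_ker_restrict n hP
  exact congrArg (fun T : SchwartzInfDual n => T ⟨_, hmem⟩) this

/-- Membership in `Ḃ^s_{∞∞}` may be tested on any representative. -/
theorem mk_mem_besov_iff {n : ℕ} (θ : 𝓢(E n, ℝ)) (hθ : IsAnnulusCutoff θ) (s : ℝ)
    (T : 𝓢'(E n, ℂ)) : (polyDist n).mkQ T ∈ besov θ s ↔ besovNorm θ s T < ⊤ := by
  refine ⟨?_, fun h => ⟨T, rfl, h⟩⟩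
  rintro ⟨T', hT', h⟩
  have hP : T' - T ∈ polyDist n := by
    rw [← (polyDist n).ker_mkQ, LinearMap.mem_ker, map_sub, hT', sub_self]
  have : ∀ j, multiplier (dyadic θ j) T' = multiplier (dyadic θ j) T := by
    intro j
    have := multiplier_polyDist θ hθ j _ hP
    rw [multiplier, map_sub, sub_eq_zero] at this
    exact this
  simpa only [besovNorm, this] using h

end

end HomBesov

namespace HomBesov

/-! ### Functions representing tempered distributions -/

/-! The proof is a Littlewood–Paley analysis and resynthesis. Put M = [s+1], so that 0 < s < M.

Analysis: a continuous F with |Δ_y^M F| ≤ K|y|^s grows at most polynomially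
(`exists_polynomial_growth`), so it defines a tempered distribution. The symbol of Δ_y^M is
(e^{iy·ξ} − 1)^M. On the annulus carrying θ, the symbols for small steps along the coordinate axes
have no common zero, so θ is a combination of them (`IsAnnulusCutoff.exists_decomposition`).
Rescaling gives ‖θ_j(D)F‖_∞ ≤ C K 2^{-js}, which is Besov membership.

Synthesis: from ‖θ_j(D)f‖_∞ ≤ A 2^{-js}, Bernstein's inequality bounds the k-th derivatives of
φ_j(D)f by C_k A 2^{j(k-s)} (`exists_pieces`). As s > 0, the pieces with j ≥ 1 sum uniformly to H.
For j ≤ 0 only derivatives of order above s are summable, so the Taylor polynomial of order < M at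
the origin is subtracted from each piece before summing to G. In Δ_y^M(G + H), frequencies above
1/|y| are estimated by the supremum and those below by the M-th derivative. Both sides decay
geometrically and give |y|^s (`exists_reconstruction`).

Comparison: the φ_j telescope to 1 away from ξ = 0, and the subtracted polynomials vanish on 𝓢_∞.
Hence f − (G + H) has Fourier transform supported at the origin and is a polynomial
(`mem_polyDist_of_vanishing`, `Reconstruction.sub_mem_polyDist`).

The embedding: if F annihilates 𝓢_∞, the same support theorem makes F a polynomial, and homogeneity
bounds its degree by [s] (`totalDegree_le_of_fwdDiff_le`), whence injectivity. Continuity also uses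
the synthesis: F agrees on 𝓢_∞ with its reconstruction, whose pointwise growth is bounded linearly
by the seminorm of F, whereas F itself is controlled only up to polynomials. -/

theorem Represents.unique {n : ℕ} {F : E n → ℂ} {S T : 𝓢'(E n, ℂ)} (hS : Represents F S)
    (hT : Represents F T) : S = T := by
  ext u
  rw [(hS u).2, (hT u).2]

theorem integrable_bdd_mul_schwartz {n : ℕ} {g : E n → ℂ} (hg : AEStronglyMeasurable g volume)
    {A : ℝ} (hA : ∀ x, ‖g x‖ ≤ A) (u : 𝓢(E n, ℂ)) : Integrable (fun x => g x * u x) :=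
  u.integrable.bdd_mul hg (Eventually.of_forall hA)

theorem represents_toTemperedDistribution {n : ℕ} {g : E n → ℂ}
    (hg : MemLp g ⊤ (volume : Measure (E n))) :
    Represents g (Lp.toTemperedDistribution hg.toLp) := by
  intro u
  constructor
  · have h := MemLp.integrable_mul (u.memLp 1 volume) hg
    refine h.congr (Eventually.of_forall fun x => ?_)
    simp [mul_comm]
  · rw [Lp.toTemperedDistribution_apply]
    refine integral_congr_ae ?_
    filter_upwards [hg.coeFn_toLp] with x hx
    rw [hx, smul_eq_mul, mul_comm]

/-- Dividing F by the weight (1 + |x|²)^N leaves an L^∞ function. The weight has temperate growth,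
so it can be multiplied back at the level of distributions. -/
theorem exists_represents {n : ℕ} {F : E n → ℂ} (hF : AEStronglyMeasurable F volume) {C : ℝ} {N : ℕ}
    (h : ∀ x, ‖F x‖ ≤ C * (1 + ‖x‖ ^ 2) ^ N) : ∃ T : 𝓢'(E n, ℂ), Represents F T := by
  set w : E n → ℂ := fun x => (((1 + ‖x‖ ^ 2) ^ N : ℝ) : ℂ) with hw
  have hwt : Function.HasTemperateGrowth w := by
    refine Function.HasTemperateGrowth.comp Function.Complex.hasTemperateGrowth_ofReal ?_
    exact ((Function.HasTemperateGrowth.const (1 : ℝ)).add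
      (Function.hasTemperateGrowth_norm_sq (E n))).pow N
  have hpos : ∀ x : E n, 0 < (1 + ‖x‖ ^ 2) ^ N := fun x => by positivity
  have hw0 : ∀ x, w x ≠ 0 := fun x => by
    simp only [hw, ne_eq, Complex.ofReal_eq_zero]; exact (hpos x).ne'
  have hwc : Continuous w := by fun_prop
  set g : E n → ℂ := fun x => F x * (w x)⁻¹ with hg
  have hgm : AEStronglyMeasurable g volume :=
    hF.mul (hwc.inv₀ hw0).aestronglyMeasurable
  have hgb : ∀ x, ‖g x‖ ≤ C := by
    intro x
    rw [hg, norm_mul, norm_inv, Complex.norm_real, Real.norm_of_nonneg (hpos x).le,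
      ← div_eq_mul_inv, div_le_iff₀ (hpos x)]
    exact h x
  have hmem : MemLp g ⊤ (volume : Measure (E n)) :=
    memLp_top_of_bound hgm C (Eventually.of_forall hgb)
  refine ⟨TemperedDistribution.smulLeftCLM ℂ w (Lp.toTemperedDistribution hmem.toLp), fun u => ?_⟩
  have key : ∀ x, g x * (SchwartzMap.smulLeftCLM ℂ w u) x = F x * u x := by
    intro x
    rw [SchwartzMap.smulLeftCLM_apply_apply hwt, smul_eq_mul, hg]
    field_simp [hw0 x]
  have := represents_toTemperedDistribution hmem (SchwartzMap.smulLeftCLM ℂ w u)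
  simp only [key] at this
  exact this

/-! ### Mollification of bounded functions -/

section Mollify

variable {n : ℕ} {V : Type} [NormedAddCommGroup V] [NormedSpace ℝ V]

/-- An integrable majorant, uniform for z in the unit ball around x, for differentiating
convolutions under the integral. The exponent n + 1 makes it integrable on ℝⁿ. -/
theorem schwartz_decay_shift (K : 𝓢(E n, V)) : ∃ D : ℝ, ∀ x z y : E n, dist z x < 1 →
    ‖K (z - y)‖ ≤ D * (1 + ‖x - y‖) ^ (-((n : ℝ) + 1)) := by
  set D := 2 ^ (n + 1) * (Finset.Iic ((n + 1, 0) : ℕ × ℕ)).sup (fun m => SchwartzMap.seminorm ℝ m.1 m.2) K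
  refine ⟨2 ^ (n + 1) * D, fun x z y hz => ?_⟩
  have h1 := SchwartzMap.one_add_le_sup_seminorm_apply (𝕜 := ℝ) (m := (n + 1, 0)) (k := n + 1)
    (n := 0) le_rfl le_rfl K (z - y)
  rw [norm_iteratedFDeriv_zero] at h1
  have h2 : 1 + ‖x - y‖ ≤ 2 * (1 + ‖z - y‖) := by
    have : ‖x - y‖ ≤ ‖x - z‖ + ‖z - y‖ := norm_sub_le_norm_sub_add_norm_sub x z y
    rw [← dist_eq_norm x z, dist_comm] at this
    linarith [norm_nonneg (z - y)]
  have h3 : (1 + ‖x - y‖) ^ (-((n : ℝ) + 1)) = ((1 + ‖x - y‖) ^ (n + 1))⁻¹ := by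
    rw [Real.rpow_neg (by positivity)]; norm_cast
  rw [h3, ← div_eq_mul_inv, le_div_iff₀ (by positivity)]
  calc ‖K (z - y)‖ * (1 + ‖x - y‖) ^ (n + 1) ≤ ‖K (z - y)‖ * (2 * (1 + ‖z - y‖)) ^ (n + 1) := by
        gcongr
    _ = 2 ^ (n + 1) * ((1 + ‖z - y‖) ^ (n + 1) * ‖K (z - y)‖) := by rw [mul_pow]; ring
    _ ≤ _ := by gcongr

variable [NormedSpace ℂ V]

theorem integrable_decay_shift (x : E n) (D : ℝ) :
    Integrable (fun y : E n => D * (1 + ‖x - y‖) ^ (-((n : ℝ) + 1))) := by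
  have h : Integrable (fun y : E n => (1 + ‖y‖) ^ (-((n : ℝ) + 1))) :=
    integrable_one_add_norm (by simp)
  exact (h.comp_sub_left x).const_mul D

/-- Convolution of a function with a Schwartz kernel. -/
noncomputable def mollify (g : E n → ℂ) (K : 𝓢(E n, V)) (x : E n) : V := ∫ y, g y • K (x - y)

theorem mollify_aestronglyMeasurable {g : E n → ℂ} (hg : AEStronglyMeasurable g volume)
    (K : 𝓢(E n, V)) (x : E n) : AEStronglyMeasurable (fun y => g y • K (x - y)) volume :=
  hg.smul (K.continuous.comp (continuous_const.sub continuous_id)).aestronglyMeasurable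

theorem mollify_integrable {g : E n → ℂ} (hg : AEStronglyMeasurable g volume)
    {A : ℝ} (hA : ∀ x, ‖g x‖ ≤ A) (K : 𝓢(E n, V)) (x : E n) :
    Integrable (fun y => g y • K (x - y)) := by
  have hi : Integrable (fun y => K (x - y)) := K.integrable.comp_sub_left x
  exact hi.bdd_smul A hg (Eventually.of_forall hA)

theorem mollify_hasFDerivAt {g : E n → ℂ} (hg : AEStronglyMeasurable g volume)
    {A : ℝ} (hA : ∀ x, ‖g x‖ ≤ A) (K : 𝓢(E n, V)) (x : E n) :
    HasFDerivAt (mollify g K) (mollify g (SchwartzMap.fderivCLM ℝ (E n) V K) x) x := by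
  obtain ⟨D, hD⟩ := schwartz_decay_shift (SchwartzMap.fderivCLM ℝ (E n) V K)
  refine hasFDerivAt_integral_of_dominated_of_fderiv_le
    (F := fun x y => g y • K (x - y))
    (F' := fun x y => g y • (SchwartzMap.fderivCLM ℝ (E n) V K) (x - y))
    (bound := fun y => A * (D * (1 + ‖x - y‖) ^ (-((n : ℝ) + 1)))) (Metric.ball_mem_nhds x one_pos)
    (Eventually.of_forall fun z => mollify_aestronglyMeasurable hg K z)
    (mollify_integrable hg hA K x) (mollify_aestronglyMeasurable hg _ x) ?_
    ((integrable_decay_shift x D).const_mul A) ?_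
  · refine Eventually.of_forall fun y z hz => ?_
    rw [norm_smul]
    have := hD x z y hz
    have h0 := (norm_nonneg (g y)).trans (hA y)
    exact mul_le_mul (hA y) this (norm_nonneg _) h0
  · refine Eventually.of_forall fun y z _ => ?_
    have h1 : HasFDerivAt (fun z => K (z - y)) (fderiv ℝ K (z - y)) z := by
      have := (K.hasFDerivAt (z - y)).comp z ((hasFDerivAt_id z).sub_const y)
      simpa [Function.comp_def] using this
    rw [SchwartzMap.fderivCLM_apply]
    exact h1.const_smul (g y)

theorem mollify_norm_le {g : E n → ℂ} {A : ℝ} (hA : ∀ x, ‖g x‖ ≤ A) (K : 𝓢(E n, V)) (x : E n) :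
    ‖mollify g K x‖ ≤ (∫ y, ‖K y‖) * A := by
  have hi : Integrable (fun y => K (x - y)) := K.integrable.comp_sub_left x
  calc ‖mollify g K x‖ ≤ ∫ y, ‖K (x - y)‖ * A := by
        refine norm_integral_le_of_norm_le (hi.norm.mul_const A) (Eventually.of_forall fun y => ?_)
        rw [norm_smul, mul_comm]
        gcongr
        exact hA y
    _ = _ := by
        rw [integral_mul_const, integral_sub_left_eq_self (fun y => ‖K y‖) volume x]

end Mollify

/-- All derivatives fall on the kernel. The target V is quantified inside the induction because
differentiating replaces a V-valued kernel by one valued in linear maps E → V. -/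
theorem mollify_contDiff_nat {n : ℕ} {g : E n → ℂ} (hg : AEStronglyMeasurable g volume)
    {A : ℝ} (hA : ∀ x, ‖g x‖ ≤ A) (k : ℕ) : ∀ (V : Type) [NormedAddCommGroup V] [NormedSpace ℝ V]
    [NormedSpace ℂ V] (K : 𝓢(E n, V)),
    ContDiff ℝ k (mollify g K) := by
  induction k with
  | zero =>
    intro V _ _ _ K
    have : Differentiable ℝ (mollify g K) :=
      fun x => (mollify_hasFDerivAt hg hA K x).differentiableAt
    simpa using this.continuous
  | succ k ih =>
    intro V _ _ _ K
    have h1 : fderiv ℝ (mollify g K) = mollify g (SchwartzMap.fderivCLM ℝ (E n) V K) :=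
      funext fun x => (mollify_hasFDerivAt hg hA K x).fderiv
    push_cast
    refine contDiff_succ_iff_fderiv.2
      ⟨fun x => (mollify_hasFDerivAt hg hA K x).differentiableAt, by simp, ?_⟩
    rw [h1]
    exact ih _ _

/-- The constant is an L¹ norm of a derivative of K. It is chosen before g and A, which later yields
bounds uniform over all dyadic scales. -/
theorem mollify_iteratedFDeriv_le {n : ℕ} (k : ℕ) : ∀ (V : Type) [NormedAddCommGroup V]
    [NormedSpace ℝ V] [NormedSpace ℂ V] (K : 𝓢(E n, V)),
    ∃ C : ℝ, 0 ≤ C ∧ ∀ (g : E n → ℂ) (A : ℝ), AEStronglyMeasurable g volume → (∀ x, ‖g x‖ ≤ A) →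
    ∀ x, ‖iteratedFDeriv ℝ k (mollify g K) x‖ ≤ C * A := by
  induction k with
  | zero =>
    intro V _ _ _ K
    refine ⟨∫ y, ‖K y‖, by positivity, fun g A _ hA x => ?_⟩
    rw [norm_iteratedFDeriv_zero]
    exact mollify_norm_le hA K x
  | succ k ih =>
    intro V _ _ _ K
    obtain ⟨C, hC, h⟩ := ih _ (SchwartzMap.fderivCLM ℝ (E n) V K)
    refine ⟨C, hC, fun g A hg hA x => ?_⟩
    have h1 : fderiv ℝ (mollify g K) = mollify g (SchwartzMap.fderivCLM ℝ (E n) V K) :=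
      funext fun x => (mollify_hasFDerivAt hg hA K x).fderiv
    rw [← norm_iteratedFDeriv_fderiv, h1]
    exact h g A hg hA x

/-! ### Multipliers acting on bounded functions -/

theorem hasTemperateGrowth_cexp_mul_I :
    Function.HasTemperateGrowth (fun t : ℝ => Complex.exp (t * Complex.I)) := by
  have h1 : ∀ k : ℕ, iteratedDeriv k (fun t : ℝ => Complex.exp (t * Complex.I)) =
      fun t : ℝ => Complex.I ^ k * Complex.exp (t * Complex.I) := by
    intro k
    induction k with
    | zero => simp
    | succ k ih =>
      rw [iteratedDeriv_succ, ih]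
      funext t
      have h2 : HasDerivAt (fun t : ℝ => (t : ℂ) * Complex.I) Complex.I t := by
        simpa using (Complex.ofRealCLM.hasDerivAt (x := t)).mul_const Complex.I
      rw [(h2.cexp.const_mul (Complex.I ^ k)).deriv]
      ring
  refine ⟨(Complex.ofRealCLM.contDiff.mul contDiff_const).cexp, fun k => ⟨0, 1, fun t => ?_⟩⟩
  rw [norm_iteratedFDeriv_eq_norm_iteratedDeriv, h1]
  simp [Complex.norm_exp_ofReal_mul_I]

/-- The character `ξ ↦ e^{2πi ⟨ξ, y⟩}`. -/
noncomputable def character {n : ℕ} (y ξ : E n) : ℂ :=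
  Complex.exp (((2 * π * inner ℝ ξ y : ℝ) : ℂ) * Complex.I)

theorem character_hasTemperateGrowth {n : ℕ} (y : E n) :
    Function.HasTemperateGrowth (character y) := by
  have h : Function.HasTemperateGrowth (fun ξ : E n => 2 * π * inner ℝ ξ y) :=
    (Function.HasTemperateGrowth.const (2 * π)).mul (Function.hasTemperateGrowth_inner_left y)
  exact Function.HasTemperateGrowth.comp (g := fun t : ℝ => Complex.exp (t * Complex.I))
    hasTemperateGrowth_cexp_mul_I h

theorem character_add {n : ℕ} (y z ξ : E n) :
    character (y + z) ξ = character y ξ * character z ξ := by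
  simp only [character]
  rw [← Complex.exp_add, inner_add_right]
  congr 1
  push_cast
  ring

theorem fourierInv_eq_character {n : ℕ} (S : 𝓢(E n, ℂ)) (x : E n) :
    (𝓕⁻ S) x = ∫ ξ, character x ξ * S ξ := by
  rw [SchwartzMap.fourierInv_coe, Real.fourierInv_eq']
  rfl

theorem fourier_eq_character {n : ℕ} (S : 𝓢(E n, ℂ)) (x : E n) :
    (𝓕 S) x = ∫ ξ, character (-x) ξ * S ξ := by
  rw [SchwartzMap.fourier_coe, Real.fourier_eq']
  simp [character]

theorem fourierInv_character_mul {n : ℕ} (S : 𝓢(E n, ℂ)) (x y : E n) :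
    (𝓕⁻ (SchwartzMap.smulLeftCLM ℂ (character y) S)) x = (𝓕⁻ S) (x + y) := by
  rw [fourierInv_eq_character, fourierInv_eq_character]
  congr 1
  funext ξ
  rw [SchwartzMap.smulLeftCLM_apply_apply (character_hasTemperateGrowth y), smul_eq_mul,
    character_add, mul_assoc]

theorem fourier_character_mul {n : ℕ} (S : 𝓢(E n, ℂ)) (x y : E n) :
    (𝓕 (SchwartzMap.smulLeftCLM ℂ (character y) S)) x = (𝓕 S) (x - y) := by
  rw [fourier_eq_character, fourier_eq_character]
  congr 1
  funext ξ
  rw [SchwartzMap.smulLeftCLM_apply_apply (character_hasTemperateGrowth y), smul_eq_mul,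
    ← mul_assoc, ← character_add]
  congr 2
  abel

/-- Evaluation at y is absorbed into S as a character. Then 𝓕⁻ is moved from u to S by its symmetry
under the integral, and the character becomes a translation. -/
theorem fourier_smulLeft_fourierInv_apply {n : ℕ} (S u : 𝓢(E n, ℂ)) (y : E n) :
    (𝓕 (SchwartzMap.smulLeftCLM ℂ (S : E n → ℂ) (𝓕⁻ u))) y = ∫ x, u x * (𝓕⁻ S) (x - y) := by
  have h := SchwartzMap.integral_fourierInv_mul_eq (SchwartzMap.smulLeftCLM ℂ (character (-y)) S) u
  simp only [fourierInv_character_mul, ← sub_eq_add_neg] at h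
  rw [fourier_eq_character]
  refine Eq.trans ?_ (h.symm.trans ?_)
  · congr 1
    funext ξ
    rw [SchwartzMap.smulLeftCLM_apply_apply (character_hasTemperateGrowth _),
      SchwartzMap.smulLeftCLM_apply_apply S.hasTemperateGrowth, smul_eq_mul, smul_eq_mul, mul_assoc]
  · congr 1
    funext x
    rw [mul_comm]

/-- The multiplier is defined by duality on test functions. Fubini transfers the convolution from
the test function to g. -/
theorem represents_multiplier_schwartz {n : ℕ} (S : 𝓢(E n, ℂ)) {g : E n → ℂ} {A : ℝ}
    (hg : AEStronglyMeasurable g volume) (hA : ∀ x, ‖g x‖ ≤ A) {T : 𝓢'(E n, ℂ)}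
    (hT : Represents g T) :
    Represents (mollify g (𝓕⁻ S)) (TemperedDistribution.fourierMultiplierCLM ℂ (S : E n → ℂ) T) := by
  intro u
  have hb : Continuous (mollify g (𝓕⁻ S)) := by
    have := mollify_contDiff_nat hg hA 0 ℂ (𝓕⁻ S)
    exact this.continuous
  refine ⟨integrable_bdd_mul_schwartz hb.aestronglyMeasurable (mollify_norm_le hA (𝓕⁻ S)) u, ?_⟩
  rw [TemperedDistribution.fourierMultiplierCLM_apply_apply, (hT _).2]
  simp only [fourier_smulLeft_fourierInv_apply, mollify, smul_eq_mul]
  have hint : Integrable (fun p : E n × E n => g p.1 * (u p.2 * (𝓕⁻ S) (p.2 - p.1)))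
      (volume.prod volume) := by
    have h1 : Integrable (fun p : E n × E n => u p.2 * (𝓕⁻ S) (p.2 - p.1))
        (volume.prod volume) := by
      have h2 : Integrable (fun p : E n × E n => u p.1 * (𝓕⁻ S) (p.1 - p.2))
          (volume.prod volume) := by
        have h3 : Integrable (fun y => (𝓕⁻ S) (-y)) := (𝓕⁻ S).integrable.comp_neg
        have h4 := (u.integrable (μ := volume)).mul_prod h3
        have h5 : MeasurePreserving (fun p : E n × E n => (p.1, p.2 - p.1))
            (volume.prod volume) (volume.prod volume) :=
          measurePreserving_prod_sub volume volume
        refine (h5.integrable_comp h4.aestronglyMeasurable |>.2 h4).congr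
          (Eventually.of_forall fun p => ?_)
        simp
      exact h2.swap
    exact h1.bdd_mul (c := A) (hg.comp_fst) (Eventually.of_forall fun p => hA _)
  calc ∫ y, g y * ∫ x, u x * (𝓕⁻ S) (x - y)
      = ∫ y, ∫ x, g y * (u x * (𝓕⁻ S) (x - y)) := by
        congr 1; funext y; rw [integral_const_mul]
    _ = ∫ x, ∫ y, g y * (u x * (𝓕⁻ S) (x - y)) := integral_integral_swap hint
    _ = _ := by
        congr 1; funext x
        rw [← integral_mul_const]
        congr 1; funext y; ring

theorem fourierInv_comp_smul {n : ℕ} (κ S : 𝓢(E n, ℂ)) {r : ℝ} (hr : 0 < r)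
    (hS : ∀ ξ, S ξ = κ (r⁻¹ • ξ)) (x : E n) : (𝓕⁻ S) x = (r : ℂ) ^ n * (𝓕⁻ κ) (r • x) := by
  rw [fourierInv_eq_character, fourierInv_eq_character]
  have h := Measure.integral_comp_inv_smul_of_nonneg (volume : Measure (E n))
    (fun ξ => character (r • x) ξ * κ ξ) hr.le
  rw [finrank_euclideanSpace_fin] at h
  have h2 : ∀ ξ, character x ξ * S ξ = character (r • x) (r⁻¹ • ξ) * κ (r⁻¹ • ξ) := by
    intro ξ
    rw [hS, character, character, real_inner_smul_left, real_inner_smul_right, inv_mul_cancel_left₀ hr.ne']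
  simp only [h2]
  rw [h, Complex.real_smul]
  push_cast
  rfl

/-- The multiplier `κ(r⁻¹ D)` maps functions bounded by `A` to smooth functions with derivatives
controlled by powers of `r`. -/
theorem exists_represents_multiplier {n : ℕ} (κ : 𝓢(E n, ℂ)) : ∃ C : ℕ → ℝ, (∀ k, 0 ≤ C k) ∧
    ∀ (r : ℝ), 0 < r → ∀ (g : E n → ℂ) (A : ℝ), AEStronglyMeasurable g volume →
    (∀ x, ‖g x‖ ≤ A) → ∀ T : 𝓢'(E n, ℂ), Represents g T → ∃ b : E n → ℂ, ContDiff ℝ ∞ b ∧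
    (∀ k x, ‖iteratedFDeriv ℝ k b x‖ ≤ C k * A * r ^ k) ∧
    Represents b (TemperedDistribution.fourierMultiplierCLM ℂ (fun ξ => κ (r⁻¹ • ξ)) T) := by
  choose C hC h using fun k => mollify_iteratedFDeriv_le k ℂ (𝓕⁻ κ)
  refine ⟨C, hC, fun r hr g A hg hA T hT => ?_⟩
  set e : E n ≃L[ℝ] E n := ContinuousLinearEquiv.smulLeft (Units.mk0 r⁻¹ (inv_ne_zero hr.ne'))
  set S : 𝓢(E n, ℂ) := SchwartzMap.compCLMOfContinuousLinearEquiv ℂ e κ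
  have hS : ∀ ξ, S ξ = κ (r⁻¹ • ξ) := fun ξ => rfl
  -- Dilating g instead of the kernel keeps 𝓕⁻κ fixed, so the constants do not depend on r. The
  -- factor rⁿ of the dilated kernel cancels the Jacobian, and each derivative brings out one r.
  set g' : E n → ℂ := fun y => g (r⁻¹ • y)
  have hg' : AEStronglyMeasurable g' volume :=
    hg.comp_quasiMeasurePreserving (Measure.quasiMeasurePreserving_smul volume (inv_ne_zero hr.ne'))
  have hA' : ∀ x, ‖g' x‖ ≤ A := fun x => hA _
  have hcd : ContDiff ℝ ∞ (mollify g' (𝓕⁻ κ)) :=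
    contDiff_infty.2 fun k => mollify_contDiff_nat hg' hA' k ℂ _
  have heq : mollify g (𝓕⁻ S) = fun x => mollify g' (𝓕⁻ κ) (r • x) := by
    funext x
    have h1 := Measure.integral_comp_smul_of_nonneg (volume : Measure (E n))
      (fun y => g' y • (𝓕⁻ κ) (r • x - y)) r (hR := hr.le)
    rw [finrank_euclideanSpace_fin] at h1
    have h2 : ∀ y, g y • (𝓕⁻ S) (x - y) =
        (r : ℂ) ^ n * (g' (r • y) • (𝓕⁻ κ) (r • x - r • y)) := by
      intro y
      rw [fourierInv_comp_smul κ S hr hS, smul_sub]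
      simp only [g', inv_smul_smul₀ hr.ne', smul_eq_mul]
      ring
    have hr0 : (r : ℂ) ≠ 0 := Complex.ofReal_ne_zero.2 hr.ne'
    simp only [mollify, h2]
    rw [integral_const_mul, h1, Complex.real_smul]
    push_cast
    field_simp
  refine ⟨mollify g (𝓕⁻ S), ?_, ?_, represents_multiplier_schwartz S hg hA hT⟩
  · rw [heq]
    exact hcd.comp (contDiff_const_smul r)
  · intro k x
    rw [heq, iteratedFDeriv_comp_const_smul r (hcd.of_le (by exact_mod_cast le_top)) ]
    rw [norm_smul, norm_pow, Real.norm_of_nonneg hr.le, mul_comm]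
    gcongr
    exact h k g' A hg' hA' _

/-! ### Functions vanishing to finite order at the origin -/

/-- Integrate down from order M: each lower derivative vanishes at 0, so the mean value inequality
on the ball of radius |x| gains one factor |x|. -/
theorem norm_iteratedFDeriv_le_of_vanishing {n : ℕ} {V : Type*} [NormedAddCommGroup V]
    [NormedSpace ℝ V] {M : ℕ} {u : E n → V} (hu : ContDiff ℝ M u) {a : ℝ}
    (ha : ∀ x, ‖iteratedFDeriv ℝ M u x‖ ≤ a) (h0 : ∀ k < M, iteratedFDeriv ℝ k u 0 = 0) :
    ∀ d k, k + d = M → ∀ x, ‖iteratedFDeriv ℝ k u x‖ ≤ a * ‖x‖ ^ d := by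
  intro d
  induction d with
  | zero =>
    intro k hk x
    obtain rfl : k = M := by simpa using hk
    simpa using ha x
  | succ d ih =>
    intro k hk x
    have h1 : ∀ y ∈ Metric.closedBall (0 : E n) ‖x‖,
        ‖fderiv ℝ (iteratedFDeriv ℝ k u) y‖ ≤ a * ‖x‖ ^ d := by
      intro y hy
      rw [norm_fderiv_iteratedFDeriv]
      have ha0 : 0 ≤ a := (norm_nonneg _).trans (ha 0)
      have hy' : ‖y‖ ≤ ‖x‖ := by simpa using hy
      exact (ih (k + 1) (by omega) y).trans (by gcongr)
    have hd : ∀ y ∈ Metric.closedBall (0 : E n) ‖x‖,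
        DifferentiableAt ℝ (iteratedFDeriv ℝ k u) y := fun y _ =>
      (hu.differentiable_iteratedFDeriv (by exact_mod_cast (by omega : k < M))) y
    have h2 := (convex_closedBall (0 : E n) ‖x‖).norm_image_sub_le_of_norm_fderiv_le hd h1
      (Metric.mem_closedBall_self (norm_nonneg x)) (y := x) (by simp)
    rw [h0 k (by omega), sub_zero, sub_zero] at h2
    rw [pow_succ, ← mul_assoc]
    exact h2

/-! ### Dilated cut-offs of Schwartz functions -/

section Cutoff

variable {n : ℕ}

theorem comp_smul_hasTemperateGrowth (χ : 𝓢(E n, ℂ)) (r : ℝ) :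
    Function.HasTemperateGrowth (fun ξ : E n => χ (r • ξ)) := by
  have h : Function.HasTemperateGrowth (fun ξ : E n => r • ξ) := by fun_prop
  exact Function.HasTemperateGrowth.comp χ.hasTemperateGrowth h

theorem norm_iteratedFDeriv_comp_smul_le (χ : 𝓢(E n, ℂ)) {r : ℝ} (hr : 0 ≤ r) (i : ℕ) (ξ : E n) :
    ‖iteratedFDeriv ℝ i (fun ξ => χ (r • ξ)) ξ‖ ≤ r ^ i * SchwartzMap.seminorm ℝ 0 i χ := by
  rw [iteratedFDeriv_comp_const_smul r (χ.smooth i), norm_smul, norm_pow, Real.norm_of_nonneg hr]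
  gcongr
  exact χ.norm_iteratedFDeriv_le_seminorm ℝ i _

/-- Cutting off a Schwartz function near infinity: `χ(r ξ) h(ξ) → h(ξ)` as `r → 0`. -/
theorem tendsto_cutoff (χ : 𝓢(E n, ℂ)) (hχ : χ 0 = 1) (h : 𝓢(E n, ℂ)) {r : ℕ → ℝ}
    (hr0 : ∀ j, 0 ≤ r j) (hr1 : ∀ j, r j ≤ 1) (hr : Tendsto r atTop (𝓝 0)) :
    Tendsto (fun j => SchwartzMap.smulLeftCLM ℂ (fun ξ => χ (r j • ξ)) h) atTop (𝓝 h) := by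
  set c : ℕ → ℝ := fun i => SchwartzMap.seminorm ℝ 0 i χ + SchwartzMap.seminorm ℝ 0 1 χ with hc
  have hc0 : ∀ i, 0 ≤ c i := fun i => add_nonneg (apply_nonneg _ _) (apply_nonneg _ _)
  -- For i = 0 the mean value theorem costs a factor |ξ|. For i ≥ 1 the chain rule gives r^i ≤ r.
  -- The weight 1 + |ξ| is absorbed below by the seminorms of h with index k + 1.
  have hη : ∀ j i ξ, ‖iteratedFDeriv ℝ i (fun ξ : E n => χ (r j • ξ) - 1) ξ‖ ≤
      r j * c i * (1 + ‖ξ‖) := by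
    intro j i ξ
    rcases Nat.eq_zero_or_pos i with rfl | hi
    · rw [norm_iteratedFDeriv_zero]
      have h1 : ∀ y ∈ Set.univ, ‖fderiv ℝ χ y‖ ≤ SchwartzMap.seminorm ℝ 0 1 χ := by
        intro y _
        have := χ.norm_iteratedFDeriv_le_seminorm ℝ 1 y
        rwa [← norm_iteratedFDeriv_fderiv, norm_iteratedFDeriv_zero] at this
      have h2 := convex_univ.norm_image_sub_le_of_norm_fderiv_le (x := (0 : E n)) (y := r j • ξ)
        (fun y _ => χ.differentiableAt) h1 trivial trivial
      rw [hχ, sub_zero, norm_smul, Real.norm_of_nonneg (hr0 j)] at h2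
      refine h2.trans ?_
      have h3 : SchwartzMap.seminorm ℝ 0 1 χ ≤ c 0 := le_add_of_nonneg_left (apply_nonneg _ _)
      have := hr0 j
      calc _ ≤ c 0 * (r j * (1 + ‖ξ‖)) := by
            gcongr
            linarith
        _ = _ := by ring
    · have h1 : iteratedFDeriv ℝ i (fun ξ : E n => χ (r j • ξ) - 1) ξ =
          iteratedFDeriv ℝ i (fun ξ : E n => χ (r j • ξ)) ξ := by
        obtain ⟨i, rfl⟩ := Nat.exists_eq_succ_of_ne_zero hi.ne'
        have : fderiv ℝ (fun ξ : E n => χ (r j • ξ) - 1) = fderiv ℝ (fun ξ : E n => χ (r j • ξ)) :=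
          funext fun x => fderiv_sub_const _
        simp only [iteratedFDeriv_succ_eq_comp_right, Function.comp, this]
      rw [h1]
      refine (norm_iteratedFDeriv_comp_smul_le χ (hr0 j) i ξ).trans ?_
      have h2 : r j ^ i ≤ r j := pow_le_of_le_one (hr0 j) (hr1 j) hi.ne'
      have h3 : SchwartzMap.seminorm ℝ 0 i χ ≤ c i := le_add_of_nonneg_right (apply_nonneg _ _)
      calc _ ≤ r j * c i * 1 := by
            rw [mul_one]
            exact mul_le_mul h2 h3 (apply_nonneg _ _) (hr0 j)
        _ ≤ _ := by
            have := hr0 j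
            have := hc0 i
            gcongr
            linarith [norm_nonneg ξ]
  rw [(schwartz_withSeminorms ℝ (E n) ℂ).tendsto_nhds]
  rintro ⟨k, l⟩ ε hε
  set D : ℝ := ∑ i ∈ Finset.range (l + 1), (l.choose i : ℝ) * (c i *
    (SchwartzMap.seminorm ℝ k (l - i) h + SchwartzMap.seminorm ℝ (k + 1) (l - i) h)) with hD
  have hD0 : 0 ≤ D := Finset.sum_nonneg fun i _ => by
    have := hc0 i
    have : 0 ≤ SchwartzMap.seminorm ℝ k (l - i) h := apply_nonneg _ _
    have : 0 ≤ SchwartzMap.seminorm ℝ (k + 1) (l - i) h := apply_nonneg _ _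
    positivity
  have key : ∀ j, SchwartzMap.seminorm ℝ k l
      (SchwartzMap.smulLeftCLM ℂ (fun ξ => χ (r j • ξ)) h - h) ≤ r j * D := by
    intro j
    refine SchwartzMap.seminorm_le_bound ℝ k l _ (mul_nonneg (hr0 j) hD0) fun ξ => ?_
    have h1 : ⇑(SchwartzMap.smulLeftCLM ℂ (fun ξ => χ (r j • ξ)) h - h) =
        fun ξ => (χ (r j • ξ) - 1) * h ξ := by
      funext x
      rw [sub_apply, SchwartzMap.smulLeftCLM_apply_apply (comp_smul_hasTemperateGrowth χ (r j)),
        smul_eq_mul]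
      ring
    rw [h1]
    have h2 : ContDiff ℝ l (fun ξ : E n => χ (r j • ξ) - 1) :=
      ((χ.smooth l).comp (contDiff_const_smul _)).sub contDiff_const
    have h3 := norm_iteratedFDeriv_mul_le h2 (h.smooth l) ξ le_rfl
    calc _ ≤ ‖ξ‖ ^ k * ∑ i ∈ Finset.range (l + 1), (l.choose i : ℝ) *
            ‖iteratedFDeriv ℝ i (fun ξ : E n => χ (r j • ξ) - 1) ξ‖ *
              ‖iteratedFDeriv ℝ (l - i) h ξ‖ := by gcongr
      _ ≤ r j * D := by
        rw [hD, Finset.mul_sum, Finset.mul_sum]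
        refine Finset.sum_le_sum fun i _ => ?_
        have e1 := h.le_seminorm ℝ k (l - i) ξ
        have e2 := h.le_seminorm ℝ (k + 1) (l - i) ξ
        have := hr0 j
        have := hc0 i
        calc _ ≤ ‖ξ‖ ^ k * ((l.choose i : ℝ) * (r j * c i * (1 + ‖ξ‖)) *
              ‖iteratedFDeriv ℝ (l - i) h ξ‖) := by
              gcongr
              exact hη j i ξ
          _ = r j * ((l.choose i : ℝ) * (c i * (‖ξ‖ ^ k * ‖iteratedFDeriv ℝ (l - i) h ξ‖ +
              ‖ξ‖ ^ (k + 1) * ‖iteratedFDeriv ℝ (l - i) h ξ‖))) := by ring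
          _ ≤ _ := by gcongr
  have h4 : Tendsto (fun j => r j * D) atTop (𝓝 0) := by simpa using hr.mul_const D
  filter_upwards [h4.eventually_lt_const hε] with j hj
  exact (key j).trans_lt hj

/-- Cutting off near the origin a function vanishing there to high order. -/
theorem tendsto_cutoff_seminorm (χ : 𝓢(E n, ℂ)) (hχ : ∀ ξ, 2 < ‖ξ‖ → χ ξ = 0) (h : 𝓢(E n, ℂ))
    {L : ℕ} (hh : ∀ k ≤ L, iteratedFDeriv ℝ k h 0 = 0) {k l : ℕ} (hl : l ≤ L) {r : ℕ → ℝ}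
    (hr1 : ∀ j, 1 ≤ r j) (hr : Tendsto r atTop atTop) :
    Tendsto (fun j => SchwartzMap.seminorm ℝ k l
      (SchwartzMap.smulLeftCLM ℂ (fun ξ => χ (r j • ξ)) h)) atTop (𝓝 0) := by
  set a := SchwartzMap.seminorm ℝ 0 (L + 1) h
  have ha : 0 ≤ a := apply_nonneg _ _
  have hb : ∀ d m, m + d = L + 1 → ∀ x, ‖iteratedFDeriv ℝ m h x‖ ≤ a * ‖x‖ ^ d :=
    norm_iteratedFDeriv_le_of_vanishing (h.smooth (L + 1 : ℕ))
      (h.norm_iteratedFDeriv_le_seminorm ℝ (L + 1)) (fun k hk => hh k (by omega))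
  obtain ⟨D, hD⟩ : ∃ D : ℝ, D = 2 ^ k * ∑ i ∈ Finset.range (l + 1), (l.choose i : ℝ) *
    SchwartzMap.seminorm ℝ 0 i χ * (a * 2 ^ (L + 1 - (l - i))) := ⟨_, rfl⟩
  have hD0 : 0 ≤ D := hD ▸ mul_nonneg (by positivity) (Finset.sum_nonneg fun i _ => by
    have : 0 ≤ SchwartzMap.seminorm ℝ 0 i χ := apply_nonneg _ _
    positivity)
  have key : ∀ j, SchwartzMap.seminorm ℝ k l
      (SchwartzMap.smulLeftCLM ℂ (fun ξ => χ (r j • ξ)) h) ≤ (r j)⁻¹ * D := by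
    intro j
    have hrp : 0 < r j := one_pos.trans_le (hr1 j)
    refine SchwartzMap.seminorm_le_bound ℝ k l _ (mul_nonneg (inv_nonneg.2 hrp.le) hD0) fun ξ => ?_
    have h1 : ⇑(SchwartzMap.smulLeftCLM ℂ (fun ξ => χ (r j • ξ)) h) =
        fun ξ => χ (r j • ξ) * h ξ := by
      funext x
      rw [SchwartzMap.smulLeftCLM_apply_apply (comp_smul_hasTemperateGrowth χ (r j)), smul_eq_mul]
    rw [h1]
    by_cases hξ : 2 < ‖r j • ξ‖
    · have : (fun ξ => χ (r j • ξ) * h ξ) =ᶠ[𝓝 ξ] fun _ => 0 := by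
        have hc : Continuous fun ξ : E n => ‖r j • ξ‖ := by fun_prop
        filter_upwards [hc.continuousAt.eventually (lt_mem_nhds hξ)] with x hx
        rw [hχ _ hx, zero_mul]
      rw [(this.iteratedFDeriv ℝ l).eq_of_nhds]
      simp only [iteratedFDeriv_fun_zero, Pi.zero_apply, norm_zero, mul_zero]
      positivity
    · have hξ' : ‖ξ‖ ≤ 2 * (r j)⁻¹ := by
        rw [norm_smul, Real.norm_of_nonneg hrp.le, not_lt] at hξ
        rw [← div_eq_mul_inv, le_div_iff₀ hrp]
        linarith
      have h2 : ContDiff ℝ l (fun ξ : E n => χ (r j • ξ)) :=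
        (χ.smooth l).comp (contDiff_const_smul _)
      have h3 := norm_iteratedFDeriv_mul_le h2 (h.smooth l) ξ le_rfl
      have hi1 : (r j)⁻¹ ≤ 1 := inv_le_one_of_one_le₀ (hr1 j)
      calc _ ≤ (2 * (r j)⁻¹) ^ k * ∑ i ∈ Finset.range (l + 1), (l.choose i : ℝ) *
              ‖iteratedFDeriv ℝ i (fun ξ : E n => χ (r j • ξ)) ξ‖ *
                ‖iteratedFDeriv ℝ (l - i) h ξ‖ := by gcongr
        _ ≤ 2 ^ k * ∑ i ∈ Finset.range (l + 1), (l.choose i : ℝ) *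
              ‖iteratedFDeriv ℝ i (fun ξ : E n => χ (r j • ξ)) ξ‖ *
                ‖iteratedFDeriv ℝ (l - i) h ξ‖ := by
            gcongr
            linarith
        _ ≤ (r j)⁻¹ * D := by
          rw [hD, mul_left_comm]
          refine mul_le_mul_of_nonneg_left ?_ (by positivity)
          rw [Finset.mul_sum]
          refine Finset.sum_le_sum fun i hi => ?_
          have hil : i ≤ l := by simpa [Nat.lt_succ_iff] using hi
          have e1 := norm_iteratedFDeriv_comp_smul_le χ hrp.le i ξ
          have e2 := hb (L + 1 - (l - i)) (l - i) (by omega) ξ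
          have e3 : 0 ≤ SchwartzMap.seminorm ℝ 0 i χ := apply_nonneg _ _
          calc _ ≤ (l.choose i : ℝ) * (r j ^ i * SchwartzMap.seminorm ℝ 0 i χ) *
                (a * (2 * (r j)⁻¹) ^ (L + 1 - (l - i))) := by
                gcongr
                exact e2.trans (by gcongr)
            _ = (r j ^ i * (r j)⁻¹ ^ (L + 1 - (l - i))) * ((l.choose i : ℝ) *
                SchwartzMap.seminorm ℝ 0 i χ * (a * 2 ^ (L + 1 - (l - i)))) := by
                rw [mul_pow]; ring
            _ ≤ _ := by
                gcongr
                -- The loss r^i from differentiating the cut-off is compensated by the vanishing of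
                -- h where |ξ| ≤ 2/r. Since l ≤ L, at least one factor 1/r is left over.
                have : L + 1 - (l - i) = i + (L + 1 - l) := by omega
                rw [this, pow_add, ← mul_assoc, ← mul_pow, mul_inv_cancel₀ hrp.ne', one_pow,
                  one_mul]
                exact pow_le_of_le_one (by positivity) hi1 (by omega)
  have h4 : Tendsto (fun j => (r j)⁻¹ * D) atTop (𝓝 0) := by
    simpa using (tendsto_inv_atTop_zero.comp hr).mul_const D
  exact squeeze_zero (fun _ => apply_nonneg _ _) key h4

end Cutoff

/-! ### Distributions whose Fourier transform is supported at the origin -/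


theorem fourierInv_vanishing {n : ℕ} {T : 𝓢'(E n, ℂ)}
    (hT : ∀ h : 𝓢(E n, ℂ), ⇑h =ᶠ[𝓝 0] 0 → T (𝓕 h) = 0) (h : 𝓢(E n, ℂ)) (hh : ⇑h =ᶠ[𝓝 0] 0) :
    T (𝓕⁻ h) = 0 := by
  set h' : 𝓢(E n, ℂ) := SchwartzMap.compCLMOfContinuousLinearEquiv ℂ
    (ContinuousLinearEquiv.neg ℝ (M := E n)) h
  have h1 : 𝓕⁻ h = 𝓕 h' := by
    ext x
    rw [SchwartzMap.fourierInv_coe, SchwartzMap.fourier_coe, Real.fourierInv_eq_fourier_comp_neg]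
    rfl
  rw [h1]
  refine hT _ ?_
  have : Tendsto (fun x : E n => -x) (𝓝 0) (𝓝 0) := by
    simpa using (continuous_neg (G := E n)).tendsto 0
  exact this.eventually hh

theorem exists_seminorm_bound {n : ℕ} (T : 𝓢(E n, ℂ) →L[ℂ] ℂ) : ∃ (s : Finset (ℕ × ℕ)) (C : ℝ),
    0 ≤ C ∧ ∀ h, ‖T h‖ ≤ C * ∑ p ∈ s, SchwartzMap.seminorm ℝ p.1 p.2 h := by
  obtain ⟨s, C, -, hb⟩ := Seminorm.bound_of_continuous (schwartz_withSeminorms ℂ (E n) ℂ)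
    ((normSeminorm ℂ ℂ).comp T.toLinearMap) (continuous_norm.comp T.continuous)
  refine ⟨s, C, C.2, fun h => (hb h).trans ?_⟩
  change (C : ℝ) * (s.sup (schwartzSeminormFamily ℂ (E n) ℂ)) h ≤ _
  gcongr
  have h1 := Seminorm.finset_sup_le_sum (schwartzSeminormFamily ℂ (E n) ℂ) s h
  refine h1.trans (le_of_eq ?_)
  simp only [← FunLike.coeAddMonoidHom_apply, map_sum, Finset.sum_apply]
  rfl

theorem exists_ball_cutoff (n : ℕ) : ∃ χ : 𝓢(E n, ℂ), (∀ ξ, ‖ξ‖ < 1 → χ ξ = 1) ∧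
    ∀ ξ, 2 < ‖ξ‖ → χ ξ = 0 := by
  let f : ContDiffBump (0 : E n) := ⟨1, 2, one_pos, one_lt_two⟩
  let F : 𝓢(E n, ℝ) := f.hasCompactSupport.toSchwartzMap f.contDiff
  refine ⟨SchwartzMap.postcompCLM (𝕜 := ℝ) Complex.ofRealCLM F, fun ξ hξ => ?_, fun ξ hξ => ?_⟩
  · have : f ξ = 1 := f.one_of_mem_closedBall (by simpa using hξ.le)
    change ((f ξ : ℝ) : ℂ) = 1
    simp [this]
  · have : f ξ = 0 := f.zero_of_le_dist (by simpa using hξ.le)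
    change ((f ξ : ℝ) : ℂ) = 0
    simp [this]

/-- Continuity makes U of finite order, and L is the largest derivative order in its seminorm bound.
Cutting h off to a shrinking neighbourhood of 0 does not change U h, while the seminorms concerned
tend to 0. -/
theorem eq_zero_of_iteratedFDeriv_eq_zero {n : ℕ} (U : 𝓢(E n, ℂ) →L[ℂ] ℂ)
    (hU : ∀ h : 𝓢(E n, ℂ), ⇑h =ᶠ[𝓝 0] 0 → U h = 0) : ∃ L : ℕ, ∀ h : 𝓢(E n, ℂ),
    (∀ k ≤ L, iteratedFDeriv ℝ k h 0 = 0) → U h = 0 := by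
  obtain ⟨s, C, hC, hb⟩ := exists_seminorm_bound U
  obtain ⟨χ, hχ1, hχ2⟩ := exists_ball_cutoff n
  refine ⟨s.sup Prod.snd, fun h hh => ?_⟩
  set r : ℕ → ℝ := fun j => j + 1
  have hr1 : ∀ j, 1 ≤ r j := fun j => by simp [r]
  have hr : Tendsto r atTop atTop := tendsto_atTop_add_const_right _ _ tendsto_natCast_atTop_atTop
  have h1 : ∀ j, U h = U (SchwartzMap.smulLeftCLM ℂ (fun ξ => χ (r j • ξ)) h) := by
    intro j
    rw [← sub_eq_zero, ← map_sub]
    refine hU _ ?_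
    have hc : Continuous fun ξ : E n => ‖r j • ξ‖ := by fun_prop
    have h0 : ‖r j • (0 : E n)‖ < 1 := by simp
    filter_upwards [hc.continuousAt.eventually (gt_mem_nhds h0)] with ξ hξ
    rw [sub_apply, SchwartzMap.smulLeftCLM_apply_apply (comp_smul_hasTemperateGrowth χ (r j)),
      hχ1 _ hξ, one_smul, sub_self, Pi.zero_apply]
  have h2 : Tendsto (fun j => C * ∑ p ∈ s, SchwartzMap.seminorm ℝ p.1 p.2
      (SchwartzMap.smulLeftCLM ℂ (fun ξ => χ (r j • ξ)) h)) atTop (𝓝 (C * ∑ p ∈ s, 0)) := by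
    refine Tendsto.const_mul _ (tendsto_finsetSum _ fun p hp => ?_)
    exact tendsto_cutoff_seminorm χ hχ2 h hh (Finset.le_sup (f := Prod.snd) hp) hr1 hr
  rw [Finset.sum_const_zero, mul_zero] at h2
  have h3 : ‖U h‖ ≤ 0 := ge_of_tendsto' h2 fun j => by
    rw [h1 j]
    exact hb _
  exact norm_le_zero_iff.1 h3

/-- The functional `h ↦ ∂_{i_1} ⋯ ∂_{i_k} h(0)`. -/
noncomputable def partialAtZero {n k : ℕ} (i : Fin k → Fin n) : 𝓢(E n, ℂ) →ₗ[ℂ] ℂ where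
  toFun h := partialDeriv i h 0
  map_add' h g := by
    have := iteratedFDeriv_add_apply (h.smooth k).contDiffAt (g.smooth k).contDiffAt (x := (0 : E n))
    exact congrArg (fun A => A fun l => EuclideanSpace.single (i l) (1 : ℝ)) this
  map_smul' c h := by
    have := iteratedFDeriv_const_smul_apply (a := c) (h.smooth k).contDiffAt (x := (0 : E n))
    exact congrArg (fun A => A fun l => EuclideanSpace.single (i l) (1 : ℝ)) this

theorem prod_coord_eq_mono {n k : ℕ} (i : Fin k → Fin n) (x : E n) :
    ∏ l, ((x (i l) : ℝ) : ℂ) = mono (fun a => Fintype.card {l // i l = a}) x := by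
  rw [mono, ← Fintype.prod_fiberwise' i fun a => ((x a : ℝ) : ℂ)]
  simp

/-- Differentiating the Fourier integral produces coordinate factors, and the exponential is 1 at
the origin. Point derivatives on the Fourier side are thus monomials on the other side. -/
theorem partialAtZero_fourier {n k : ℕ} (i : Fin k → Fin n) (u : 𝓢(E n, ℂ)) :
    partialAtZero i (𝓕 u) = (-(2 * π * Complex.I)) ^ k *
      monoDist (fun a => Fintype.card {l // i l = a}) u := by
  change iteratedFDeriv ℝ k (𝓕 u : 𝓢(E n, ℂ)) 0 _ = _
  have h0 : ∀ m : ℕ, (m : ℕ∞) ≤ ⊤ → Integrable (fun v => ‖v‖ ^ m * ‖u v‖) :=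
    fun m _ => u.integrable_pow_mul volume m
  have h1 := Real.iteratedFDeriv_fourier (N := ⊤) h0
    u.integrable.aestronglyMeasurable (n := k) le_top
  rw [SchwartzMap.fourier_coe, h1, Real.fourier_eq', monoDist_apply, ← integral_const_mul]
  have h2 : ∀ v : E n, Complex.exp (((-2 * π * inner ℝ v 0 : ℝ) : ℂ) * Complex.I) = 1 := by
    intro v; simp
  simp only [h2, one_smul]
  have h3 : Integrable (fun v => VectorFourier.fourierPowSMulRight (innerSL ℝ) u v k) :=
    VectorFourier.integrable_fourierPowSMulRight _ (h0 k le_top) u.integrable.aestronglyMeasurable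
  rw [ContinuousMultilinearMap.integral_apply h3]
  congr 1
  funext v
  rw [VectorFourier.fourierPowSMulRight_apply, ← prod_coord_eq_mono]
  have h4 : ∀ l, (innerSL ℝ v) (EuclideanSpace.single (i l) (1 : ℝ)) = v (i l) := fun l => by
    change inner ℝ v (EuclideanSpace.single (i l) (1 : ℝ)) = v (i l)
    simp [EuclideanSpace.inner_single_right]
  simp only [h4, smul_eq_mul, Complex.real_smul, Complex.ofReal_prod]
  ring

theorem iteratedFDeriv_eq_zero_of_partialDeriv {n k : ℕ} {h : E n → ℂ} {x : E n}
    (hh : ∀ i : Fin k → Fin n, partialDeriv i h x = 0) : iteratedFDeriv ℝ k h x = 0 := by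
  have h1 : (iteratedFDeriv ℝ k h x).toMultilinearMap = 0 := by
    refine Module.Basis.ext_multilinear
      (fun _ => (EuclideanSpace.basisFun (Fin n) ℝ).toBasis) fun v => ?_
    simpa [partialDeriv] using hh v
  ext m
  exact congrArg (fun A => A m) h1

/-- A distribution whose Fourier transform is supported at the origin is a polynomial. By finite
order, the transform vanishes on the common kernel of finitely many point derivatives at 0. By
linear algebra it is a linear combination of them. -/
theorem mem_polyDist_of_vanishing {n : ℕ} (T : 𝓢'(E n, ℂ))
    (hT : ∀ h : 𝓢(E n, ℂ), ⇑h =ᶠ[𝓝 0] 0 → T (𝓕 h) = 0) : T ∈ polyDist n := by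
  set U : 𝓢(E n, ℂ) →L[ℂ] ℂ :=
    { toLinearMap := T.toLinearMap ∘ₗ (FourierTransform.fourierInvCLM ℂ 𝓢(E n, ℂ)).toLinearMap
      cont := T.cont.comp (FourierTransform.fourierInvCLM ℂ 𝓢(E n, ℂ)).cont }
  have hUa : ∀ h, U h = T (𝓕⁻ h) := fun h => rfl
  obtain ⟨L, hL⟩ := eq_zero_of_iteratedFDeriv_eq_zero U fun h hh => fourierInv_vanishing hT h hh
  have h1 : U.toLinearMap ∈ Submodule.span ℂ (Set.range
      fun p : (Σ k : Fin (L + 1), Fin k → Fin n) => partialAtZero p.2) := by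
    refine mem_span_of_iInf_ker_le_ker fun h hh => ?_
    simp only [Submodule.mem_iInf, LinearMap.mem_ker] at hh
    exact hL h fun k hk => iteratedFDeriv_eq_zero_of_partialDeriv fun i =>
      hh ⟨⟨k, Nat.lt_succ_of_le hk⟩, i⟩
  obtain ⟨c, hc⟩ := (Submodule.mem_span_range_iff_exists_fun ℂ).1 h1
  have h2 : T = ∑ p : (Σ k : Fin (L + 1), Fin k → Fin n),
      (c p * (-(2 * π * Complex.I)) ^ (p.1 : ℕ)) •
        monoDist (fun a => Fintype.card {l // p.2 l = a}) := by
    ext u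
    have h3 : T u = U (𝓕 u) := by rw [hUa, FourierTransform.fourierInv_fourier_eq]
    have h4 : U (𝓕 u) = ∑ p, c p * partialAtZero p.2 (𝓕 u) := by
      rw [← ContinuousLinearMap.coe_coe, ← hc]
      simp
    rw [h3, h4, sum_apply]
    refine Finset.sum_congr rfl fun p _ => ?_
    rw [partialAtZero_fourier, ← mul_assoc]
    rfl
  rw [h2]
  exact Submodule.sum_mem _ fun p _ => Submodule.smul_mem _ _ (Submodule.subset_span ⟨_, rfl⟩)

/-! ### Growth of functions with bounded difference quotients -/

/-- Expand the M-th difference at 0 with step x/M. Its last term is F(x); the others are values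
F(kx/M), k < M, in a smaller ball, with total weight at most 2^M. -/
theorem norm_le_of_fwdDiff {n M : ℕ} (hM : 0 < M) {F : E n → ℂ} (x : E n) {a D : ℝ}
    (ha : ‖((fwdDiff ((M : ℝ)⁻¹ • x))^[M] F) 0‖ ≤ a)
    (hD : ∀ z, ‖z‖ ≤ (1 - (M : ℝ)⁻¹) * ‖x‖ → ‖F z‖ ≤ D) : ‖F x‖ ≤ a + 2 ^ M * D := by
  have hM' : (0 : ℝ) < M := by exact_mod_cast hM
  have hM1 : (M : ℝ)⁻¹ ≤ 1 := inv_le_one_of_one_le₀ (by exact_mod_cast hM)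
  have hD0 : 0 ≤ D := (norm_nonneg _).trans
    (hD 0 (by simpa using mul_nonneg (sub_nonneg.2 hM1) (norm_nonneg x)))
  rw [fwdDiff_iter_eq_sum_shift, Finset.sum_range_succ] at ha
  have e1 : (0 : E n) + M • (M : ℝ)⁻¹ • x = x := by
    rw [zero_add, ← Nat.cast_smul_eq_nsmul ℝ, smul_inv_smul₀ hM'.ne']
  rw [e1] at ha
  simp only [Nat.sub_self, pow_zero, Nat.choose_self, Nat.cast_one, mul_one, one_smul] at ha
  set S := ∑ k ∈ Finset.range M, ((-1 : ℤ) ^ (M - k) * (M.choose k : ℤ)) •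
    F (0 + k • (M : ℝ)⁻¹ • x)
  have hS : ‖S‖ ≤ 2 ^ M * D := by
    have h1 : ∀ k ∈ Finset.range M, ‖((-1 : ℤ) ^ (M - k) * (M.choose k : ℤ)) •
        F (0 + k • (M : ℝ)⁻¹ • x)‖ ≤ (M.choose k : ℝ) * D := by
      intro k hk
      have hk' : k < M := Finset.mem_range.1 hk
      rw [zsmul_eq_mul, norm_mul]
      gcongr
      · push_cast
        rw [norm_mul, norm_pow, norm_neg, norm_one, one_pow, one_mul]
        simp
      · refine hD _ ?_
        rw [zero_add, ← Nat.cast_smul_eq_nsmul ℝ, norm_smul, norm_smul, norm_inv, Real.norm_natCast,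
          Real.norm_natCast, ← mul_assoc]
        gcongr
        have : (k : ℝ) ≤ M - 1 := by
          have : (k : ℝ) + 1 ≤ M := by exact_mod_cast hk'
          linarith
        calc (k : ℝ) * (M : ℝ)⁻¹ ≤ (M - 1) * (M : ℝ)⁻¹ := by gcongr
          _ = _ := by field_simp
    refine (norm_sum_le_of_le _ h1).trans ?_
    rw [← Finset.sum_mul]
    gcongr
    have h2 := Nat.sum_range_choose M
    rw [Finset.sum_range_succ] at h2
    have h3 : (∑ k ∈ Finset.range M, M.choose k) ≤ 2 ^ M := by omega
    exact_mod_cast h3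
  calc ‖F x‖ = ‖(S + F x) - S‖ := by rw [add_sub_cancel_left]
    _ ≤ _ := (norm_sub_le _ _).trans (add_le_add ha hS)

theorem exists_polynomial_growth {n M : ℕ} (hM : 0 < M) {s : ℝ} (hs : 0 < s) {F : E n → ℂ}
    (hF : Continuous F) {K : ℝ} (hK : ∀ x y, ‖((fwdDiff y)^[M] F) x‖ ≤ K * ‖y‖ ^ s) :
    ∃ (C : ℝ) (N : ℕ), ∀ x, ‖F x‖ ≤ C * (1 + ‖x‖ ^ 2) ^ N := by
  have hM' : (1 : ℝ) ≤ M := by exact_mod_cast hM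
  obtain ⟨D₀, hD₀⟩ := (isCompact_closedBall (0 : E n) 1).exists_bound_of_continuousOn hF.continuousOn
  set D := max D₀ (max K 0)
  have hD0 : 0 ≤ D := le_max_of_le_right (le_max_right _ _)
  have hDK : K ≤ D := le_max_of_le_right (le_max_left _ _)
  -- This ratio satisfies (1 − 1/M)ρ ≤ 1: the points kx/M, k < M, for x in the ball of radius
  -- ρ^{j+1} lie in the previous ball.
  set ρ : ℝ := 1 + (M : ℝ)⁻¹ with hρ
  have hρ1 : 1 < ρ := by rw [hρ]; have : 0 < (M : ℝ)⁻¹ := by positivity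
                         linarith
  -- The growth factor per step: 2^M from the values in the previous ball and ρ^s from the bound on
  -- the difference.
  set Λ : ℝ := 2 ^ M + ρ ^ s with hΛ
  have hρs : 0 < ρ ^ s := Real.rpow_pos_of_pos (by linarith) s
  have hΛ1 : 1 ≤ Λ := by
    have : (1 : ℝ) ≤ 2 ^ M := one_le_pow₀ one_le_two
    linarith
  have key : ∀ j : ℕ, ∀ x : E n, ‖x‖ ≤ ρ ^ j → ‖F x‖ ≤ D * Λ ^ j := by
    intro j
    induction j with
    | zero =>
      intro x hx
      rw [pow_zero, mul_one]
      exact (hD₀ x (by simpa using hx)).trans (le_max_left _ _)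
    | succ j ih =>
      intro x hx
      have h1 : ‖((fwdDiff ((M : ℝ)⁻¹ • x))^[M] F) 0‖ ≤ D * Λ ^ j * ρ ^ s := by
        refine (hK _ _).trans ?_
        have h2 : ‖(M : ℝ)⁻¹ • x‖ ≤ ρ ^ (j + 1) := by
          rw [norm_smul, norm_inv, Real.norm_natCast]
          refine (mul_le_of_le_one_left (norm_nonneg x) (inv_le_one_of_one_le₀ hM')).trans hx
        have h3 : ‖(M : ℝ)⁻¹ • x‖ ^ s ≤ Λ ^ j * ρ ^ s := by
          calc _ ≤ (ρ ^ (j + 1)) ^ s := by gcongr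
            _ = (ρ ^ s) ^ j * ρ ^ s := by
              rw [← pow_succ, ← Real.rpow_natCast, ← Real.rpow_natCast, ← Real.rpow_mul (by linarith),
                ← Real.rpow_mul (by linarith), mul_comm]
            _ ≤ _ := by
              gcongr
              have : (0 : ℝ) < 2 ^ M := by positivity
              linarith
        rw [mul_assoc]
        gcongr
      have h4 := norm_le_of_fwdDiff hM x h1 (D := D * Λ ^ j) fun z hz => ih z (hz.trans ?_)
      · refine h4.trans (le_of_eq ?_)
        rw [hΛ, pow_succ]
        ring
      · have h5 : 0 ≤ 1 - (M : ℝ)⁻¹ := sub_nonneg.2 (inv_le_one_of_one_le₀ hM')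
        calc _ ≤ (1 - (M : ℝ)⁻¹) * ρ ^ (j + 1) := by gcongr
          _ = ((1 - (M : ℝ)⁻¹) * ρ) * ρ ^ j := by ring
          _ ≤ 1 * ρ ^ j := by
            gcongr
            rw [hρ]
            nlinarith [sq_nonneg (M : ℝ)⁻¹]
          _ = _ := one_mul _
  -- Since Λ < ρ^N, geometric growth along the radii ρ^j is polynomial growth of degree governed by
  -- N.
  obtain ⟨N, hN⟩ := pow_unbounded_of_one_lt Λ hρ1
  refine ⟨D * Λ, N, fun x => ?_⟩
  have hx1 : (1 : ℝ) ≤ 1 + ‖x‖ ^ 2 := by linarith [sq_nonneg ‖x‖]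
  rcases le_total ‖x‖ 1 with hx | hx
  · calc ‖F x‖ ≤ D := by simpa using key 0 x (by simpa using hx)
      _ ≤ D * Λ := le_mul_of_one_le_right hD0 hΛ1
      _ ≤ _ := le_mul_of_one_le_right (by positivity) (one_le_pow₀ hx1)
  · obtain ⟨j, hj1, hj2⟩ := exists_nat_pow_near hx hρ1
    calc ‖F x‖ ≤ D * Λ ^ (j + 1) := key (j + 1) x hj2.le
      _ = D * Λ * Λ ^ j := by ring
      _ ≤ D * Λ * (ρ ^ N) ^ j := by gcongr
      _ = D * Λ * (ρ ^ j) ^ N := by rw [← pow_mul, ← pow_mul, mul_comm N]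
      _ ≤ D * Λ * (1 + ‖x‖ ^ 2) ^ N := by
        gcongr
        refine hj1.trans ?_
        nlinarith [sq_nonneg (‖x‖ - 1)]

/-! ### Differences as Fourier multipliers -/

/-- Translation is multiplication by a character on the Fourier side. On test functions it becomes
the opposite translation, which a change of variables moves back to F. -/
theorem Represents.fwdDiff {n : ℕ} {F : E n → ℂ} {T : 𝓢'(E n, ℂ)} (hT : Represents F T) (y : E n) :
    Represents (_root_.fwdDiff y F)
      (TemperedDistribution.fourierMultiplierCLM ℂ (fun ξ => character y ξ - 1) T) := by
  intro u
  set v : 𝓢(E n, ℂ) := SchwartzMap.compSubConstCLM ℂ y u with hv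
  have hva : ∀ x, v x = u (x - y) := fun x => SchwartzMap.compSubConstCLM_apply _ _ _
  have ht : Function.HasTemperateGrowth (fun ξ => character y ξ - 1) :=
    (character_hasTemperateGrowth y).sub (Function.HasTemperateGrowth.const (1 : ℂ))
  have h1 : 𝓕 (SchwartzMap.smulLeftCLM ℂ (fun ξ => character y ξ - 1) (𝓕⁻ u)) = v - u := by
    have h2 : SchwartzMap.smulLeftCLM ℂ (fun ξ => character y ξ - 1) (𝓕⁻ u) =
        SchwartzMap.smulLeftCLM ℂ (character y) (𝓕⁻ u) - 𝓕⁻ u := by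
      ext ξ
      rw [sub_apply, SchwartzMap.smulLeftCLM_apply_apply ht,
        SchwartzMap.smulLeftCLM_apply_apply (character_hasTemperateGrowth y)]
      simp [sub_mul]
    ext x
    have h3 := map_sub (FourierTransform.fourierCLM ℂ 𝓢(E n, ℂ))
      (SchwartzMap.smulLeftCLM ℂ (character y) (𝓕⁻ u)) (𝓕⁻ u)
    simp only [FourierTransform.fourierCLM_apply] at h3
    rw [h2, h3, sub_apply, fourier_character_mul, sub_apply, hva,
      FourierTransform.fourier_fourierInv_eq]
  rw [TemperedDistribution.fourierMultiplierCLM_apply_apply, h1, map_sub, (hT v).2, (hT u).2]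
  have i1 : Integrable (fun x => F (x + y) * u x) := by
    simpa [hva] using (hT v).1.comp_add_right y
  have i2 : ∫ x, F x * v x = ∫ x, F (x + y) * u x := by
    rw [← integral_add_right_eq_self (fun x => F x * v x) y]
    simp [hva]
  have e : ∀ x, _root_.fwdDiff y F x * u x = F (x + y) * u x - F x * u x := fun x => by
    change (F (x + y) - F x) * u x = _; rw [sub_mul]
  simp only [e]
  exact ⟨i1.sub (hT u).1, by rw [i2, integral_sub i1 (hT u).1]⟩

theorem Represents.fwdDiff_iter {n : ℕ} {F : E n → ℂ} {T : 𝓢'(E n, ℂ)} (hT : Represents F T)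
    (y : E n) (m : ℕ) : Represents ((_root_.fwdDiff y)^[m] F)
      (TemperedDistribution.fourierMultiplierCLM ℂ (fun ξ => (character y ξ - 1) ^ m) T) := by
  have ht : Function.HasTemperateGrowth (fun ξ => character y ξ - 1) :=
    (character_hasTemperateGrowth y).sub (Function.HasTemperateGrowth.const (1 : ℂ))
  induction m with
  | zero => simpa using hT
  | succ m ih =>
    have h := ih.fwdDiff y
    have h2 := TemperedDistribution.fourierMultiplierCLM_fourierMultiplierCLM_apply (ht.pow m) ht T
    rw [show (fun ξ => (character y ξ - 1) ^ m) = (fun ξ => character y ξ - 1) ^ m from rfl, h2,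
      ← pow_succ] at h
    rw [Function.iterate_succ_apply']
    exact h

/-! ### Quotients of smooth functions as Schwartz functions -/

theorem exists_schwartz_div {n : ℕ} {f Q : E n → ℂ} (hf : ContDiff ℝ ∞ f)
    (hc : HasCompactSupport f) (hQ : ContDiff ℝ ∞ Q) (h0 : ∀ x ∈ tsupport f, Q x ≠ 0) :
    ∃ S : 𝓢(E n, ℂ), ∀ x, S x = f x / Q x := by
  have h1 : ContDiff ℝ ∞ (fun x => f x / Q x) := by
    refine contDiff_iff_contDiffAt.2 fun x => ?_
    by_cases hx : x ∈ tsupport f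
    · simp only [div_eq_mul_inv]
      exact hf.contDiffAt.mul (hQ.contDiffAt.inv (h0 x hx))
    · have : (fun x => f x / Q x) =ᶠ[𝓝 x] fun _ => 0 := by
        filter_upwards [notMem_tsupport_iff_eventuallyEq.1 hx] with z hz
        rw [hz]; simp
      exact contDiffAt_const.congr_of_eventuallyEq this
  have h2 : HasCompactSupport (fun x => f x / Q x) := by
    refine hc.mono fun x hx => ?_
    simp only [Function.mem_support, ne_eq, div_eq_zero_iff, not_or] at hx ⊢
    exact hx.1
  exact ⟨h2.toSchwartzMap h1, fun x => rfl⟩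

/-! ### Algebra of representing functions -/

theorem Represents.add {n : ℕ} {F G : E n → ℂ} {S T : 𝓢'(E n, ℂ)} (hF : Represents F S)
    (hG : Represents G T) : Represents (fun x => F x + G x) (S + T) := by
  intro u
  simp only [add_mul]
  refine ⟨(hF u).1.add (hG u).1, ?_⟩
  rw [integral_add (hF u).1 (hG u).1, ← (hF u).2, ← (hG u).2]
  rfl

theorem Represents.sum {n : ℕ} {ι : Type*} (t : Finset ι) {F : ι → E n → ℂ} {S : ι → 𝓢'(E n, ℂ)}
    (h : ∀ i, Represents (F i) (S i)) :
    Represents (fun x => ∑ i ∈ t, F i x) (∑ i ∈ t, S i) := by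
  classical
  induction t using Finset.induction_on with
  | empty => intro u; simp
  | insert a t ha ih =>
    simp only [Finset.sum_insert ha]
    exact (h a).add ih

/-! ### Annular cut-offs -/

section Annulus

variable {n : ℕ} {θ : 𝓢(E n, ℝ)}

theorem IsAnnulusCutoff.nonneg (hθ : IsAnnulusCutoff θ) (ξ : E n) : 0 ≤ θ ξ :=
  (Set.indicator_nonneg (fun _ _ => zero_le_one) _).trans (hθ ξ).1

theorem IsAnnulusCutoff.eq_zero_of_lt (hθ : IsAnnulusCutoff θ) {ξ : E n} (h : ‖ξ‖ < 1) :
    θ ξ = 0 := by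
  refine le_antisymm ?_ (hθ.nonneg ξ)
  have := (hθ ξ).2
  rwa [Set.indicator_of_notMem (fun h' => h'.2 (by simpa using h))] at this

theorem IsAnnulusCutoff.eq_zero_of_le (hθ : IsAnnulusCutoff θ) {ξ : E n} (h : 8 ≤ ‖ξ‖) :
    θ ξ = 0 := by
  refine le_antisymm ?_ (hθ.nonneg ξ)
  have := (hθ ξ).2
  rwa [Set.indicator_of_notMem (fun h' => by
    have := h'.1
    simp only [Metric.mem_ball, dist_zero_right] at this
    linarith)] at this

theorem IsAnnulusCutoff.one_le (hθ : IsAnnulusCutoff θ) {ξ : E n} (h2 : 2 ≤ ‖ξ‖) (h4 : ‖ξ‖ < 4) :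
    1 ≤ θ ξ := by
  have := (hθ ξ).1
  rwa [Set.indicator_of_mem] at this
  simp [h2, h4]

theorem IsAnnulusCutoff.hasCompactSupport (hθ : IsAnnulusCutoff θ) : HasCompactSupport θ := by
  refine HasCompactSupport.of_support_subset_isCompact (isCompact_closedBall (0 : E n) 8) ?_
  intro ξ hξ
  rw [mem_closedBall_zero_iff]
  by_contra h
  exact hξ (hθ.eq_zero_of_le (not_le.1 h).le)

theorem IsAnnulusCutoff.tsupport_subset (hθ : IsAnnulusCutoff θ) :
    tsupport θ ⊆ {ξ | 1 ≤ ‖ξ‖ ∧ ‖ξ‖ ≤ 8} := by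
  refine closure_minimal (fun ξ hξ => ?_) ((isClosed_le continuous_const continuous_norm).inter
    (isClosed_le continuous_norm continuous_const))
  constructor
  · by_contra h
    exact hξ (hθ.eq_zero_of_lt (not_le.1 h))
  · by_contra h
    exact hξ (hθ.eq_zero_of_le (not_le.1 h).le)

theorem cexp_mul_I_ne_one {t : ℝ} (h0 : t ≠ 0) (h1 : |t| < 2 * π) :
    Complex.exp (t * Complex.I) ≠ 1 := by
  intro h
  obtain ⟨k, hk⟩ := Complex.exp_eq_one_iff.1 h
  have h2 : t = k * (2 * π) := by
    have h3 : (t : ℂ) * Complex.I = ((k * (2 * π) : ℝ) : ℂ) * Complex.I := by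
      rw [hk]; push_cast; ring
    exact_mod_cast mul_right_cancel₀ Complex.I_ne_zero h3
  have hk0 : k ≠ 0 := by rintro rfl; simp at h2; exact h0 h2
  have h4 : (1 : ℝ) ≤ |(k : ℝ)| := by exact_mod_cast Int.one_le_abs hk0
  rw [h2, abs_mul, abs_of_pos Real.two_pi_pos] at h1
  nlinarith [Real.two_pi_pos]

/-- An annular cut-off lies in the ideal generated by the symbols of `M`-th differences. -/
theorem IsAnnulusCutoff.exists_decomposition (hθ : IsAnnulusCutoff θ) (M : ℕ) :
    ∃ m : Fin n → 𝓢(E n, ℂ), ∀ ξ : E n, ((θ ξ : ℝ) : ℂ) =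
      ∑ i, m i ξ * (Complex.exp (((ξ i / 4 : ℝ) : ℂ) * Complex.I) - 1) ^ M := by
  set e : Fin n → E n → ℂ := fun i ξ => (Complex.exp (((ξ i / 4 : ℝ) : ℂ) * Complex.I) - 1) ^ M
  have he : ∀ i, ContDiff ℝ ∞ (e i) := by
    intro i
    have h1 : ContDiff ℝ ∞ fun ξ : E n => ξ i / 4 :=
      (EuclideanSpace.proj i : E n →L[ℝ] ℝ).contDiff.div_const 4
    exact (((Complex.ofRealCLM.contDiff.comp h1).mul contDiff_const).cexp.sub contDiff_const).pow M
  -- With Q = Σ|e_i|², the coefficients are m_i = θ · conj(e_i) / Q.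
  set e' : Fin n → E n → ℂ := fun i ξ => (starRingEnd ℂ) (e i ξ)
  have he' : ∀ i, ContDiff ℝ ∞ (e' i) := fun i => Complex.conjCLE.contDiff.comp (he i)
  set Q : E n → ℂ := fun ξ => ∑ i, e i ξ * e' i ξ
  have hQ : ContDiff ℝ ∞ Q := ContDiff.sum fun i _ => (he i).mul (he' i)
  have hQe : ∀ ξ, Q ξ = ((∑ i, Complex.normSq (e i ξ) : ℝ) : ℂ) := by
    intro ξ
    simp only [Q, e', Complex.mul_conj]
    push_cast
    rfl
  -- Some coordinate is nonzero and |ξ_i|/4 ≤ 2 < 2π, so the corresponding exponential is not 1. The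
  -- divisor 4 in the symbol is there for this.
  have hQ0 : ∀ ξ : E n, 1 ≤ ‖ξ‖ ∧ ‖ξ‖ ≤ 8 → Q ξ ≠ 0 := by
    rintro ξ ⟨h1, h8⟩
    rw [hQe, Complex.ofReal_ne_zero]
    have hξ : ξ ≠ 0 := by rintro rfl; norm_num at h1
    obtain ⟨i, hi⟩ : ∃ i, ξ i ≠ 0 := by
      by_contra h
      push Not at h
      exact hξ (by ext i; simpa using h i)
    refine (Finset.sum_pos' (fun i _ => Complex.normSq_nonneg _) ⟨i, Finset.mem_univ i, ?_⟩).ne'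
    refine Complex.normSq_pos.2 (pow_ne_zero M (sub_ne_zero.2 (cexp_mul_I_ne_one ?_ ?_)))
    · exact div_ne_zero hi (by norm_num)
    · have h2 : |ξ i| ≤ ‖ξ‖ := by simpa using PiLp.norm_apply_le ξ i
      rw [abs_div, abs_of_pos (by norm_num : (0 : ℝ) < 4)]
      linarith [Real.pi_gt_three]
  have hθc : ContDiff ℝ ∞ fun ξ => ((θ ξ : ℝ) : ℂ) := Complex.ofRealCLM.contDiff.comp (θ.smooth ⊤)
  have hsub : ∀ i, Function.support (fun ξ => ((θ ξ : ℝ) : ℂ) * e' i ξ) ⊆ Function.support θ := by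
    intro i ξ hξ
    simp only [Function.mem_support, ne_eq, mul_eq_zero, not_or, Complex.ofReal_eq_zero] at hξ ⊢
    exact hξ.1
  have hm : ∀ i, ∃ S : 𝓢(E n, ℂ), ∀ ξ, S ξ = (((θ ξ : ℝ) : ℂ) * e' i ξ) / Q ξ := fun i =>
    exists_schwartz_div (hθc.mul (he' i)) (hθ.hasCompactSupport.mono (hsub i)) hQ fun ξ hξ =>
      hQ0 ξ (hθ.tsupport_subset (closure_mono (hsub i) hξ))
  choose m hm using hm
  refine ⟨m, fun ξ => ?_⟩
  by_cases h0 : θ ξ = 0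
  · simp [hm, h0]
  · have h1 := hQ0 ξ (hθ.tsupport_subset (subset_closure h0))
    have h2 : ∀ i, m i ξ * e i ξ = ((θ ξ : ℝ) : ℂ) / Q ξ * (e i ξ * e' i ξ) := by
      intro i; rw [hm]; ring
    change _ = ∑ i, m i ξ * e i ξ
    simp only [h2]
    rw [← Finset.mul_sum, div_mul_cancel₀ _ h1]

end Annulus

theorem exists_schwartz_dilation {n : ℕ} (S : 𝓢(E n, ℂ)) {c : ℝ} (hc : c ≠ 0) :
    ∃ S' : 𝓢(E n, ℂ), ∀ ξ, S' ξ = S (c • ξ) :=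
  ⟨SchwartzMap.compCLMOfContinuousLinearEquiv ℂ
    (ContinuousLinearEquiv.smulLeft (Units.mk0 c hc) : E n ≃L[ℝ] E n) S, fun _ => rfl⟩

/-- Littlewood–Paley pieces of a function with bounded difference quotients. -/
theorem exists_represents_annulus_multiplier {n M : ℕ} {s : ℝ} {θ : 𝓢(E n, ℝ)}
    (hθ : IsAnnulusCutoff θ) : ∃ C : ℝ, 0 ≤ C ∧ ∀ (F : E n → ℂ) (K : ℝ), Continuous F →
    (∀ x y, ‖((fwdDiff y)^[M] F) x‖ ≤ K * ‖y‖ ^ s) → ∀ T : 𝓢'(E n, ℂ), Represents F T →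
    ∀ j : ℤ, ∃ b : E n → ℂ, Continuous b ∧ (∀ x, ‖b x‖ ≤ C * K * (2 : ℝ) ^ (-(j : ℝ) * s)) ∧
      Represents b (multiplier (dyadic θ j) T) := by
  obtain ⟨m, hm⟩ := hθ.exists_decomposition M
  choose κ hκ using fun i => exists_schwartz_dilation (m i) (c := 2 * π) Real.two_pi_pos.ne'
  choose C hC hb using fun i => exists_represents_multiplier (κ i)
  refine ⟨∑ i, C i 0 * (1 / 4) ^ s, Finset.sum_nonneg fun i _ => mul_nonneg (hC i 0) (by positivity),
    fun F K hF hK T hT j => ?_⟩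
  set r : ℝ := (2 : ℝ) ^ j with hr
  have hr0 : 0 < r := by positivity
  -- With this step length, 2π⟨ξ, y_i⟩ is one quarter of the i-th coordinate of 2^{-j}(2πξ), which
  -- is the argument in the decomposition of θ. The bound |y_i|^s supplies the decay 2^{-js}.
  set y : Fin n → E n := fun i => EuclideanSpace.single i (r⁻¹ / 4)
  have hy : ∀ i, ‖y i‖ = r⁻¹ / 4 := fun i => by
    simp only [y, PiLp.norm_single, Real.norm_eq_abs]
    exact abs_of_pos (by positivity)
  have hcont : ∀ i, Continuous ((fwdDiff (y i))^[M] F) := by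
    intro i
    have : ∀ m : ℕ, Continuous ((fwdDiff (y i))^[m] F) := by
      intro m
      induction m with
      | zero => exact hF
      | succ m ih =>
        rw [Function.iterate_succ_apply']
        exact (ih.comp (continuous_add_const _)).sub ih
    exact this M
  choose b hbc hbb hbr using fun i => hb i r hr0 _ (K * ‖y i‖ ^ s)
    (hcont i).aestronglyMeasurable (fun x => hK x (y i)) _ (hT.fwdDiff_iter (y i) M)
  refine ⟨fun x => ∑ i, b i x, continuous_finsetSum _ fun i _ => (hbc i).continuous, fun x => ?_, ?_⟩
  · have h1 : ∀ i, ‖b i x‖ ≤ C i 0 * (1 / 4) ^ s * K * (2 : ℝ) ^ (-(j : ℝ) * s) := by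
      intro i
      have h2 := hbb i 0 x
      rw [norm_iteratedFDeriv_zero, pow_zero, mul_one, hy] at h2
      refine h2.trans (le_of_eq ?_)
      have h3 : (r⁻¹ / 4) ^ s = (1 / 4) ^ s * (2 : ℝ) ^ (-(j : ℝ) * s) := by
        rw [div_eq_mul_one_div, Real.mul_rpow (by positivity) (by positivity), mul_comm, hr,
          ← zpow_neg, ← Real.rpow_intCast, ← Real.rpow_mul two_pos.le]
        push_cast
        rfl
      rw [h3]
      ring
    refine (norm_sum_le_of_le _ fun i _ => h1 i).trans (le_of_eq ?_)
    rw [Finset.sum_mul, Finset.sum_mul]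
  · have h1 := Represents.sum Finset.univ hbr
    convert h1 using 1
    have ht1 : ∀ i, Function.HasTemperateGrowth (fun ξ => (character (y i) ξ - 1) ^ M) := fun i =>
      ((character_hasTemperateGrowth _).sub (Function.HasTemperateGrowth.const (1 : ℂ))).pow M
    have ht2 : ∀ i, Function.HasTemperateGrowth (fun ξ => κ i (r⁻¹ • ξ)) := fun i =>
      comp_smul_hasTemperateGrowth _ _
    have h2 : ∀ i, TemperedDistribution.fourierMultiplierCLM ℂ (fun ξ => κ i (r⁻¹ • ξ))
        (TemperedDistribution.fourierMultiplierCLM ℂ (fun ξ => (character (y i) ξ - 1) ^ M) T) =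
        TemperedDistribution.fourierMultiplierCLM ℂ
          (fun ξ => (character (y i) ξ - 1) ^ M * κ i (r⁻¹ • ξ)) T := fun i =>
      TemperedDistribution.fourierMultiplierCLM_fourierMultiplierCLM_apply (ht1 i) (ht2 i) T
    simp only [h2]
    have ht3 : ∀ i ∈ Finset.univ, Function.HasTemperateGrowth
        (fun ξ => (character (y i) ξ - 1) ^ M * κ i (r⁻¹ • ξ)) := fun i _ => (ht1 i).mul (ht2 i)
    rw [multiplier, ← sum_apply, ← TemperedDistribution.fourierMultiplierCLM_sum ℂ ht3]
    congr 2
    funext ξ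
    rw [dyadic, hm]
    refine Finset.sum_congr rfl fun i _ => ?_
    rw [hκ, mul_comm, zpow_neg, ← hr, smul_comm]
    congr 4
    simp only [y, EuclideanSpace.inner_single_right]
    congr 2
    simp
    ring

/-! ### Littlewood–Paley pieces of an element of the Besov space -/

theorem dyadic_hasTemperateGrowth {n : ℕ} (θ : 𝓢(E n, ℝ)) (j : ℤ) :
    Function.HasTemperateGrowth (fun ξ : E n => ((dyadic θ j ((2 * π) • ξ) : ℝ) : ℂ)) := by
  have h1 : Function.HasTemperateGrowth (fun ξ : E n => (2 : ℝ) ^ (-j) • (2 * π) • ξ) := by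
    fun_prop
  exact Function.HasTemperateGrowth.comp Function.Complex.hasTemperateGrowth_ofReal
    (Function.HasTemperateGrowth.comp θ.hasTemperateGrowth h1)

theorem fourierMultiplierCLM_add_apply {n : ℕ} {a b : E n → ℂ} (ha : a.HasTemperateGrowth)
    (hb : b.HasTemperateGrowth) (T : 𝓢'(E n, ℂ)) :
    TemperedDistribution.fourierMultiplierCLM ℂ (a + b) T =
      TemperedDistribution.fourierMultiplierCLM ℂ a T +
      TemperedDistribution.fourierMultiplierCLM ℂ b T := by
  simp only [TemperedDistribution.fourierMultiplierCLM_apply,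
    TemperedDistribution.smulLeftCLM_add ha hb, add_apply]
  exact map_add (FourierTransform.fourierInvCLM ℂ 𝓢'(E n, ℂ)) _ _

section Ball

variable {n : ℕ} {ψ : 𝓢(E n, ℝ)}

theorem IsBallCutoff.eq_one (hψ : IsBallCutoff ψ) {ξ : E n} (h : ‖ξ‖ < 1) : ψ ξ = 1 := by
  have h1 := (hψ ξ).1
  have h2 := (hψ ξ).2
  rw [Set.indicator_of_mem (by simpa using h)] at h1
  rw [Set.indicator_of_mem (by simpa using h.trans one_lt_two)] at h2
  exact le_antisymm h2 h1

theorem IsBallCutoff.eq_zero (hψ : IsBallCutoff ψ) {ξ : E n} (h : 2 ≤ ‖ξ‖) : ψ ξ = 0 := by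
  have h1 := (hψ ξ).1
  have h2 := (hψ ξ).2
  rw [Set.indicator_of_notMem (by simpa using one_le_two.trans h)] at h1
  rw [Set.indicator_of_notMem (by simpa using h)] at h2
  exact le_antisymm h2 h1

theorem support_difference_subset (hψ : IsBallCutoff ψ) {φ : E n → ℝ}
    (hφ : ∀ ξ, φ ξ = ψ ((2 : ℝ)⁻¹ • ξ) - ψ ξ) {ξ : E n} (h : φ ξ ≠ 0) : 1 ≤ ‖ξ‖ ∧ ‖ξ‖ < 4 := by
  have h2 : ‖(2 : ℝ)⁻¹ • ξ‖ = ‖ξ‖ / 2 := by rw [norm_smul]; simp; ring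
  constructor
  · by_contra h1
    rw [not_le] at h1
    refine h ?_
    rw [hφ, hψ.eq_one h1, hψ.eq_one (by rw [h2]; linarith [norm_nonneg ξ]), sub_self]
  · by_contra h1
    rw [not_lt] at h1
    refine h ?_
    rw [hφ, hψ.eq_zero (by rw [h2]; linarith), hψ.eq_zero (by linarith), sub_self]

/-- The support of φ lies in 1 ≤ |ξ| ≤ 4. There θ ≥ 1 for 2 ≤ |ξ| < 4 and θ(2·) ≥ 1 for 1 ≤ |ξ| < 2,
so the sum is bounded below by 1 and can be divided out. -/
theorem exists_difference_div (hψ : IsBallCutoff ψ) {φ : E n → ℝ}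
    (hφ : ∀ ξ, φ ξ = ψ ((2 : ℝ)⁻¹ • ξ) - ψ ξ) {θ : 𝓢(E n, ℝ)} (hθ : IsAnnulusCutoff θ) :
    ∃ σ : 𝓢(E n, ℂ), ∀ ξ, ((φ ξ : ℝ) : ℂ) = ((θ ξ : ℝ) + (θ ((2 : ℝ) • ξ) : ℝ)) * σ ξ := by
  set Q : E n → ℝ := fun ξ => θ ξ + θ ((2 : ℝ) • ξ)
  have hQc : ContDiff ℝ ∞ Q := (θ.smooth ⊤).add ((θ.smooth ⊤).comp (contDiff_const_smul (2 : ℝ)))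
  have hφc : ContDiff ℝ ∞ φ := by
    rw [funext hφ]
    exact ((ψ.smooth ⊤).comp (contDiff_const_smul (2 : ℝ)⁻¹)).sub (ψ.smooth ⊤)
  have hQ : ∀ ξ, φ ξ ≠ 0 → 1 ≤ Q ξ := by
    intro ξ h
    obtain ⟨h1, h4⟩ := support_difference_subset hψ hφ h
    rcases le_or_gt 2 ‖ξ‖ with h2 | h2
    · exact le_add_of_le_of_nonneg (hθ.one_le h2 h4) (hθ.nonneg _)
    · have h3 : ‖(2 : ℝ) • ξ‖ = 2 * ‖ξ‖ := by rw [norm_smul]; simp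
      exact le_add_of_nonneg_of_le (hθ.nonneg _)
        (hθ.one_le (by rw [h3]; linarith) (by rw [h3]; linarith))
  have hsupp : Function.support (fun ξ => ((φ ξ : ℝ) : ℂ)) ⊆ {ξ | 1 ≤ Q ξ} := fun ξ hξ =>
    hQ ξ (by simpa using hξ)
  have hcomp : HasCompactSupport (fun ξ => ((φ ξ : ℝ) : ℂ)) := by
    refine HasCompactSupport.of_support_subset_isCompact (isCompact_closedBall (0 : E n) 4) ?_
    intro ξ hξ
    simpa using (support_difference_subset hψ hφ (by simpa using hξ)).2.le
  obtain ⟨σ, hσ⟩ := exists_schwartz_div (f := fun ξ => ((φ ξ : ℝ) : ℂ))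
    (Q := fun ξ => ((Q ξ : ℝ) : ℂ)) (Complex.ofRealCLM.contDiff.comp hφc) hcomp
    (Complex.ofRealCLM.contDiff.comp hQc) (fun ξ hξ => by
      have : 1 ≤ Q ξ := closure_minimal hsupp (isClosed_le continuous_const hQc.continuous) hξ
      exact Complex.ofReal_ne_zero.2 (by linarith))
  refine ⟨σ, fun ξ => ?_⟩
  rw [hσ, ← Complex.ofReal_add]
  by_cases h : φ ξ = 0
  · simp [h]
  · have : ((Q ξ : ℝ) : ℂ) ≠ 0 := Complex.ofReal_ne_zero.2 (by linarith [hQ ξ h])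
    exact (mul_div_cancel₀ _ this).symm

end Ball

theorem two_rpow_mul_zpow_pow (s : ℝ) (j : ℤ) (k : ℕ) :
    (2 : ℝ) ^ (-(j : ℝ) * s) * ((2 : ℝ) ^ j) ^ k = (2 : ℝ) ^ ((j : ℝ) * (k - s)) := by
  rw [← zpow_natCast, ← zpow_mul, ← Real.rpow_intCast, ← Real.rpow_add two_pos]
  congr 1
  push_cast
  ring

/-- Bernstein's inequality for φ_j = (θ_j + θ_{j−1})σ_j: the Schwartz multiplier σ_j acts on a
function bounded by a multiple of 2^{-js}, and each derivative costs 2^j. The constants are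
independent of f and j. -/
theorem exists_pieces {n : ℕ} (s : ℝ) {θ ψ : 𝓢(E n, ℝ)} (hθ : IsAnnulusCutoff θ)
    (hψ : IsBallCutoff ψ) {φ : E n → ℝ} (hφ : ∀ ξ, φ ξ = ψ ((2 : ℝ)⁻¹ • ξ) - ψ ξ) :
    ∃ C : ℕ → ℝ, (∀ k, 0 ≤ C k) ∧ ∀ (f : 𝓢'(E n, ℂ)) (A : ℝ) (g : ℤ → E n → ℂ),
    (∀ j, AEStronglyMeasurable (g j) volume) →
    (∀ j x, ‖g j x‖ ≤ A * (2 : ℝ) ^ (-(j : ℝ) * s)) →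
    (∀ j, Represents (g j) (multiplier (dyadic θ j) f)) →
    ∃ B : ℤ → E n → ℂ, ∀ j, ContDiff ℝ ∞ (B j) ∧
      (∀ (k : ℕ) x, ‖iteratedFDeriv ℝ k (B j) x‖ ≤ C k * A * (2 : ℝ) ^ ((j : ℝ) * (k - s))) ∧
      Represents (B j) (multiplier (dyadic φ j) f) := by
  obtain ⟨σ, hσ⟩ := exists_difference_div hψ hφ hθ
  obtain ⟨κ, hκ⟩ := exists_schwartz_dilation σ (c := 2 * π) Real.two_pi_pos.ne'
  obtain ⟨C, hC, h⟩ := exists_represents_multiplier κ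
  refine ⟨fun k => C k * (1 + (2 : ℝ) ^ s), fun k => mul_nonneg (hC k) (by positivity),
    fun f A g hgm hgb hgr => ?_⟩
  have hb : ∀ (j : ℤ) x, ‖g j x + g (j - 1) x‖ ≤ A * (1 + (2 : ℝ) ^ s) * (2 : ℝ) ^ (-(j : ℝ) * s) := by
    intro j x
    refine (norm_add_le_of_le (hgb j x) (hgb (j - 1) x)).trans (le_of_eq ?_)
    have : (2 : ℝ) ^ (-((j - 1 : ℤ) : ℝ) * s) = (2 : ℝ) ^ s * (2 : ℝ) ^ (-(j : ℝ) * s) := by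
      rw [← Real.rpow_add two_pos]
      congr 1
      push_cast
      ring
    rw [this]
    ring
  choose B hB1 hB2 hB3 using fun j : ℤ => h ((2 : ℝ) ^ j) (by positivity) _ _
    ((hgm j).add (hgm (j - 1))) (hb j) _ ((hgr j).add (hgr (j - 1)))
  refine ⟨B, fun j => ⟨hB1 j, fun k x => (hB2 j k x).trans (le_of_eq ?_), ?_⟩⟩
  · rw [← two_rpow_mul_zpow_pow]
    ring
  · convert hB3 j using 1
    have t1 := dyadic_hasTemperateGrowth θ j
    have t2 := dyadic_hasTemperateGrowth θ (j - 1)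
    have t3 := comp_smul_hasTemperateGrowth κ ((2 : ℝ) ^ j)⁻¹
    have e := fourierMultiplierCLM_add_apply t1 t2 f
    simp only [multiplier]
    rw [← e, TemperedDistribution.fourierMultiplierCLM_fourierMultiplierCLM_apply (t1.add t2) t3]
    congr 2
    funext ξ
    simp only [Pi.mul_apply, Pi.add_apply]
    rw [hκ, ← zpow_neg, smul_comm, dyadic, hσ, dyadic, dyadic]
    congr 4
    rw [smul_smul (2 : ℝ)]
    congr 2
    rw [neg_sub, sub_eq_add_neg, zpow_add₀ two_ne_zero, zpow_one]

/-! ### Taylor polynomials -/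

/-- After a cut-off, u is the Fourier transform of a Schwartz function near 0. Its derivatives there
are integrals of products of the factors ⟨x, v_i⟩, which are visibly symmetric. -/
theorem iteratedFDeriv_zero_perm {n : ℕ} {u : E n → ℂ} (hu : ContDiff ℝ ∞ u) {k : ℕ}
    (v : Fin k → E n) (σ : Equiv.Perm (Fin k)) :
    iteratedFDeriv ℝ k u 0 (fun i => v (σ i)) = iteratedFDeriv ℝ k u 0 v := by
  let f : ContDiffBump (0 : E n) := ⟨1, 2, one_pos, one_lt_two⟩
  have hc : HasCompactSupport (fun x => f x • u x) := f.hasCompactSupport.smul_right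
  let h : 𝓢(E n, ℂ) := hc.toSchwartzMap (f.contDiff.smul hu)
  have h1 : ⇑h =ᶠ[𝓝 0] u := by
    filter_upwards [f.eventuallyEq_one] with x hx
    change f x • u x = u x
    simp [hx]
  rw [← (h1.iteratedFDeriv ℝ k).eq_of_nhds]
  have h2 : h = 𝓕 (𝓕⁻ h) := (FourierTransform.fourier_fourierInv_eq h).symm
  set w := 𝓕⁻ h
  have h0 : ∀ m : ℕ, (m : ℕ∞) ≤ ⊤ → Integrable (fun v => ‖v‖ ^ m * ‖w v‖) :=
    fun m _ => w.integrable_pow_mul volume m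
  have h3 : iteratedFDeriv ℝ k h = 𝓕 fun v => VectorFourier.fourierPowSMulRight (innerSL ℝ) w v k := by
    rw [h2, SchwartzMap.fourier_coe]
    exact Real.iteratedFDeriv_fourier (N := ⊤) h0 w.integrable.aestronglyMeasurable (n := k) le_top
  have h4 : Integrable (fun v => VectorFourier.fourierPowSMulRight (innerSL ℝ) w v k) :=
    VectorFourier.integrable_fourierPowSMulRight _ (h0 k le_top) w.integrable.aestronglyMeasurable
  rw [h3, Real.fourier_eq']
  have h5 : ∀ x : E n, Complex.exp (((-2 * π * inner ℝ x 0 : ℝ) : ℂ) * Complex.I) = 1 := by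
    intro x; simp
  simp only [h5, one_smul]
  rw [ContinuousMultilinearMap.integral_apply h4, ContinuousMultilinearMap.integral_apply h4]
  congr 1
  funext x
  rw [VectorFourier.fourierPowSMulRight_apply, VectorFourier.fourierPowSMulRight_apply]
  congr 2
  exact Equiv.prod_comp σ fun i => (innerSL ℝ) x (v i)

theorem contDiff_polyEval {n : ℕ} (p : MvPolynomial (Fin n) ℂ) : ContDiff ℝ ∞ (polyEval n p) := by
  induction p using MvPolynomial.induction_on with
  | C a =>
    have : polyEval n (MvPolynomial.C a) = fun _ => a := by ext x; simp [polyEval]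
    rw [this]
    exact contDiff_const
  | add p q hp hq =>
    rw [map_add]
    exact hp.add hq
  | mul_X p i hp =>
    have : polyEval n (p * MvPolynomial.X i) = fun x => polyEval n p x * ((x i : ℝ) : ℂ) := by
      ext x; simp [polyEval]
    rw [this]
    exact hp.mul (Complex.ofRealCLM.contDiff.comp
      (EuclideanSpace.proj i : E n →L[ℝ] ℝ).contDiff)

theorem exists_polyEval_eq_multilinear {n k : ℕ} (L : (E n) [×k]→L[ℝ] ℂ) :
    ∃ p : MvPolynomial (Fin n) ℂ, ∀ x, polyEval n p x = L fun _ => x := by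
  refine ⟨∑ i : Fin k → Fin n, MvPolynomial.C (L fun l => EuclideanSpace.single (i l) 1) *
    ∏ l, MvPolynomial.X (i l), fun x => ?_⟩
  have hx : x = ∑ a, x a • EuclideanSpace.single a (1 : ℝ) := by
    simpa using ((EuclideanSpace.basisFun (Fin n) ℝ).sum_repr x).symm
  have h1 : (L fun _ => x) = L fun _ => ∑ a, x a • EuclideanSpace.single a (1 : ℝ) := by
    rw [← hx]
  rw [h1, L.map_sum]
  simp only [polyEval, LinearMap.coe_mk, AddHom.coe_mk, map_sum, map_mul, map_prod,
    MvPolynomial.eval_C, MvPolynomial.eval_X]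
  rw [Finset.sum_apply]
  refine Finset.sum_congr rfl fun i _ => ?_
  rw [L.map_smul_univ, Complex.real_smul, mul_comm, Complex.ofReal_prod]

/-- Used only for vanishing: for m < k the power of |x| is zero at the origin, and for m > k the
descending factorial is zero. -/
theorem norm_iteratedFDeriv_diagonal_le {n k : ℕ} (L : (E n) [×k]→L[ℝ] ℂ) (m : ℕ) (x : E n) :
    ∃ C, ‖iteratedFDeriv ℝ m (fun x => L fun _ => x) x‖ ≤
      C * ((k.descFactorial m : ℝ) * ‖x‖ ^ (k - m)) := by
  let D : E n →L[ℝ] (Fin k → E n) := ContinuousLinearMap.pi fun _ => ContinuousLinearMap.id ℝ (E n)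
  have h1 : (fun x : E n => L fun _ => x) = L ∘ D := rfl
  rw [h1, ContinuousLinearMap.iteratedFDeriv_comp_right D L.contDiff x le_rfl]
  refine ⟨‖L‖ * ∏ _i : Fin m, ‖D‖, (ContinuousMultilinearMap.norm_compContinuousLinearMap_le _ _).trans ?_⟩
  have h2 := L.norm_iteratedFDeriv_le m (D x)
  rw [Fintype.card_fin] at h2
  have h3 : ‖D x‖ ≤ ‖x‖ := (pi_norm_le_iff_of_nonneg (norm_nonneg x)).2 fun _ => le_rfl
  calc _ ≤ (k.descFactorial m : ℝ) * ‖L‖ * ‖D x‖ ^ (k - m) * ∏ _i : Fin m, ‖D‖ := by gcongr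
    _ ≤ (k.descFactorial m : ℝ) * ‖L‖ * ‖x‖ ^ (k - m) * ∏ _i : Fin m, ‖D‖ := by gcongr
    _ = _ := by ring

/-- Add the homogeneous terms D^M u(0)[x, …, x]/M! one at a time. The M-th derivative of such a term
sums over permutations, and symmetry of D^M u(0) turns this into M! equal summands. -/
theorem exists_taylor_polynomial {n : ℕ} {u : E n → ℂ} (hu : ContDiff ℝ ∞ u) (M : ℕ) :
    ∃ p : MvPolynomial (Fin n) ℂ,
      (∀ k < M, iteratedFDeriv ℝ k (polyEval n p) 0 = iteratedFDeriv ℝ k u 0) ∧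
      ∀ k, M ≤ k → ∀ x, iteratedFDeriv ℝ k (polyEval n p) x = 0 := by
  induction M with
  | zero =>
    refine ⟨0, by simp, fun k _ x => ?_⟩
    rw [map_zero]
    exact congrFun iteratedFDeriv_fun_zero x
  | succ M ih =>
    obtain ⟨p, hp1, hp2⟩ := ih
    have hpc := contDiff_polyEval p
    set L := iteratedFDeriv ℝ M u 0
    obtain ⟨q, hq⟩ := exists_polyEval_eq_multilinear (((M.factorial : ℝ)⁻¹) • L)
    have hqf := funext hq
    have hqc := contDiff_polyEval q
    have hqk : ∀ k x, ∃ C, ‖iteratedFDeriv ℝ k (polyEval n q) x‖ ≤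
        C * ((M.descFactorial k : ℝ) * ‖x‖ ^ (M - k)) := by
      rw [hqf]
      exact norm_iteratedFDeriv_diagonal_le _
    have hadd : ∀ k x, iteratedFDeriv ℝ k (polyEval n (p + q)) x =
        iteratedFDeriv ℝ k (polyEval n p) x + iteratedFDeriv ℝ k (polyEval n q) x := by
      intro k x
      rw [map_add]
      exact iteratedFDeriv_add_apply (hpc.contDiffAt.of_le (by exact_mod_cast le_top))
        (hqc.contDiffAt.of_le (by exact_mod_cast le_top))
    refine ⟨p + q, fun k hk => ?_, fun k hk x => ?_⟩
    · rw [hadd]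
      rcases Nat.lt_succ_iff_lt_or_eq.1 hk with h | rfl
      · obtain ⟨C, hC⟩ := hqk k 0
        rw [norm_zero, zero_pow (by omega), mul_zero, mul_zero] at hC
        rw [norm_le_zero_iff.1 hC, add_zero, hp1 k h]
      · rw [hp2 k le_rfl, zero_add, hqf]
        ext v
        rw [ContinuousMultilinearMap.iteratedFDeriv_comp_diagonal]
        simp only [smul_apply]
        have h2 : ∀ σ : Equiv.Perm (Fin k), L (fun i => v (σ i)) = L v :=
          iteratedFDeriv_zero_perm hu v
        simp only [h2, Finset.sum_const, Finset.card_univ, Fintype.card_perm, Fintype.card_fin]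
        rw [← Nat.cast_smul_eq_nsmul ℝ, smul_inv_smul₀]
        exact_mod_cast k.factorial_ne_zero
    · obtain ⟨C, hC⟩ := hqk k x
      rw [Nat.descFactorial_of_lt hk, Nat.cast_zero, zero_mul, mul_zero] at hC
      rw [hadd, hp2 k (by omega), norm_le_zero_iff.1 hC, add_zero]

/-! ### Series with locally uniformly summable derivatives -/

/-- Termwise differentiation. Summability is required only on balls, because the Taylor-corrected
pieces grow polynomially at infinity. -/
theorem hasFTaylorSeriesUpTo_tsum {n : ℕ} {u : ℕ → E n → ℂ} (hu : ∀ j, ContDiff ℝ ∞ (u j))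
    (h : ∀ (k : ℕ) (R : ℝ), ∃ a : ℕ → ℝ, Summable a ∧
      ∀ j x, ‖x‖ < R → ‖iteratedFDeriv ℝ k (u j) x‖ ≤ a j) :
    HasFTaylorSeriesUpTo (∞ : WithTop ℕ∞) (fun x => ∑' j, u j x)
      (fun x k => ∑' j, iteratedFDeriv ℝ k (u j) x) := by
  have hsum : ∀ (k : ℕ) x, Summable fun j => iteratedFDeriv ℝ k (u j) x := by
    intro k x
    obtain ⟨a, ha, hb⟩ := h k (‖x‖ + 1)
    exact Summable.of_norm_bounded ha fun j => hb j x (by linarith)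
  have hder : ∀ (m : ℕ) x, HasFDerivAt (fun y => ∑' j, iteratedFDeriv ℝ m (u j) y)
      ((∑' j, iteratedFDeriv ℝ (m + 1) (u j) x).curryLeft) x := by
    intro m x
    obtain ⟨a, ha, hb⟩ := h (m + 1) (‖x‖ + 1)
    have h1 : (∑' j, iteratedFDeriv ℝ (m + 1) (u j) x).curryLeft =
        ∑' j, (iteratedFDeriv ℝ (m + 1) (u j) x).curryLeft :=
      (continuousMultilinearCurryLeftEquiv ℝ (fun _ : Fin (m + 1) => E n) ℂ).toContinuousLinearEquiv.map_tsum
    rw [h1]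
    refine hasFDerivAt_tsum_of_isPreconnected (s := Metric.ball (0 : E n) (‖x‖ + 1))
      (f := fun j y => iteratedFDeriv ℝ m (u j) y)
      (f' := fun j y => (iteratedFDeriv ℝ (m + 1) (u j) y).curryLeft) ha Metric.isOpen_ball
      (convex_ball _ _).isPreconnected (fun j y _ => ?_) (fun j y hy => ?_) (x₀ := 0) ?_
      (hsum m 0) ?_
    · have := (hu j).ftaylorSeries.fderiv m (by exact_mod_cast ENat.natCast_lt_top m) y
      exact this
    · rw [ContinuousMultilinearMap.curryLeft_norm]
      exact hb j y (by simpa using hy)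
    · simp only [Metric.mem_ball, dist_self]; positivity
    · simp
  refine ⟨fun x => ?_, fun m _ x => hder m x, fun m _ => ?_⟩
  · have h1 : (∑' j, iteratedFDeriv ℝ 0 (u j) x).curry0 =
        ∑' j, (iteratedFDeriv ℝ 0 (u j) x).curry0 :=
      (continuousMultilinearCurryFin0 ℝ (E n) ℂ).toContinuousLinearEquiv.map_tsum
    rw [h1]
    rfl
  · exact continuous_iff_continuousAt.2 fun x => (hder m x).continuousAt

/-! ### Bounds for iterated differences -/

section FwdDiff

variable {n : ℕ}

theorem norm_fwdDiff_iter_le (y : E n) (m : ℕ) : ∀ {g : E n → ℂ} {a : ℝ}, (∀ x, ‖g x‖ ≤ a) →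
    ∀ x, ‖((fwdDiff y)^[m] g) x‖ ≤ 2 ^ m * a := by
  induction m with
  | zero => intro g a h x; simpa using h x
  | succ m ih =>
    intro g a h x
    rw [Function.iterate_succ_apply, pow_succ, mul_assoc]
    refine ih (fun z => ?_) x
    rw [two_mul]
    exact norm_sub_le_of_le (h _) (h _)

/-- Each difference trades one derivative for one factor |y| by the mean value inequality. This is
the low-frequency bound; the supremum bound serves for high frequencies. -/
theorem norm_fwdDiff_iter_le_of_iteratedFDeriv (y : E n) (m : ℕ) : ∀ {g : E n → ℂ} {a : ℝ},
    ContDiff ℝ ∞ g → (∀ x, ‖iteratedFDeriv ℝ m g x‖ ≤ a) →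
    ∀ x, ‖((fwdDiff y)^[m] g) x‖ ≤ ‖y‖ ^ m * a := by
  induction m with
  | zero => intro g a _ h x; simpa using h x
  | succ m ih =>
    intro g a hg h x
    have hg' : ContDiff ℝ ∞ (fun x => g (x + y)) := hg.comp (contDiff_id.add contDiff_const)
    rw [Function.iterate_succ_apply, pow_succ, mul_assoc]
    refine ih (hg'.sub hg) (fun z => ?_) x
    have h1 : iteratedFDeriv ℝ m (fun x => g (x + y) - g x) z =
        iteratedFDeriv ℝ m g (z + y) - iteratedFDeriv ℝ m g z := by
      rw [← iteratedFDeriv_comp_add_right m y z]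
      exact iteratedFDeriv_sub_apply (hg'.contDiffAt.of_le (by exact_mod_cast le_top))
        (hg.contDiffAt.of_le (by exact_mod_cast le_top))
    have h2 : ∀ w ∈ Set.univ, ‖fderiv ℝ (iteratedFDeriv ℝ m g) w‖ ≤ a := fun w _ => by
      rw [norm_fderiv_iteratedFDeriv]
      exact h w
    have h3 := convex_univ.norm_image_sub_le_of_norm_fderiv_le (x := z) (y := z + y)
      (fun w _ => (hg.differentiable_iteratedFDeriv
        (by exact_mod_cast ENat.natCast_lt_top m)).differentiableAt) h2 trivial trivial
    rw [add_sub_cancel_left, mul_comm, ← h1] at h3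
    exact h3

theorem HasSum.fwdDiff_iter {ι : Type*} (y : E n) (m : ℕ) : ∀ {v : ι → E n → ℂ} {F : E n → ℂ},
    (∀ x, HasSum (fun i => v i x) (F x)) →
    ∀ x, HasSum (fun i => ((fwdDiff y)^[m] (v i)) x) (((fwdDiff y)^[m] F) x) := by
  induction m with
  | zero => intro v F h x; exact h x
  | succ m ih =>
    intro v F h x
    simp only [Function.iterate_succ_apply]
    exact ih (fun z => (h (z + y)).sub (h z)) x

theorem fwdDiff_zero_iter {M : ℕ} (hM : 0 < M) (F : E n → ℂ) (x : E n) :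
    ((fwdDiff (0 : E n))^[M] F) x = 0 := by
  obtain ⟨m, rfl⟩ := Nat.exists_eq_succ_of_ne_zero hM.ne'
  rw [Nat.succ_eq_add_one, Function.iterate_succ_apply']
  change _ - _ = _
  rw [add_zero, sub_self]

end FwdDiff

/-! ### Summation of the pieces -/

theorem summable_pow_natAbs {q : ℝ} (h0 : 0 ≤ q) (h1 : q < 1) :
    Summable fun i : ℤ => q ^ i.natAbs := by
  refine Summable.of_nat_of_neg ?_ ?_
  · simpa using summable_geometric_of_lt_one h0 h1
  · simpa using summable_geometric_of_lt_one h0 h1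

theorem two_rpow_le_pow_natAbs {δ t : ℝ} {i : ℤ} (h : t ≤ -(δ * |(i : ℝ)|)) :
    (2 : ℝ) ^ t ≤ ((2 : ℝ) ^ (-δ)) ^ i.natAbs := by
  rw [← Real.rpow_natCast, ← Real.rpow_mul two_pos.le]
  refine Real.rpow_le_rpow_of_exponent_le one_le_two (h.trans (le_of_eq ?_))
  rw [Nat.cast_natAbs, Int.cast_abs]
  ring

theorem norm_partialDeriv_le {n k : ℕ} (i : Fin k → Fin n) (F : E n → ℂ) (x : E n) :
    ‖partialDeriv i F x‖ ≤ ‖iteratedFDeriv ℝ k F x‖ := by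
  refine (ContinuousMultilinearMap.le_opNorm _ _).trans (le_of_eq ?_)
  simp

/-- Data of a Littlewood–Paley reconstruction: `v i` is the piece `B i`, corrected by a polynomial
for `i ≤ 0`, and `G + H` is the sum of the `v i`. -/
structure Reconstruction {n : ℕ} (s : ℝ) (M : ℕ) (q K : ℝ) (B : ℤ → E n → ℂ) (v : ℤ → E n → ℂ)
    (G H : E n → ℂ) : Prop where
  sub_poly : ∀ i, ∃ p : MvPolynomial (Fin n) ℂ, v i = fun x => B i x - polyEval n p x
  continuous : ∀ i, Continuous (v i)
  hasSum : ∀ x, HasSum (fun i => v i x) (G x + H x)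
  bound : ∀ i x, ‖v i x‖ ≤ K * q ^ i.natAbs * (1 + ‖x‖ ^ M)
  contDiff : ContDiff ℝ ∞ G
  continuous_high : Continuous H
  difference : ∀ x y, ‖((fwdDiff y)^[M] (G + H)) x‖ ≤ K * ‖y‖ ^ s
  low : ∀ (k : ℕ), M ≤ k → ∀ i : Fin k → Fin n, TendstoUniformly
    (fun (N : ℕ) x => ∑ j ∈ Finset.range N, partialDeriv i (B (-(j : ℤ))) x)
    (partialDeriv i G) atTop
  high : TendstoUniformly (fun (N : ℕ) x => ∑ j ∈ Finset.range N, B ((j : ℤ) + 1) x) H atTop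

section Sum

variable {n M : ℕ} {s δ A : ℝ} {C : ℕ → ℝ} {B : ℤ → E n → ℂ}

/-- The corrected low-frequency pieces. -/
theorem exists_corrected_pieces (hδM : δ ≤ M - s)
    (hC : ∀ k, 0 ≤ C k) (hA : 0 ≤ A) (hB : ∀ j, ContDiff ℝ ∞ (B j))
    (hb : ∀ j (k : ℕ) x, ‖iteratedFDeriv ℝ k (B j) x‖ ≤ C k * A * (2 : ℝ) ^ ((j : ℝ) * (k - s)))
    (j : ℕ) : ∃ p : MvPolynomial (Fin n) ℂ,
      (∀ x, ‖((B (-(j : ℤ))) - polyEval n p) x‖ ≤ C M * A * ((2 : ℝ) ^ (-δ)) ^ j * ‖x‖ ^ M) ∧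
      (∀ (k : ℕ) x, k < M → ‖iteratedFDeriv ℝ k ((B (-(j : ℤ))) - polyEval n p) x‖ ≤
        C M * A * ((2 : ℝ) ^ (-δ)) ^ j * ‖x‖ ^ (M - k)) ∧
      (∀ (k : ℕ) x, M ≤ k → iteratedFDeriv ℝ k (polyEval n p) x = 0) ∧
      (∀ (k : ℕ) x, M ≤ k → iteratedFDeriv ℝ k ((B (-(j : ℤ))) - polyEval n p) x =
        iteratedFDeriv ℝ k (B (-(j : ℤ))) x) ∧
      (∀ (k : ℕ) x, M ≤ k → ‖iteratedFDeriv ℝ k (B (-(j : ℤ))) x‖ ≤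
        C k * A * ((2 : ℝ) ^ (-δ)) ^ j) := by
  obtain ⟨p, hp1, hp2⟩ := exists_taylor_polynomial (hB (-(j : ℤ))) M
  have hsub : ∀ k x, iteratedFDeriv ℝ k ((B (-(j : ℤ))) - polyEval n p) x =
      iteratedFDeriv ℝ k (B (-(j : ℤ))) x - iteratedFDeriv ℝ k (polyEval n p) x := fun k x =>
    iteratedFDeriv_sub_apply ((hB _).contDiffAt.of_le (by exact_mod_cast le_top))
      ((contDiff_polyEval p).contDiffAt.of_le (by exact_mod_cast le_top))
  have h1 : ∀ (k : ℕ) x, M ≤ k → iteratedFDeriv ℝ k ((B (-(j : ℤ))) - polyEval n p) x =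
        iteratedFDeriv ℝ k (B (-(j : ℤ))) x := fun k x hk => by rw [hsub, hp2 k hk, sub_zero]
  have h2 : ∀ (k : ℕ) x, M ≤ k → ‖iteratedFDeriv ℝ k (B (-(j : ℤ))) x‖ ≤
        C k * A * ((2 : ℝ) ^ (-δ)) ^ j := by
    intro k x hk
    refine (hb _ k x).trans ?_
    have hk' : (M : ℝ) ≤ k := by exact_mod_cast hk
    have := two_rpow_le_pow_natAbs (δ := δ) (t := ((-(j : ℤ) : ℤ) : ℝ) * (k - s)) (i := -(j : ℤ)) (by
      push_cast
      rw [abs_neg, abs_of_nonneg (Nat.cast_nonneg j)]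
      nlinarith [Nat.cast_nonneg (α := ℝ) j])
    rw [Int.natAbs_neg, Int.natAbs_natCast] at this
    exact mul_le_mul_of_nonneg_left this (mul_nonneg (hC k) hA)
  have h3 := norm_iteratedFDeriv_le_of_vanishing (M := M)
    (((hB (-(j : ℤ))).sub (contDiff_polyEval p)).of_le (by exact_mod_cast le_top))
    (fun x => (le_of_eq (by rw [← h1 M x le_rfl]; rfl)).trans (h2 M x le_rfl))
    (fun k hk => (hsub k 0).trans (by rw [hp1 k hk, sub_self]))
  refine ⟨p, fun x => ?_, fun k x hk => h3 (M - k) k (by omega) x, fun k x hk => hp2 k hk x, h1, h2⟩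
  have := h3 M 0 (by omega) x
  rwa [norm_iteratedFDeriv_zero] at this

/-- The scale 2^i is compared with 1/|y| ≈ 2^{-J}. For i + J ≥ 0 the supremum gives 2^{-is} =
2^{Js}2^{-(i+J)s}. For i + J < 0 the M-th derivative gives |y|^M 2^{i(M−s)}. The polynomial
correction is killed by Δ^M. Both cases decay in |i + J|, so the sum over i does not depend on y. -/
theorem norm_fwdDiff_piece_le (hs : 0 < s) (hδs : δ ≤ s) (hδM : δ ≤ M - s)
    (hsM : s ≤ M) (hC : ∀ k, 0 ≤ C k) (hA : 0 ≤ A) {B v : E n → ℂ} {i J : ℤ} {y : E n}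
    (hJ1 : (2 : ℝ) ^ J ≤ ‖y‖) (hJ2 : ‖y‖ < (2 : ℝ) ^ (J + 1))
    (hB : ContDiff ℝ ∞ B) {p : MvPolynomial (Fin n) ℂ} (hv : v = fun x => B x - polyEval n p x)
    (hp : ∀ x, iteratedFDeriv ℝ M (polyEval n p) x = 0)
    (hb : ∀ (k : ℕ) x, ‖iteratedFDeriv ℝ k B x‖ ≤ C k * A * (2 : ℝ) ^ ((i : ℝ) * (k - s))) (x : E n) :
    ‖((fwdDiff y)^[M] v) x‖ ≤
      2 ^ M * (C 0 + C M) * A * ‖y‖ ^ s * ((2 : ℝ) ^ (-δ)) ^ (i + J).natAbs := by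
  have hy : 0 < ‖y‖ := lt_of_lt_of_le (by positivity) hJ1
  have hP : ∀ x, ((fwdDiff y)^[M] (polyEval n p)) x = 0 := fun x => by
    have := norm_fwdDiff_iter_le_of_iteratedFDeriv y M (contDiff_polyEval p) (a := 0)
      (fun x => by rw [hp, norm_zero]) x
    rwa [mul_zero, norm_le_zero_iff] at this
  have hvB : ((fwdDiff y)^[M] v) x = ((fwdDiff y)^[M] B) x := by
    have h1 : B = v + polyEval n p := by rw [hv]; ext x; simp
    rw [h1, fwdDiff_iter_add', Pi.add_apply, hP, add_zero]
  rw [hvB]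
  have hC0 := hC 0
  have hCM := hC M
  rcases le_or_gt 0 (i + J) with h | h
  · have h' : (0 : ℝ) ≤ i + J := by exact_mod_cast h
    have h0 : ∀ x, ‖B x‖ ≤ C 0 * A * (2 : ℝ) ^ ((i : ℝ) * ((0 : ℕ) - s)) := fun x => by
      rw [← norm_iteratedFDeriv_zero (𝕜 := ℝ)]
      exact hb 0 x
    have h1 := norm_fwdDiff_iter_le y M h0 x
    refine h1.trans ?_
    have h2 : (2 : ℝ) ^ ((i : ℝ) * ((0 : ℕ) - s)) ≤ ‖y‖ ^ s * ((2 : ℝ) ^ (-δ)) ^ (i + J).natAbs := by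
      have e1 : (2 : ℝ) ^ ((i : ℝ) * ((0 : ℕ) - s)) = ((2 : ℝ) ^ J) ^ s * (2 : ℝ) ^ (-((i + J : ℤ) : ℝ) * s) := by
        rw [← Real.rpow_intCast, ← Real.rpow_mul two_pos.le, ← Real.rpow_add two_pos]
        congr 1
        push_cast
        ring
      rw [e1]
      gcongr
      refine two_rpow_le_pow_natAbs ?_
      push_cast
      rw [abs_of_nonneg h']
      nlinarith
    calc _ ≤ 2 ^ M * (C 0 * A * (‖y‖ ^ s * ((2 : ℝ) ^ (-δ)) ^ (i + J).natAbs)) := by gcongr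
      _ = 2 ^ M * C 0 * A * ‖y‖ ^ s * ((2 : ℝ) ^ (-δ)) ^ (i + J).natAbs := by ring
      _ ≤ _ := by gcongr; linarith
  · have h' : (i : ℝ) + J < 0 := by exact_mod_cast h
    have h1 := norm_fwdDiff_iter_le_of_iteratedFDeriv y M hB (hb M) x
    refine h1.trans ?_
    have h2 : ‖y‖ ^ M * (2 : ℝ) ^ ((i : ℝ) * (M - s)) ≤
        2 ^ M * (‖y‖ ^ s * ((2 : ℝ) ^ (-δ)) ^ (i + J).natAbs) := by
      have hpos : 0 ≤ (M : ℝ) - s := sub_nonneg.2 hsM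
      have e1 : ‖y‖ ^ M = ‖y‖ ^ s * ‖y‖ ^ ((M : ℝ) - s) := by
        rw [← Real.rpow_add hy, add_sub_cancel, Real.rpow_natCast]
      have e2 : ‖y‖ ^ ((M : ℝ) - s) ≤ 2 ^ M * (2 : ℝ) ^ ((J : ℝ) * (M - s)) := by
        calc _ ≤ ((2 : ℝ) ^ (J + 1)) ^ ((M : ℝ) - s) := by gcongr
          _ = (2 : ℝ) ^ ((M : ℝ) - s) * (2 : ℝ) ^ ((J : ℝ) * (M - s)) := by
            rw [← Real.rpow_intCast, ← Real.rpow_mul two_pos.le, ← Real.rpow_add two_pos]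
            congr 1
            push_cast
            ring
          _ ≤ _ := by
            gcongr
            rw [← Real.rpow_natCast]
            exact Real.rpow_le_rpow_of_exponent_le one_le_two (by linarith)
      calc _ ≤ ‖y‖ ^ s * (2 ^ M * (2 : ℝ) ^ ((J : ℝ) * (M - s))) * (2 : ℝ) ^ ((i : ℝ) * (M - s)) := by
            rw [e1]; gcongr
        _ = 2 ^ M * (‖y‖ ^ s * (2 : ℝ) ^ (((i : ℝ) + J) * (M - s))) := by
            rw [add_mul, Real.rpow_add two_pos]; ring
        _ ≤ _ := by
            gcongr
            refine two_rpow_le_pow_natAbs ?_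
            push_cast
            rw [abs_of_neg h']
            nlinarith
    calc _ = C M * A * (‖y‖ ^ M * (2 : ℝ) ^ ((i : ℝ) * (M - s))) := by ring
      _ ≤ C M * A * (2 ^ M * (‖y‖ ^ s * ((2 : ℝ) ^ (-δ)) ^ (i + J).natAbs)) := by gcongr
      _ = 2 ^ M * C M * A * ‖y‖ ^ s * ((2 : ℝ) ^ (-δ)) ^ (i + J).natAbs := by ring
      _ ≤ _ := by gcongr; linarith

end Sum

/-- D and q are fixed before A and B, so every estimate is linear in A; continuity of the embedding
rests on this. -/
theorem exists_reconstruction (n : ℕ) {M : ℕ} {s : ℝ} (hs : 0 < s) (hM : s < M) {C : ℕ → ℝ}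
    (hC : ∀ k, 0 ≤ C k) : ∃ D q : ℝ, 0 ≤ D ∧ 0 ≤ q ∧ q < 1 ∧ ∀ (A : ℝ) (B : ℤ → E n → ℂ), 0 ≤ A →
    (∀ j, ContDiff ℝ ∞ (B j)) →
    (∀ j (k : ℕ) x, ‖iteratedFDeriv ℝ k (B j) x‖ ≤ C k * A * (2 : ℝ) ^ ((j : ℝ) * (k - s))) →
    ∃ (v : ℤ → E n → ℂ) (G H : E n → ℂ), Reconstruction s M q (D * A) B v G H := by
  -- The common decay rate: s at high frequencies, M − s at low ones. Both are positive because 0 <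
  -- s < M.
  set δ : ℝ := min s (M - s) with hδ
  have hδ0 : 0 < δ := lt_min hs (by linarith)
  have hδs : δ ≤ s := min_le_left _ _
  have hδM : δ ≤ M - s := min_le_right _ _
  set q : ℝ := (2 : ℝ) ^ (-δ) with hq
  have hq0 : 0 ≤ q := by positivity
  have hq1 : q < 1 := Real.rpow_lt_one_of_one_lt_of_neg one_lt_two (by linarith)
  have hsumq := summable_pow_natAbs hq0 hq1
  set S := ∑' i : ℤ, q ^ i.natAbs with hS
  have hS1 : 1 ≤ S := by
    have := hsumq.le_tsum 0 (fun i _ => by positivity)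
    simpa using this
  have hM0 : 0 < M := by
    have : (0 : ℝ) < M := hs.trans hM
    exact_mod_cast this
  -- The factor S is the sum of the two-sided geometric series in the difference estimate. As S ≥ 1
  -- and 2^M ≥ 1, the same constant also covers the pointwise bounds on the pieces.
  refine ⟨2 ^ M * (C 0 + C M) * S, q, by have := hC 0; have := hC M; positivity, hq0, hq1,
    fun A B hA hB hb => ?_⟩
  have hD : ∀ k ∈ ({0, M} : Set ℕ), C k * A ≤ 2 ^ M * (C 0 + C M) * S * A := by
    intro k hk
    have h0 := hC 0
    have h1 := hC M
    have h2 : C k ≤ C 0 + C M := by rcases hk with rfl | rfl <;> linarith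
    have h3 : (1 : ℝ) ≤ 2 ^ M := one_le_pow₀ one_le_two
    gcongr
    calc C k ≤ 1 * (C 0 + C M) * 1 := by linarith
      _ ≤ _ := by gcongr
  choose p hp1 hp2 hp3 hp4 hp5 using exists_corrected_pieces (n := n) hδM hC hA hB hb
  set u : ℕ → E n → ℂ := fun j => B (-(j : ℤ)) - polyEval n (p j) with hu
  have huc : ∀ j, ContDiff ℝ ∞ (u j) := fun j => (hB _).sub (contDiff_polyEval _)
  set P : ℤ → MvPolynomial (Fin n) ℂ := fun i => if i ≤ 0 then p i.natAbs else 0 with hP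
  set v : ℤ → E n → ℂ := fun i x => B i x - polyEval n (P i) x with hv
  have hvlow : ∀ j : ℕ, v (-(j : ℤ)) = u j := by
    intro j
    simp [hv, hu, hP]
    rfl
  have hvhigh : ∀ j : ℕ, v ((j : ℤ) + 1) = B ((j : ℤ) + 1) := by
    intro j
    have : ¬ ((j : ℤ) + 1 ≤ 0) := by omega
    simp [hv, hP, this]
  have hBhigh : ∀ (j : ℕ) x, ‖B ((j : ℤ) + 1) x‖ ≤ C 0 * A * q ^ (j + 1) := by
    intro j x
    have h1 := hb ((j : ℤ) + 1) 0 x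
    rw [norm_iteratedFDeriv_zero] at h1
    refine h1.trans ?_
    have := two_rpow_le_pow_natAbs (δ := δ) (t := (((j : ℤ) + 1 : ℤ) : ℝ) * ((0 : ℕ) - s))
      (i := (j : ℤ) + 1) (by
      push_cast
      rw [abs_of_nonneg (by positivity)]
      nlinarith [Nat.cast_nonneg (α := ℝ) j])
    have h2 : ((j : ℤ) + 1).natAbs = j + 1 := by omega
    rw [h2] at this
    have := hC 0
    gcongr
  have hgeo : Summable fun j : ℕ => q ^ j := summable_geometric_of_lt_one hq0 hq1
  have hhighs : Summable fun j : ℕ => C 0 * A * q ^ (j + 1) :=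
    ((summable_nat_add_iff 1).2 hgeo).mul_left _
  have hT := hasFTaylorSeriesUpTo_tsum huc (by
    intro k R
    rcases lt_or_ge k M with hk | hk
    · refine ⟨fun j => C M * A * q ^ j * |R| ^ (M - k), (hgeo.mul_left _).mul_right _,
        fun j x hx => (hp2 j k x hk).trans ?_⟩
      exact mul_le_mul_of_nonneg_left
        (pow_le_pow_left₀ (norm_nonneg x) (hx.le.trans (le_abs_self R)) _)
        (mul_nonneg (mul_nonneg (hC M) hA) (by positivity))
    · refine ⟨fun j => C k * A * q ^ j, hgeo.mul_left _, fun j x _ => ?_⟩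
      rw [hp4 j k x hk]
      exact hp5 j k x hk)
  have hlows : ∀ x, Summable fun j => u j x := fun x =>
    Summable.of_norm_bounded ((hgeo.mul_left (C M * A)).mul_right (‖x‖ ^ M)) fun j => hp1 j x
  have hGH : ∀ x, HasSum (fun i => v i x) ((∑' j, u j x) + ∑' j : ℕ, B ((j : ℤ) + 1) x) := by
    intro x
    have h1 : HasSum (fun j : ℕ => v (-(j : ℤ)) x) (∑' j, u j x) := by
      simp only [hvlow]; exact (hlows x).hasSum
    have h2 : HasSum (fun j : ℕ => v (-(-((j : ℤ) + 1))) x) (∑' j : ℕ, B ((j : ℤ) + 1) x) := by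
      simp only [neg_neg, hvhigh]
      exact (Summable.of_norm_bounded hhighs fun j => hBhigh j x).hasSum
    -- The family is reflected so that the low frequencies, which include index 0, occupy the
    -- nonnegative half of ℤ.
    have h3 := HasSum.of_nat_of_neg_add_one (f := fun i : ℤ => v (-i) x) h1 h2
    exact (Equiv.neg ℤ).hasSum_iff.1 h3
  refine ⟨v, fun x => ∑' j, u j x, fun x => ∑' j : ℕ, B ((j : ℤ) + 1) x, ?_⟩
  exact {
    sub_poly := fun i => ⟨P i, rfl⟩
    continuous := fun i => (hB i).continuous.sub (contDiff_polyEval _).continuous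
    hasSum := hGH
    bound := by
      intro i x
      rcases le_or_gt i 0 with hi | hi
      · obtain ⟨j, rfl⟩ : ∃ j : ℕ, i = -(j : ℤ) := ⟨i.natAbs, by omega⟩
        rw [hvlow, Int.natAbs_neg, Int.natAbs_natCast]
        refine (hp1 j x).trans ?_
        have h1 := hD M (by simp)
        have h2 : 0 ≤ C M * A := mul_nonneg (hC M) hA
        have h3 : (0 : ℝ) ≤ ‖x‖ ^ M := by positivity
        have := h2.trans h1
        gcongr
        linarith
      · obtain ⟨j, rfl⟩ : ∃ j : ℕ, i = (j : ℤ) + 1 := ⟨i.natAbs - 1, by omega⟩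
        have h0 : ((j : ℤ) + 1).natAbs = j + 1 := by omega
        rw [hvhigh, h0]
        refine (hBhigh j x).trans ?_
        have h1 := hD 0 (by simp)
        have h2 : 0 ≤ C 0 * A := mul_nonneg (hC 0) hA
        have h3 : (0 : ℝ) ≤ ‖x‖ ^ M := by positivity
        calc _ ≤ 2 ^ M * (C 0 + C M) * S * A * q ^ (j + 1) * 1 := by rw [mul_one]; gcongr
          _ ≤ _ := by
            have := h2.trans h1
            gcongr
            linarith
    contDiff := hT.contDiff
    continuous_high := continuous_tsum (fun j => (hB _).continuous) hhighs hBhigh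
    difference := by
      intro x y
      rcases eq_or_ne y 0 with rfl | hy
      · rw [fwdDiff_zero_iter hM0, norm_zero]
        have h2 : 0 ≤ C 0 * A := mul_nonneg (hC 0) hA
        have := h2.trans (hD 0 (by simp))
        positivity
      · obtain ⟨J, hJ1, hJ2⟩ := exists_mem_Ico_zpow (norm_pos_iff.2 hy) (one_lt_two (α := ℝ))
        have h1 : ∀ i, ‖((fwdDiff y)^[M] (v i)) x‖ ≤
            2 ^ M * (C 0 + C M) * A * ‖y‖ ^ s * q ^ (i + J).natAbs := fun i =>
          norm_fwdDiff_piece_le hs hδs hδM hM.le hC hA hJ1 hJ2 (hB i) rfl (by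
            intro x
            simp only [hP]
            split_ifs
            · exact hp3 _ M x le_rfl
            · rw [map_zero]; exact congrFun iteratedFDeriv_fun_zero x) (hb i) x
        have h2 : HasSum (fun i : ℤ => 2 ^ M * (C 0 + C M) * A * ‖y‖ ^ s * q ^ (i + J).natAbs)
            (2 ^ M * (C 0 + C M) * A * ‖y‖ ^ s * S) :=
          ((Equiv.addRight J).hasSum_iff.2 hsumq.hasSum).mul_left _
        have h3 := HasSum.fwdDiff_iter y M hGH x
        refine (h3.norm_le_of_bounded h2 h1).trans (le_of_eq ?_)
        ring
    low := by
      intro k hk i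
      -- From order M on the Taylor corrections disappear and the bounds lose their dependence on x.
      -- This is why the convergence is uniform on all of ℝⁿ and involves the uncorrected pieces.
      have h1 := tendstoUniformly_tsum_nat (hgeo.mul_left (C k * A))
        (f := fun (j : ℕ) x => partialDeriv i (B (-(j : ℤ))) x)
        (fun j x => (norm_partialDeriv_le i _ x).trans (hp5 j k x hk))
      have h2 : (partialDeriv i fun x => ∑' j, u j x) =
          fun x => ∑' j : ℕ, partialDeriv i (B (-(j : ℤ))) x := by
        funext x
        have h3 : Summable fun j : ℕ => iteratedFDeriv ℝ k (B (-(j : ℤ))) x :=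
          Summable.of_norm_bounded (hgeo.mul_left (C k * A)) fun j => hp5 j k x hk
        have h4 := hT.eq_iteratedFDeriv (m := k) (by exact_mod_cast le_top) x
        simp only [partialDeriv]
        rw [← h4]
        simp only [hp4 _ k _ hk, hu]
        exact (ContinuousMultilinearMap.apply ℝ (fun _ : Fin k => E n) ℂ
          (fun l => EuclideanSpace.single (i l) (1 : ℝ))).map_tsum h3
      rw [h2]
      exact h1
    high := tendstoUniformly_tsum_nat hhighs hBhigh }

/-! ### The Littlewood–Paley series of a distribution -/

section LittlewoodPaley

variable {n : ℕ} {ψ : 𝓢(E n, ℝ)}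

theorem IsBallCutoff.exists_dilation (hψ : IsBallCutoff ψ) :
    ∃ χ : 𝓢(E n, ℂ), ∀ ξ, χ ξ = ((ψ ((2 * π) • ξ) : ℝ) : ℂ) := by
  have hc : HasCompactSupport (fun ξ : E n => ((ψ ξ : ℝ) : ℂ)) := by
    refine HasCompactSupport.of_support_subset_isCompact (isCompact_closedBall 0 2) fun ξ hξ => ?_
    rw [mem_closedBall_zero_iff]
    by_contra h
    exact hξ (by simp [hψ.eq_zero (not_le.1 h).le])
  exact exists_schwartz_dilation
    (hc.toSchwartzMap (Complex.ofRealCLM.contDiff.comp (ψ.smooth ⊤))) Real.two_pi_pos.ne'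

theorem multiplier_apply_fourier (σ : E n → ℝ) (f : 𝓢'(E n, ℂ)) (h : 𝓢(E n, ℂ)) :
    multiplier σ f (𝓕 h) =
      f (𝓕 (SchwartzMap.smulLeftCLM ℂ (fun ξ : E n => ((σ ((2 * π) • ξ) : ℝ) : ℂ)) h)) := by
  rw [multiplier, TemperedDistribution.fourierMultiplierCLM_apply_apply,
    FourierTransform.fourierInv_fourier_eq]

/-- Since φ_i = ψ_{i+1} − ψ_i, the sum over −N ≤ i < N telescopes to ψ_N − ψ_{−N}. The second term
eventually vanishes on the support of h, and the first is a cut-off receding to infinity. -/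
theorem tendsto_sum_multiplier (hψ : IsBallCutoff ψ) {φ : E n → ℝ}
    (hφ : ∀ ξ, φ ξ = ψ ((2 : ℝ)⁻¹ • ξ) - ψ ξ) (f : 𝓢'(E n, ℂ)) {h : 𝓢(E n, ℂ)}
    (hh : ⇑h =ᶠ[𝓝 0] 0) :
    Tendsto (fun N : ℕ => ∑ i ∈ Finset.Ico (-N : ℤ) N, multiplier (dyadic φ i) f (𝓕 h)) atTop
      (𝓝 (f (𝓕 h))) := by
  set X : ℤ → 𝓢(E n, ℂ) := fun i => SchwartzMap.smulLeftCLM ℂ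
    (fun ξ : E n => ((dyadic ψ i ((2 * π) • ξ) : ℝ) : ℂ)) h with hX
  have hXa : ∀ i ξ, X i ξ = ((dyadic ψ i ((2 * π) • ξ) : ℝ) : ℂ) * h ξ := fun i ξ =>
    SchwartzMap.smulLeftCLM_apply_apply (dyadic_hasTemperateGrowth ψ i) h ξ
  have hstep : ∀ i, multiplier (dyadic φ i) f (𝓕 h) = f (𝓕 (X (i + 1))) - f (𝓕 (X i)) := by
    intro i
    have e := map_sub (FourierTransform.fourierCLM ℂ 𝓢(E n, ℂ)) (X (i + 1)) (X i)
    simp only [FourierTransform.fourierCLM_apply] at e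
    rw [multiplier_apply_fourier, ← map_sub, ← e]
    congr 2
    rw [← sub_apply, ← SchwartzMap.smulLeftCLM_sub (dyadic_hasTemperateGrowth ψ (i + 1))
      (dyadic_hasTemperateGrowth ψ i)]
    congr 2
    funext ξ
    simp only [Pi.sub_apply, dyadic, hφ, Complex.ofReal_sub]
    rw [smul_smul (2 : ℝ)⁻¹, neg_add, zpow_add₀ two_ne_zero, mul_comm (2 : ℝ)⁻¹, zpow_neg_one]
  have hsum : ∀ N : ℕ, ∑ i ∈ Finset.Ico (-N : ℤ) N, multiplier (dyadic φ i) f (𝓕 h) =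
      f (𝓕 (X N)) - f (𝓕 (X (-N))) := by
    intro N
    induction N with
    | zero => simp
    | succ N ih =>
      have e1 : Finset.Ico (-(N + 1 : ℕ) : ℤ) (N + 1 : ℕ) =
          insert (-(N : ℤ) - 1) (insert (N : ℤ) (Finset.Ico (-N : ℤ) N)) := by
        ext i
        simp only [Finset.mem_Ico, Finset.mem_insert]
        push_cast
        omega
      rw [e1, Finset.sum_insert (by simp), Finset.sum_insert (by simp), ih, hstep, hstep]
      push_cast
      rw [sub_add_cancel, neg_add']
      ring
  have hlow : ∀ᶠ N : ℕ in atTop, f (𝓕 (X (-N))) = 0 := by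
    obtain ⟨ε, hε, hball⟩ := Metric.eventually_nhds_iff.1 hh
    obtain ⟨N₀, hN₀⟩ := pow_unbounded_of_one_lt (2 / (ε * (2 * π))) (one_lt_two (α := ℝ))
    filter_upwards [eventually_ge_atTop N₀] with N hN
    have : X (-N) = 0 := by
      ext ξ
      rw [hXa]
      rcases lt_or_ge ‖ξ‖ ε with h1 | h1
      · rw [hball (by simpa using h1)]
        simp
      · rw [dyadic, hψ.eq_zero]
        · simp
        · rw [neg_neg, zpow_natCast, norm_smul, norm_smul, Real.norm_of_nonneg (by positivity),
            Real.norm_of_nonneg Real.two_pi_pos.le]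
          have h2 : (2 : ℝ) ^ N₀ ≤ 2 ^ N := pow_le_pow_right₀ one_le_two hN
          rw [div_lt_iff₀ (by positivity)] at hN₀
          calc (2 : ℝ) ≤ 2 ^ N₀ * (ε * (2 * π)) := hN₀.le
            _ ≤ 2 ^ N * (‖ξ‖ * (2 * π)) := by gcongr
            _ = _ := by ring
    rw [this, FourierTransform.fourier_zero, map_zero]
  have hhigh : Tendsto (fun N : ℕ => f (𝓕 (X N))) atTop (𝓝 (f (𝓕 h))) := by
    obtain ⟨χ, hχ⟩ := hψ.exists_dilation
    have h1 := tendsto_cutoff χ (by rw [hχ, smul_zero, hψ.eq_one (by simp)]; simp) h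
      (r := fun N : ℕ => (2⁻¹ : ℝ) ^ N) (fun N => by positivity)
      (fun N => pow_le_one₀ (by norm_num) (by norm_num))
      (tendsto_pow_atTop_nhds_zero_of_lt_one (by norm_num) (by norm_num))
    have h2 : ∀ N : ℕ, SchwartzMap.smulLeftCLM ℂ (fun ξ => χ ((2⁻¹ : ℝ) ^ N • ξ)) h = X N := by
      intro N
      simp only [hX, dyadic, hχ, zpow_neg, zpow_natCast, inv_pow]
      congr 2
      funext ξ
      rw [smul_comm]
    simp only [h2] at h1
    exact ((f.cont.comp (FourierTransform.fourierCLM ℂ 𝓢(E n, ℂ)).cont).tendsto h).comp h1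
  simp only [hsum]
  have := hhigh.sub (tendsto_const_nhds.congr' (hlow.mono fun N hN => hN.symm))
  rwa [sub_zero] at this

end LittlewoodPaley

/-! ### Polynomials as distributions -/

theorem represents_monoDist {n : ℕ} (α : Fin n → ℕ) :
    Represents (mono α : E n → ℂ) (monoDist α) := by
  intro u
  refine ⟨(SchwartzMap.smulLeftCLM ℂ (mono α) u).integrable.congr (Eventually.of_forall fun x => ?_),
    ?_⟩
  · exact SchwartzMap.smulLeftCLM_apply_apply (mono_hasTemperateGrowth α) u x
  · simp only [monoDist_apply, mul_comm]

theorem Represents.smul {n : ℕ} {F : E n → ℂ} {T : 𝓢'(E n, ℂ)} (hF : Represents F T) (c : ℂ) :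
    Represents (fun x => c * F x) (c • T) := by
  intro u
  simp only [mul_assoc]
  refine ⟨(hF u).1.const_mul c, ?_⟩
  rw [integral_const_mul, ← (hF u).2]
  rfl

theorem polyEval_monomial {n : ℕ} (α : Fin n →₀ ℕ) (c : ℂ) (x : E n) :
    polyEval n (MvPolynomial.monomial α c) x = c * mono α x := by
  simp [polyEval, MvPolynomial.eval_monomial, mono, Finsupp.prod_fintype]

theorem exists_represents_polyEval {n : ℕ} (p : MvPolynomial (Fin n) ℂ) :
    ∃ T ∈ polyDist n, Represents (polyEval n p) T := by
  induction p using MvPolynomial.induction_on' with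
  | monomial α c =>
    refine ⟨c • monoDist α, Submodule.smul_mem _ _ (Submodule.subset_span ⟨_, rfl⟩), ?_⟩
    have h := (represents_monoDist (α : Fin n → ℕ)).smul c
    simpa only [← polyEval_monomial] using h
  | add p q hp hq =>
    obtain ⟨S, hS, hpS⟩ := hp
    obtain ⟨T, hT, hqT⟩ := hq
    refine ⟨S + T, Submodule.add_mem _ hS hT, ?_⟩
    rw [map_add]
    exact hpS.add hqT

theorem exists_polyEval_of_mem_polyDist {n : ℕ} {T : 𝓢'(E n, ℂ)} (hT : T ∈ polyDist n) :
    ∃ p : MvPolynomial (Fin n) ℂ, Represents (polyEval n p) T := by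
  induction hT using Submodule.span_induction with
  | mem T hT =>
    obtain ⟨α, rfl⟩ := hT
    refine ⟨MvPolynomial.monomial (Finsupp.equivFunOnFinite.symm α) 1, ?_⟩
    have : polyEval n (MvPolynomial.monomial (Finsupp.equivFunOnFinite.symm α) 1) = mono α := by
      funext x
      rw [polyEval_monomial]
      simp
    rw [this]
    exact represents_monoDist α
  | zero => exact ⟨0, fun u => by simp⟩
  | add S T _ _ hS hT =>
    obtain ⟨p, hp⟩ := hS
    obtain ⟨q, hq⟩ := hT
    refine ⟨p + q, ?_⟩
    rw [map_add]
    exact hp.add hq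
  | smul c T _ hT =>
    obtain ⟨p, hp⟩ := hT
    refine ⟨c • p, ?_⟩
    rw [map_smul]
    exact hp.smul c

theorem apply_eq_zero_of_mem_polyDist {n : ℕ} {T : 𝓢'(E n, ℂ)} (hT : T ∈ polyDist n)
    (ρ : schwartzInf n) : T ρ.1 = 0 :=
  congrArg (fun S : SchwartzInfDual n => S ρ) (polyDist_le_ker_restrict n hT)

/-! ### The reconstructed distribution -/

section

variable {n M : ℕ} {s q K : ℝ} {B v : ℤ → E n → ℂ} {G H : E n → ℂ}

theorem Reconstruction.continuous_add (R : Reconstruction s M q K B v G H) : Continuous (G + H) :=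
  R.contDiff.continuous.add R.continuous_high

theorem integrable_one_add_norm_pow_mul (M : ℕ) (u : 𝓢(E n, ℂ)) :
    Integrable (fun x => (1 + ‖x‖ ^ M) * ‖u x‖) := by
  simp only [add_mul, one_mul]
  exact u.integrable.norm.add (u.integrable_pow_mul volume M)

theorem Reconstruction.hasSum_integral (R : Reconstruction s M q K B v G H) (hq0 : 0 ≤ q)
    (hq1 : q < 1) (u : 𝓢(E n, ℂ)) :
    HasSum (fun i => ∫ x, v i x * u x) (∫ x, (G + H) x * u x) := by
  refine hasSum_integral_of_dominated_convergence
    (fun i x => K * q ^ i.natAbs * ((1 + ‖x‖ ^ M) * ‖u x‖))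
    (fun i => ((R.continuous i).mul u.continuous).aestronglyMeasurable)
    (fun i => Eventually.of_forall fun x => ?_)
    (Eventually.of_forall fun x => ?_) ?_ (Eventually.of_forall fun x => (R.hasSum x).mul_right _)
  · rw [norm_mul, ← mul_assoc]
    exact mul_le_mul_of_nonneg_right (R.bound i x) (norm_nonneg _)
  · exact ((summable_pow_natAbs hq0 hq1).mul_left K).mul_right _
  · simp only [tsum_mul_right]
    exact (integrable_one_add_norm_pow_mul M u).const_mul _

theorem Reconstruction.norm_integral_le (R : Reconstruction s M q K B v G H) (hq0 : 0 ≤ q)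
    (hq1 : q < 1) (u : 𝓢(E n, ℂ)) :
    ‖∫ x, (G + H) x * u x‖ ≤
      K * ((∑' i : ℤ, q ^ i.natAbs) * ∫ x, (1 + ‖x‖ ^ M) * ‖u x‖) := by
  rw [← integral_const_mul, ← integral_const_mul]
  refine norm_integral_le_of_norm_le (((integrable_one_add_norm_pow_mul M u).const_mul _).const_mul _)
    (Eventually.of_forall fun x => ?_)
  rw [norm_mul]
  have h1 : HasSum (fun i : ℤ => K * q ^ i.natAbs * (1 + ‖x‖ ^ M))
      (K * (∑' i : ℤ, q ^ i.natAbs) * (1 + ‖x‖ ^ M)) :=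
    ((summable_pow_natAbs hq0 hq1).hasSum.mul_left K).mul_right _
  have h2 := (R.hasSum x).norm_le_of_bounded h1 fun i => R.bound i x
  calc _ ≤ K * (∑' i : ℤ, q ^ i.natAbs) * (1 + ‖x‖ ^ M) * ‖u x‖ :=
        mul_le_mul_of_nonneg_right h2 (norm_nonneg _)
    _ = _ := by ring

theorem Reconstruction.integral_piece (R : Reconstruction s M q K B v G H) {i : ℤ}
    {T : 𝓢'(E n, ℂ)} (hT : Represents (B i) T) (ρ : schwartzInf n) :
    ∫ x, v i x * ρ.1 x = T ρ.1 := by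
  obtain ⟨p, hp⟩ := R.sub_poly i
  obtain ⟨P, hP, hpP⟩ := exists_represents_polyEval p
  simp only [hp, sub_mul]
  rw [integral_sub (hT ρ.1).1 (hpP ρ.1).1, ← (hT ρ.1).2, ← (hpP ρ.1).2,
    apply_eq_zero_of_mem_polyDist hP, sub_zero]

/-- On 𝓕h with h vanishing near 0, all moments are zero, so v_i and φ_i(D)f have the same pairing.
Summing over symmetric intervals gives both T(𝓕h) and f(𝓕h), and the support theorem applies. -/
theorem Reconstruction.sub_mem_polyDist (R : Reconstruction s M q K B v G H) (hq0 : 0 ≤ q)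
    (hq1 : q < 1) {ψ : 𝓢(E n, ℝ)} (hψ : IsBallCutoff ψ) {φ : E n → ℝ}
    (hφ : ∀ ξ, φ ξ = ψ ((2 : ℝ)⁻¹ • ξ) - ψ ξ) {f T : 𝓢'(E n, ℂ)}
    (hB : ∀ j, Represents (B j) (multiplier (dyadic φ j) f)) (hT : Represents (G + H) T) :
    f - T ∈ polyDist n := by
  refine mem_polyDist_of_vanishing _ fun h hh => ?_
  have h1 := R.hasSum_integral hq0 hq1 (𝓕 h)
  rw [← (hT _).2] at h1
  have h2 := fun i => R.integral_piece (hB i) ⟨𝓕 h, fourier_mem_schwartzInf h hh⟩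
  simp only [h2] at h1
  have h3 := h1.comp (Finset.tendsto_Ico_neg (R := ℤ))
  have h4 := tendsto_nhds_unique (tendsto_sum_multiplier hψ hφ f hh) h3
  rw [sub_apply, h4, sub_self]

theorem exists_represents_of_fwdDiff (hM : 0 < M) (hs : 0 < s) {F : E n → ℂ} (hF : Continuous F)
    (hK : ∀ x y, ‖((fwdDiff y)^[M] F) x‖ ≤ K * ‖y‖ ^ s) : ∃ T, Represents F T := by
  obtain ⟨C, N, h⟩ := exists_polynomial_growth hM hs hF hK
  exact exists_represents hF.aestronglyMeasurable h

end

/-! ### Polynomials in the Hölder–Zygmund space -/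

theorem Represents.unique_function {n : ℕ} {F F' : E n → ℂ} {T : 𝓢'(E n, ℂ)} (hF : Continuous F)
    (hF' : Continuous F') (h : Represents F T) (h' : Represents F' T) : F = F' := by
  refine (Continuous.ae_eq_iff_eq (volume : Measure (E n)) hF hF').1 ?_
  refine ae_eq_of_integral_contDiff_smul_eq hF.locallyIntegrable hF'.locallyIntegrable
    fun g hg hc => ?_
  have hc' : HasCompactSupport fun x => ((g x : ℝ) : ℂ) :=
    hc.comp_left (g := fun t : ℝ => (t : ℂ)) Complex.ofReal_zero
  have e := (h (hc'.toSchwartzMap (Complex.ofRealCLM.contDiff.comp hg))).2.symm.trans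
    (h' (hc'.toSchwartzMap (Complex.ofRealCLM.contDiff.comp hg))).2
  have e1 : ∀ F : E n → ℂ, ∀ x, g x • F x =
      F x * hc'.toSchwartzMap (Complex.ofRealCLM.contDiff.comp hg) x := fun F x => by
    rw [Complex.real_smul, mul_comm]
    rfl
  simp only [e1]
  exact e

theorem mono_smul {n : ℕ} (α : Fin n →₀ ℕ) (c : ℝ) (x : E n) :
    mono α (c • x) = (c : ℂ) ^ α.degree * mono α x := by
  simp [mono, mul_pow, Finset.prod_mul_distrib, Finset.prod_pow_eq_pow_sum, Finsupp.degree_eq_sum]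

theorem polyEval_eq_sum {n : ℕ} (p : MvPolynomial (Fin n) ℂ) (x : E n) :
    polyEval n p x = ∑ m ∈ p.support, p.coeff m * mono m x := by
  simp [polyEval, mono, MvPolynomial.eval_eq']

/-- Along the multiples ky a monomial is a power of k. The d-th difference kills powers of exponent
below d and sends k^d to d!, leaving the top homogeneous part. -/
theorem fwdDiff_iter_polyEval_zero {n d : ℕ} {p : MvPolynomial (Fin n) ℂ} (hp : p.totalDegree ≤ d)
    (y : E n) : ((fwdDiff y)^[d] (polyEval n p)) 0 =
      d.factorial * polyEval n (MvPolynomial.homogeneousComponent d p) y := by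
  have hpow : ∀ m ∈ p.support, ∑ k ∈ Finset.range (d + 1),
      ((-1 : ℤ) ^ (d - k) * d.choose k) • ((k : ℂ) ^ m.degree) =
        if m.degree = d then (d.factorial : ℂ) else 0 := by
    intro m hm
    have h1 := fwdDiff_iter_eq_sum_shift (1 : ℂ) (fun r : ℂ => r ^ m.degree) d 0
    simp only [zero_add, nsmul_eq_mul, mul_one] at h1
    rw [← h1]
    split_ifs with h
    · rw [h, fwdDiff_iter_eq_factorial]
      rfl
    · have h2 : m.degree < d :=
        lt_of_le_of_ne ((MvPolynomial.le_totalDegree hm).trans hp) h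
      rw [fwdDiff_iter_pow_eq_zero_of_lt h2]
      rfl
  have hsm : ∀ (k : ℕ) (m : Fin n →₀ ℕ), mono m (k • y) = (k : ℂ) ^ m.degree * mono m y := by
    intro k m
    rw [← Nat.cast_smul_eq_nsmul ℝ, mono_smul]
    norm_cast
  rw [fwdDiff_iter_eq_sum_shift]
  simp only [zero_add, polyEval_eq_sum p, hsm, Finset.smul_sum]
  rw [Finset.sum_comm, MvPolynomial.homogeneousComponent_apply, map_sum, Finset.sum_apply,
    Finset.mul_sum, Finset.sum_filter]
  refine Finset.sum_congr rfl fun m hm => ?_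
  rw [polyEval_monomial]
  have h3 : ∀ k : ℕ, ((-1 : ℤ) ^ (d - k) * d.choose k) • (p.coeff m * ((k : ℂ) ^ m.degree * mono m y))
      = (((-1 : ℤ) ^ (d - k) * d.choose k) • ((k : ℂ) ^ m.degree)) * (p.coeff m * mono m y) := by
    intro k
    simp only [zsmul_eq_mul]
    ring
  simp only [h3]
  rw [← Finset.sum_mul, hpow m hm]
  split_ifs
  · rfl
  · rw [zero_mul]

theorem polyEval_eq_zero_iff {n : ℕ} {p : MvPolynomial (Fin n) ℂ} :
    (∀ x, polyEval n p x = 0) ↔ p = 0 := by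
  refine ⟨fun h => ?_, fun h x => by rw [h]; simp⟩
  refine MvPolynomial.funext_set (fun _ => Set.range ((↑) : ℝ → ℂ))
    (fun _ => Set.infinite_range_of_injective Complex.ofReal_injective) fun x hx => ?_
  choose t ht using fun i => hx i (Set.mem_univ i)
  have h1 := h (WithLp.toLp 2 t)
  rw [map_zero, ← h1]
  simp [polyEval, ht]

/-- If the degree d exceeded [s], then d > s and d ≥ M. Taking d − M further differences with step
rv gives r^d ≤ const · r^s, which fails as r → ∞ when v is not a zero of the leading form. -/
theorem totalDegree_le_of_fwdDiff_le {n M : ℕ} {s K : ℝ} (hM : M ≤ ⌊s⌋₊ + 1) (hs : 0 < s)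
    {p : MvPolynomial (Fin n) ℂ}
    (hK : ∀ x y, ‖((fwdDiff y)^[M] (polyEval n p)) x‖ ≤ K * ‖y‖ ^ s) :
    p.totalDegree ≤ ⌊s⌋₊ := by
  by_contra! hlt
  set d := p.totalDegree with hd
  have hsd : s < d := (Nat.floor_lt hs.le).1 hlt
  have hp0 : p.support.Nonempty := by
    rw [Finset.nonempty_iff_ne_empty, ne_eq, MvPolynomial.support_eq_empty]
    rintro rfl
    simp [hd] at hlt
  obtain ⟨m, hm, hmd⟩ := Finset.exists_mem_eq_sup p.support hp0 fun m => m.degree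
  have hmd' : m.degree = d := hmd.symm
  have hne : MvPolynomial.homogeneousComponent d p ≠ 0 := by
    intro h
    have h1 := congrArg (MvPolynomial.coeff m) h
    rw [MvPolynomial.coeff_homogeneousComponent, if_pos hmd'] at h1
    exact MvPolynomial.mem_support_iff.1 hm h1
  have hQ : ∃ v, polyEval n (MvPolynomial.homogeneousComponent d p) v ≠ 0 := by
    by_contra! h
    exact hne (polyEval_eq_zero_iff.1 h)
  obtain ⟨v, hv⟩ := hQ
  have hscale : ∀ r : ℝ, polyEval n (MvPolynomial.homogeneousComponent d p) (r • v) =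
      (r : ℂ) ^ d * polyEval n (MvPolynomial.homogeneousComponent d p) v := by
    intro r
    rw [polyEval_eq_sum, polyEval_eq_sum, Finset.mul_sum]
    refine Finset.sum_congr rfl fun α hα => ?_
    rw [mono_smul]
    have : α.degree = d := by
      rw [MvPolynomial.mem_support_iff, MvPolynomial.coeff_homogeneousComponent] at hα
      by_contra h
      simp [h] at hα
    rw [this]
    ring
  set c := (d.factorial : ℝ) * ‖polyEval n (MvPolynomial.homogeneousComponent d p) v‖ with hc
  have hc0 : 0 < c := mul_pos (by exact_mod_cast d.factorial_pos) (norm_pos_iff.2 hv)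
  have hbound : ∀ r : ℝ, 0 < r → r ^ ((d : ℝ) - s) * c ≤ 2 ^ (d - M) * K * ‖v‖ ^ s := by
    intro r hr
    have h1 := norm_fwdDiff_iter_le (r • v) (d - M) (fun x => hK x (r • v)) 0
    rw [← Function.iterate_add_apply, Nat.sub_add_cancel (by omega),
      fwdDiff_iter_polyEval_zero le_rfl, hscale, norm_mul, norm_mul, norm_pow, Complex.norm_real,
      Complex.norm_natCast, Real.norm_of_nonneg hr.le, norm_smul, Real.norm_of_nonneg hr.le,
      Real.mul_rpow hr.le (norm_nonneg v)] at h1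
    have hrs : 0 < r ^ s := Real.rpow_pos_of_pos hr s
    refine le_of_mul_le_mul_left ?_ hrs
    calc r ^ s * (r ^ ((d : ℝ) - s) * c) = r ^ d * c := by
          rw [← mul_assoc, ← Real.rpow_add hr, add_sub_cancel, Real.rpow_natCast]
      _ ≤ 2 ^ (d - M) * (K * (r ^ s * ‖v‖ ^ s)) := by rw [hc]; linarith
      _ = _ := by ring
  have hlim : Tendsto (fun r : ℝ => r ^ ((d : ℝ) - s) * c) atTop atTop :=
    (tendsto_rpow_atTop (by linarith)).atTop_mul_const hc0
  obtain ⟨r, hr1, hr2⟩ := ((hlim.eventually_gt_atTop _).and (eventually_gt_atTop 0)).exists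
  exact absurd (hbound r hr2) (not_le.2 hr1)

/-! ### Functions of the Hölder–Zygmund space as distributions -/

section Zygmund

variable {n : ℕ} {s : ℝ}

theorem Zyg.continuous (F : Zyg n s) : Continuous (Zyg.toFun n s F) := F.2.1

theorem Zyg.norm_fwdDiff_le (hs : 0 < s) (F : Zyg n s) (x y : E n) :
    ‖((fwdDiff y)^[⌊s + 1⌋₊] (Zyg.toFun n s F)) x‖ ≤ ‖F‖ * ‖y‖ ^ s := by
  rcases eq_or_ne y 0 with rfl | hy
  · rw [fwdDiff_zero_iter (by rw [Nat.floor_add_one hs.le]; omega), norm_zero]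
    positivity
  · have h := le_ciSup (Zyg.bdd F) (x, y)
    have h0 : 0 < ‖y‖ ^ s := Real.rpow_pos_of_pos (norm_pos_iff.2 hy) s
    rw [zygQuot, div_le_iff₀ h0] at h
    exact h

theorem Zyg.exists_of_fwdDiff_le {F : E n → ℂ} {K : ℝ} (hK0 : 0 ≤ K) (hF : Continuous F)
    (hK : ∀ x y, ‖((fwdDiff y)^[⌊s + 1⌋₊] F) x‖ ≤ K * ‖y‖ ^ s) : ∃ F' : Zyg n s, Zyg.toFun n s F' = F := by
  refine ⟨⟨F, hF, K, ?_⟩, rfl⟩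
  rintro _ ⟨⟨x, y⟩, rfl⟩
  exact div_le_of_le_mul₀ (by positivity) hK0 (hK x y)

theorem Zyg.exists_represents (hs : 0 < s) (F : Zyg n s) : ∃ T, Represents (Zyg.toFun n s F) T :=
  exists_represents_of_fwdDiff (by rw [Nat.floor_add_one hs.le]; omega) hs F.continuous
    (F.norm_fwdDiff_le hs)

/-- F and the polynomial are continuous functions representing the same distribution, so they
coincide pointwise. The seminorm of F then limits the degree. -/
theorem Zyg.mem_polyZyg_of_represents (hs : 0 < s) {F : Zyg n s} {T : 𝓢'(E n, ℂ)}
    (hF : Represents (Zyg.toFun n s F) T) (hT : T ∈ polyDist n) : F ∈ polyZyg n s ⌊s⌋₊ := by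
  obtain ⟨p, hp⟩ := exists_polyEval_of_mem_polyDist hT
  have h := hF.unique_function F.continuous (contDiff_polyEval p).continuous hp
  refine ⟨p, ?_, h.symm⟩
  rw [SetLike.mem_coe, MvPolynomial.mem_restrictTotalDegree]
  refine totalDegree_le_of_fwdDiff_le (Nat.floor_add_one hs.le).le hs (K := ‖F‖) ?_
  rw [← h]
  exact F.norm_fwdDiff_le hs

theorem Zyg.apply_eq_zero_of_mem_polyZyg {F : Zyg n s} {T : 𝓢'(E n, ℂ)} {d : ℕ}
    (hF : Represents (Zyg.toFun n s F) T) (h : F ∈ polyZyg n s d) (ρ : schwartzInf n) :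
    T ρ.1 = 0 := by
  obtain ⟨p, -, hp⟩ := h
  obtain ⟨P, hP, hpP⟩ := exists_represents_polyEval p
  rw [hp] at hpP
  rw [hF.unique hpP]
  exact apply_eq_zero_of_mem_polyDist hP ρ

theorem linftyNorm_le_of_represents {T : 𝓢'(E n, ℂ)} {b : E n → ℂ} {a : ℝ} (hb : Continuous b)
    (ha : ∀ x, ‖b x‖ ≤ a) (hT : Represents b T) : linftyNorm T ≤ ENNReal.ofReal a := by
  have hm : MemLp b ⊤ (volume : Measure (E n)) :=
    memLp_top_of_bound hb.aestronglyMeasurable a (Eventually.of_forall ha)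
  refine (iInf₂_le hm.toLp ((represents_toTemperedDistribution hm).unique hT)).trans ?_
  rw [Lp.enorm_toLp]
  exact eLpNormEssSup_le_of_ae_bound (Eventually.of_forall ha)

theorem Zyg.besovNorm_lt_top (hs : 0 < s) {θ : 𝓢(E n, ℝ)} (hθ : IsAnnulusCutoff θ) {F : Zyg n s}
    {T : 𝓢'(E n, ℂ)} (hF : Represents (Zyg.toFun n s F) T) : besovNorm θ s T < ⊤ := by
  obtain ⟨C, hC, h⟩ := exists_represents_annulus_multiplier (M := ⌊s + 1⌋₊) (s := s) hθ
  refine lt_of_le_of_lt (iSup_le fun j => ?_) (ENNReal.ofReal_lt_top (r := C * ‖F‖))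
  obtain ⟨b, hb, hbb, hbr⟩ := h _ _ F.continuous (F.norm_fwdDiff_le hs) T hF j
  refine (mul_le_mul_right (linftyNorm_le_of_represents hb hbb hbr) _).trans ?_
  rw [← ENNReal.ofReal_mul (by positivity)]
  refine ENNReal.ofReal_le_ofReal (le_of_eq ?_)
  rw [mul_left_comm, ← Real.rpow_add two_pos]
  simp

/-- The seminorm of F gives no pointwise control, since it ignores polynomials of degree at most
[s]. Replacing F by its reconstruction changes nothing on ρ and gives growth at most a multiple of
‖F‖(1 + |x|^M). -/
theorem Zyg.exists_norm_integral_le (n : ℕ) (hs : 0 < s) {θ ψ : 𝓢(E n, ℝ)}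
    (hθ : IsAnnulusCutoff θ) (hψ : IsBallCutoff ψ) {φ : E n → ℝ}
    (hφ : ∀ ξ, φ ξ = ψ ((2 : ℝ)⁻¹ • ξ) - ψ ξ) (ρ : schwartzInf n) :
    ∃ D : ℝ, ∀ F : Zyg n s, ‖∫ x, Zyg.toFun n s F x * ρ.1 x‖ ≤ D * ‖F‖ := by
  obtain ⟨C₁, hC₁, h₁⟩ := exists_represents_annulus_multiplier (M := ⌊s + 1⌋₊) (s := s) hθ
  obtain ⟨C₂, hC₂, h₂⟩ := exists_pieces s hθ hψ hφ
  have hM : s < (⌊s + 1⌋₊ : ℝ) := by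
    rw [Nat.floor_add_one hs.le]; exact_mod_cast Nat.lt_floor_add_one s
  obtain ⟨D, q, hD, hq0, hq1, h₃⟩ := exists_reconstruction n hs hM hC₂
  refine ⟨D * C₁ * ((∑' i : ℤ, q ^ i.natAbs) * ∫ x, (1 + ‖x‖ ^ ⌊s + 1⌋₊) * ‖ρ.1 x‖), fun F => ?_⟩
  obtain ⟨T, hT⟩ := F.exists_represents hs
  choose b hb hbb hbr using h₁ _ _ F.continuous (F.norm_fwdDiff_le hs) T hT
  obtain ⟨B, hB⟩ := h₂ T _ b (fun j => (hb j).aestronglyMeasurable) hbb hbr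
  obtain ⟨v, G, H, R⟩ := h₃ _ B (mul_nonneg hC₁ (norm_nonneg F)) (fun j => (hB j).1)
    fun j => (hB j).2.1
  obtain ⟨S, hS⟩ := exists_represents_of_fwdDiff (by rw [Nat.floor_add_one hs.le]; omega) hs
    R.continuous_add R.difference
  have h4 := apply_eq_zero_of_mem_polyDist
    (R.sub_mem_polyDist hq0 hq1 hψ hφ (fun j => (hB j).2.2) hS) ρ
  rw [sub_apply, sub_eq_zero] at h4
  rw [← (hT ρ.1).2, h4, (hS ρ.1).2]
  refine (R.norm_integral_le hq0 hq1 ρ.1).trans (le_of_eq ?_)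
  ring

end Zygmund

/-! ### The embedding into `𝓢_∞'` -/

section Embedding

variable {n : ℕ} {s : ℝ}

/-- The tempered distribution `ρ ↦ ∫ F ρ`, as a linear function of `F`. -/
theorem exists_zygDist (n : ℕ) (hs : 0 < s) :
    ∃ L : Zyg n s →ₗ[ℂ] 𝓢'(E n, ℂ), ∀ F, Represents (Zyg.toFun n s F) (L F) := by
  choose T hT using fun F : Zyg n s => F.exists_represents hs
  refine ⟨{ toFun := T, map_add' := fun F G => ?_, map_smul' := fun c F => ?_ }, hT⟩
  · refine (hT (F + G)).unique ?_
    rw [map_add]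
    exact (hT F).add (hT G)
  · refine (hT (c • F)).unique ?_
    rw [map_smul]
    exact (hT F).smul c

theorem exists_embedding (n : ℕ) (hs : 0 < s) {θ ψ : 𝓢(E n, ℝ)}
    (hθ : IsAnnulusCutoff θ) (hψ : IsBallCutoff ψ) {φ : E n → ℝ}
    (hφ : ∀ ξ, φ ξ = ψ ((2 : ℝ)⁻¹ • ξ) - ψ ξ) :
    ∃ ι : ZygQuot n s →L[ℂ] SchwartzInfDual n,
      Function.Injective ι ∧
      (∀ (F : Zyg n s) (ρ : schwartzInf n),
        Integrable (fun x => Zyg.toFun n s F x * ρ.1 x) ∧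
        ι ((polyZyg n s ⌊s⌋₊).mkQ F) ρ = ∫ x, Zyg.toFun n s F x * ρ.1 x) ∧
      (∀ F : Zyg n s, ι ((polyZyg n s ⌊s⌋₊).mkQ F) ∈ restrictQuot n '' besov θ s) := by
  obtain ⟨L, hL⟩ := exists_zygDist n hs
  have hker : polyZyg n s ⌊s⌋₊ ≤ LinearMap.ker ((restrict n).toLinearMap ∘ₗ L) := by
    intro F hF
    rw [LinearMap.mem_ker]
    ext ρ
    exact Zyg.apply_eq_zero_of_mem_polyZyg (hL F) hF ρ
  set ι₀ : ZygQuot n s →ₗ[ℂ] SchwartzInfDual n :=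
    (polyZyg n s ⌊s⌋₊).liftQ ((restrict n).toLinearMap ∘ₗ L) hker
  have hcont : Continuous ι₀ := by
    refine PointwiseConvergenceCLM.continuous_of_continuous_eval fun ρ => ?_
    obtain ⟨D, hD⟩ := Zyg.exists_norm_integral_le n hs hθ hψ hφ ρ
    have h1 : Continuous fun F : Zyg n s => L F ρ.1 := by
      refine AddMonoidHomClass.continuous_of_bound
        (⟨⟨fun F => L F ρ.1, by simp⟩, 
          fun F G => congrArg (fun S : 𝓢'(E n, ℂ) => S ρ.1) (map_add L F G)⟩ : Zyg n s →+ ℂ) D fun F => ?_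
      have := hD F
      rwa [← (hL F ρ.1).2] at this
    -- Continuity out of the quotient is tested before passing to classes, where the linear bound by
    -- the seminorm is available.
    exact (Submodule.isQuotientMap_mkQ _).continuous_iff.2 h1
  refine ⟨⟨ι₀, hcont⟩, ?_, fun F ρ => ⟨(hL F ρ.1).1, (hL F ρ.1).2⟩, fun F => ?_⟩
  · refine (injective_iff_map_eq_zero ι₀).2 fun x hx => ?_
    obtain ⟨F, rfl⟩ := (polyZyg n s ⌊s⌋₊).mkQ_surjective x
    rw [Submodule.mkQ_apply, Submodule.Quotient.mk_eq_zero]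
    -- Only the functions 𝓕h with h vanishing near 0 are needed from 𝓢_∞ to force a polynomial.
    refine Zyg.mem_polyZyg_of_represents hs (hL F) (mem_polyDist_of_vanishing _ fun h hh => ?_)
    exact congrArg (fun S : SchwartzInfDual n => S ⟨𝓕 h, fourier_mem_schwartzInf h hh⟩) hx
  · exact ⟨(polyDist n).mkQ (L F),
      (mk_mem_besov_iff θ hθ s _).2 (Zyg.besovNorm_lt_top hs hθ (hL F)), rfl⟩

end Embedding

/-! ### The converse -/

theorem Represents.congr_ae {n : ℕ} {F G : E n → ℂ} {T : 𝓢'(E n, ℂ)} (hF : Represents F T)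
    (h : F =ᵐ[volume] G) : Represents G T := fun u =>
  have e : (fun x => F x * u x) =ᵐ[volume] fun x => G x * u x := h.mono fun x hx => by
    simp only [hx]
  ⟨(hF u).1.congr e, (hF u).2.trans (integral_congr_ae e)⟩

/-- The norm is an infimum, so a strict inequality selects a function. Setting it to zero on a null
set makes the bound hold everywhere, as the convolution estimates require. -/
theorem exists_represents_of_linftyNorm_lt {n : ℕ} {T : 𝓢'(E n, ℂ)} {a : ℝ}
    (h : linftyNorm T < ENNReal.ofReal a) : ∃ g : E n → ℂ, AEStronglyMeasurable g volume ∧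
      (∀ x, ‖g x‖ ≤ a) ∧ Represents g T := by
  have ha : 0 ≤ a := (ENNReal.ofReal_pos.1 (bot_le.trans_lt h)).le
  simp only [linftyNorm, iInf_lt_iff] at h
  obtain ⟨g, hg, hga⟩ := h
  have hm : MeasurableSet {x | ‖g x‖ ≤ a} :=
    measurableSet_le (Lp.stronglyMeasurable g).measurable.norm measurable_const
  refine ⟨{x | ‖g x‖ ≤ a}.indicator g, (Lp.aestronglyMeasurable g).indicator hm, fun x => ?_, ?_⟩
  · by_cases hx : x ∈ {x | ‖g x‖ ≤ a}
    · rw [Set.indicator_of_mem hx]; exact hx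
    · rw [Set.indicator_of_notMem hx, norm_zero]; exact ha
  · have h1 := represents_toTemperedDistribution (Lp.memLp g)
    rw [Lp.toLp_coeFn, hg] at h1
    refine h1.congr_ae ?_
    have h2 : ∀ᵐ x ∂volume, ‖g x‖ₑ ≤ ‖g‖ₑ := by
      have := ae_le_eLpNormEssSup (f := g) (μ := (volume : Measure (E n)))
      rwa [← eLpNorm_exponent_top, ← Lp.enorm_def] at this
    filter_upwards [h2] with x hx
    rw [Set.indicator_of_mem]
    change ‖g x‖ ≤ a
    have := hx.trans hga.le
    rwa [← ofReal_norm, ENNReal.ofReal_le_ofReal_iff ha] at this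

theorem exists_represents_of_besovNorm_lt_top {n : ℕ} {s : ℝ} {θ : 𝓢(E n, ℝ)} {f : 𝓢'(E n, ℂ)}
    (h : besovNorm θ s f < ⊤) : ∃ A : ℝ, 0 ≤ A ∧ ∀ j : ℤ, ∃ g : E n → ℂ,
      AEStronglyMeasurable g volume ∧ (∀ x, ‖g x‖ ≤ A * (2 : ℝ) ^ (-(j : ℝ) * s)) ∧
      Represents g (multiplier (dyadic θ j) f) := by
  -- The added 1 provides the strict inequality, also when the Besov norm is zero.
  refine ⟨(besovNorm θ s f).toReal + 1, by positivity, fun j => exists_represents_of_linftyNorm_lt ?_⟩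
  have h1 : ENNReal.ofReal ((2 : ℝ) ^ ((j : ℝ) * s)) * linftyNorm (multiplier (dyadic θ j) f) ≤
      besovNorm θ s f :=
    le_iSup (fun j : ℤ => ENNReal.ofReal ((2 : ℝ) ^ ((j : ℝ) * s)) *
      linftyNorm (multiplier (dyadic θ j) f)) j
  have h2 : besovNorm θ s f < ENNReal.ofReal ((besovNorm θ s f).toReal + 1) := by
    rw [ENNReal.lt_ofReal_iff_toReal_lt h.ne]
    exact lt_add_one _
  have h3 : 0 < (2 : ℝ) ^ (-(j : ℝ) * s) := by positivity
  have h4 : ENNReal.ofReal ((2 : ℝ) ^ (-(j : ℝ) * s)) * ENNReal.ofReal ((2 : ℝ) ^ ((j : ℝ) * s)) = 1 := by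
    rw [← ENNReal.ofReal_mul h3.le, ← Real.rpow_add two_pos]
    simp
  calc linftyNorm (multiplier (dyadic θ j) f)
      = ENNReal.ofReal ((2 : ℝ) ^ (-(j : ℝ) * s)) * (ENNReal.ofReal ((2 : ℝ) ^ ((j : ℝ) * s)) *
          linftyNorm (multiplier (dyadic θ j) f)) := by rw [← mul_assoc, h4, one_mul]
    _ ≤ ENNReal.ofReal ((2 : ℝ) ^ (-(j : ℝ) * s)) * besovNorm θ s f := by gcongr
    _ < ENNReal.ofReal ((2 : ℝ) ^ (-(j : ℝ) * s)) *
          ENNReal.ofReal ((besovNorm θ s f).toReal + 1) :=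
        ENNReal.mul_lt_mul_right (ENNReal.ofReal_pos.2 h3).ne' ENNReal.ofReal_ne_top h2
    _ = _ := by rw [← ENNReal.ofReal_mul h3.le, mul_comm]

end HomBesov

/-! ### Assembly of the embedding and its converse. -/

open HomBesov in
theorem mainTheorem2 (n : ℕ) (s : ℝ) (hs : 0 < s)
    (θ : 𝓢(E n, ℝ)) (hθ : IsAnnulusCutoff θ)
    (ψ : 𝓢(E n, ℝ)) (hψ : IsBallCutoff ψ)
    (φ : E n → ℝ) (hφ : ∀ ξ, φ ξ = ψ ((2 : ℝ)⁻¹ • ξ) - ψ ξ) :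
    -- the continuous embedding of the quotient space into `𝓢_∞'`, and its range
    (∃ ι : ZygQuot n s →L[ℂ] SchwartzInfDual n,
      Function.Injective ι ∧
      (∀ (F : Zyg n s) (ρ : schwartzInf n),
        Integrable (fun x => Zyg.toFun n s F x * ρ.1 x) ∧
        ι ((polyZyg n s ⌊s⌋₊).mkQ F) ρ = ∫ x, Zyg.toFun n s F x * ρ.1 x) ∧
      (∀ F : Zyg n s, ι ((polyZyg n s ⌊s⌋₊).mkQ F) ∈ restrictQuot n '' besov θ s)) ∧
    -- the converse
    (∀ f : 𝓢'(E n, ℂ), (polyDist n).mkQ f ∈ besov θ s →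
      -- `B j` is the smooth function `φ_j(D) f`
      ∃ B : ℤ → E n → ℂ,
        (∀ j, ContDiff ℝ ∞ (B j) ∧ Represents (B j) (multiplier (dyadic φ j) f)) ∧
      ∃ (F : Zyg n s) (T : 𝓢'(E n, ℂ)) (G H : E n → ℂ),
        Represents (Zyg.toFun n s F) T ∧ f - T ∈ polyDist n ∧
        Zyg.toFun n s F = G + H ∧
        ContDiff ℝ ∞ G ∧ Continuous H ∧
        (∀ (k : ℕ), ⌊s + 1⌋₊ ≤ k → ∀ i : Fin k → Fin n,
          TendstoUniformly
            (fun (N : ℕ) x => ∑ j ∈ Finset.range N, partialDeriv i (B (-(j : ℤ))) x)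
            (partialDeriv i G) atTop) ∧
        TendstoUniformly
          (fun (N : ℕ) x => ∑ j ∈ Finset.range N, B ((j : ℤ) + 1) x) H atTop) := by
  refine ⟨exists_embedding n hs hθ hψ hφ, fun f hf => ?_⟩
  have hM : s < (⌊s + 1⌋₊ : ℝ) := by
    rw [Nat.floor_add_one hs.le]
    exact_mod_cast Nat.lt_floor_add_one s
  obtain ⟨A, hA, h⟩ :=
    exists_represents_of_besovNorm_lt_top ((mk_mem_besov_iff θ hθ s f).1 hf)
  choose g hg hgb hgr using h
  obtain ⟨C, hC, h₁⟩ := exists_pieces s hθ hψ hφ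
  obtain ⟨B, hB⟩ := h₁ f A g hg hgb hgr
  obtain ⟨D, q, hD, hq0, hq1, h₂⟩ := exists_reconstruction n hs hM hC
  obtain ⟨v, G, H, R⟩ := h₂ A B hA (fun j => (hB j).1) fun j => (hB j).2.1
  -- The reconstruction was run with M = [s+1], so its difference estimate is the Hölder–Zygmund
  -- condition for G + H.
  obtain ⟨F, hF⟩ := Zyg.exists_of_fwdDiff_le (mul_nonneg hD hA) R.continuous_add R.difference
  obtain ⟨T, hT⟩ := F.exists_represents hs
  refine ⟨B, fun j => ⟨(hB j).1, (hB j).2.2⟩, F, T, G, H, hT, ?_, hF, R.contDiff,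
    R.continuous_high, R.low, R.high⟩
  rw [hF] at hT
  exact R.sub_mem_polyDist hq0 hq1 hψ hφ (fun j => (hB j).2.2) hT
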